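/- Let $S^2$ be the unit sphere of Euclidean $3$-space with spherical distance $|ab|\in[0,\pi]$, the length of the shorter great-circle arc joining $a$ and $b$. A set $C\subseteq S^2$ is convex if it contains no pair of antipodes and contains, with any two of its points, the shorter great-circle arc joining them; a convex body is a closed convex set with non-empty interior. The convex hull of a subset of a convex set is the intersection of all convex sets containing it. A spherically convex $n$-gon ($n\ge 3$) is the convex hull of $n$ points (its vertices) that lie in a convex set and none of which belongs to the convex hull of the others. A lune is the intersection $G\cap H$ of two hemispheres $G\ne H$ whose centers are not antipodes. Its thickness is the distance between the centers of the two semicircles $\mathrm{bd}(G)\cap H$ and $\mathrm{bd}(H)\cap G$ that bound it. The thickness $\Delta(C)$ of a convex body $C$ is the minimal thickness of a lune containing $C$. A convex body $C$ is reduced if $\Delta(R)<\Delta(C)$ for every convex body $R\subsetneq C$. Write $\mathrm{diam}(C)=\sup\{|xy| : x,y\in C\}$. A regular spherical triangle is a spherically convex $3$-gon with sides of equal length and interior angles of equal measure. **Theorem.** Let $V=v_1\cdots v_n$ be a reduced spherically convex $n$-gon with $\Delta(V)<\frac{\pi}{2}$, and put $$\gamma=\arcsin\frac{-\cos\Delta(V)+\sqrt{\cos^2\Delta(V)+8}}{4}.$$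 Then $$\mathrm{diam}(V)\le 2\arccos\Big(\frac{1}{2\sin\gamma}\Big),$$ with equality if and only if $V$ is a regular spherical triangle. -/

import Mathlib

noncomputable section

namespace SphericalPolygon

/-- Euclidean three-space. -/
abbrev E3 : Type := EuclideanSpace ℝ (Fin 3)

/-- The unit sphere of Euclidean three-space, with the subspace topology. -/
abbrev S2 : Type := Metric.sphere (0 : E3) 1

/-- The spherical distance `|ab|`, that is, the length of the shorter great-circle arc from `a`
to `b` (equal to `π` for antipodes). -/
def sdist (a b : S2) : ℝ := InnerProductGeometry.angle (a : E3) (b : E3)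

/-- The arc `ab`. If `a` and `b` are not antipodes, the points of the shorter part of the great
circle through `a` and `b` are the points of the sphere in the cone spanned by `a` and `b`. -/
def arc (a b : S2) : Set S2 :=
  {x | ∃ s t : ℝ, 0 ≤ s ∧ 0 ≤ t ∧ (x : E3) = s • (a : E3) + t • (b : E3)}

/-- Spherically convex sets: they contain no antipodes, and they contain the arc joining any two
of their points. -/
def IsConvex (C : Set S2) : Prop :=
  ∀ a ∈ C, ∀ b ∈ C, sdist a b < Real.pi ∧ arc a b ⊆ C

/-- Convex bodies: closed convex sets with non-empty interior (with respect to the sphere). -/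
structure IsConvexBody (C : Set S2) : Prop where
  convex : IsConvex C
  closed : IsClosed C
  interior_nonempty : (interior C).Nonempty

/-- The convex hull of a set: the intersection of all convex sets that contain it. (It is meant
only for subsets of convex sets.) -/
def hull (A : Set S2) : Set S2 := ⋂₀ {C | IsConvex C ∧ A ⊆ C}

/-- The hemisphere with center `k`: the spherical disk of radius `π / 2` with center `k`. -/
def hemisphere (k : S2) : Set S2 := {x | sdist k x ≤ Real.pi / 2}

/-- The component of `q` orthogonal to `p`. For `q ≠ ± p` it is a non-zero vector, tangent to the
sphere at `p`, in the direction in which the arc `pq` leaves `p`. -/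
def orthComponent (p q : S2) : E3 := (q : E3) - inner ℝ (p : E3) (q : E3) • (p : E3)

/-- For hemispheres `G`, `H` with centers `g ≠ ± h`: the center of the semicircle `G/H`, the part
of the great circle bounding `G` that lies in `H`. It is the point of that great circle nearest
to `h`. -/
def semicircleCenter (g h : S2) : E3 := ‖orthComponent g h‖⁻¹ • orthComponent g h

/-- The thickness of the lune `G ∩ H`, for hemispheres with centers `g ≠ ± h`: the distance
between the centers of the semicircles `G/H` and `H/G`. -/
def luneThickness (g h : S2) : ℝ :=
  InnerProductGeometry.angle (semicircleCenter g h) (semicircleCenter h g)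

/-- The thickness `Δ(C)`: the minimal thickness of a lune containing `C`. -/
def thickness (C : Set S2) : ℝ :=
  sInf {d | ∃ g h : S2, g ≠ h ∧ g ≠ -h ∧ C ⊆ hemisphere g ∩ hemisphere h ∧
    d = luneThickness g h}

/-- Reduced convex bodies: every convex body that is a proper subset is of smaller thickness. -/
structure IsReduced (C : Set S2) : Prop where
  convexBody : IsConvexBody C
  thickness_lt : ∀ R : Set S2, IsConvexBody R → R ⊂ C → thickness R < thickness C

/-- `V` is the spherically convex `k`-gon with vertices `v 0, …, v (k - 1)` (listed in any
order): it is the convex hull of these `k ≥ 3` points, which lie in a convex set, and none of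
which belongs to the convex hull of the others. -/
structure IsConvexGon {k : ℕ} (v : Fin k → S2) (V : Set S2) : Prop where
  three_le : 3 ≤ k
  subset_convex : ∃ C : Set S2, IsConvex C ∧ Set.range v ⊆ C
  notMem_hull : ∀ i, v i ∉ hull (v '' {j | j ≠ i})
  eq_hull : V = hull (Set.range v)

/-- The diameter of a set with respect to the spherical distance. -/
def diam (C : Set S2) : ℝ := sSup {d | ∃ x ∈ C, ∃ y ∈ C, d = sdist x y}

/-- The spherical angle at `b` between the arcs `ba` and `bc`. -/
def sangle (a b c : S2) : ℝ :=
  InnerProductGeometry.angle (orthComponent b a) (orthComponent b c)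

/-- `V` is a regular spherical triangle: a spherically convex `3`-gon with sides of equal length
and interior angles of equal measure. -/
def IsRegularTriangle (V : Set S2) : Prop :=
  ∃ v : Fin 3 → S2, IsConvexGon v V ∧
    (sdist (v 0) (v 1) = sdist (v 1) (v 2) ∧ sdist (v 1) (v 2) = sdist (v 2) (v 0)) ∧
    (sangle (v 2) (v 0) (v 1) = sangle (v 0) (v 1) (v 2) ∧
      sangle (v 0) (v 1) (v 2) = sangle (v 1) (v 2) (v 0))

end SphericalPolygon

end

/-! ### Determinants, cross products and angles in three-space -/

noncomputable section

namespace SphericalPolygon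

open InnerProductGeometry
open scoped RealInnerProductSpace

/-! Everything is read off in the cone over the body V. A lune with hemisphere centers g, h has
thickness π − ∠(g, h) (`luneThickness_eq`), so thickness Δ means that unit vectors of the dual cone
have inner products at least −cos Δ. Put C = cos Δ.

Cutting a small cap off at a vertex lowers the thickness of a reduced body. Minimal lunes of the cut
bodies converge, as the cap shrinks, to a lune of thickness Δ around V with that vertex w i as one
semicircle center; the other center t i also lies in V (`IsReduced.exists_lune`). Since the two
hemispheres cannot be tilted oppositely (`not_tilt`), t i lies on a side of V (`exists_isOpposite`).
Any two chords w i t i and w j t j cross (`chords_cross`), which forces n = 2k + 1, with the side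
from w (i + k) to w (i + k + 1) opposite to w i (`exists_half`).

Let e be the distance from t i to w (i + k + 1), η = cos e, and d the distance from w i to w (i + k
+ 1). The right triangle with these vertices gives cos d = Cη. The points t split the sides into
pieces that are equal in pairs, so the chain of k + 1 sides from w i to w (i + k + 1) exceeds the
complementary chain of k sides by 2e (`sum_sides`). The shorter chain is at least d; the longer one
lies in an isosceles triangle with legs l over the same base, so it is at most 2l (`exists_apex`).
Hence d + 2e ≤ 2l, which yields 2η² − Cη − 1 ≥ 0 (`cos_bound`).

So η is at least the positive root y = 1/(2 sin γ) of this quadratic, and d ≤ arccos(Cy) = 2 arccos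
y because 2y² − 1 = Cy. The diameter is attained by one of these pairs (`exists_min_inner`,
`diam_eq_arccos`). For k ≥ 2 the chain is strictly longer than d and the bound is strict. For k = 1
all sides agree (`triangle_side_succ`) and have length 2e, so cos 2e = Cη and equality holds. -/

/-- The determinant of three vectors of Euclidean three-space. -/
def det3 (x y z : E3) : ℝ :=
  x 0 * (y 1 * z 2 - y 2 * z 1) - x 1 * (y 0 * z 2 - y 2 * z 0) + x 2 * (y 0 * z 1 - y 1 * z 0)

/-- The cross product on Euclidean three-space. -/
def cross3 (x y : E3) : E3 :=
  !₂[x 1 * y 2 - x 2 * y 1, x 2 * y 0 - x 0 * y 2, x 0 * y 1 - x 1 * y 0]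

lemma inner_eq_sum (x y : E3) : ⟪x, y⟫ = x 0 * y 0 + x 1 * y 1 + x 2 * y 2 := by
  simp [PiLp.inner_apply, Fin.sum_univ_three]
  ring

lemma inner_cross3 (x y z : E3) : ⟪cross3 x y, z⟫ = det3 x y z := by
  simp [inner_eq_sum, cross3, det3]
  ring

lemma det3_rotate (x y z : E3) : det3 y z x = det3 x y z := by
  simp only [det3]; ring

lemma det3_swap_left (x y z : E3) : det3 y x z = -det3 x y z := by
  simp only [det3]; ring

lemma det3_swap_right (x y z : E3) : det3 x z y = -det3 x y z := by
  simp only [det3]; ring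

lemma det3_self_left (x y : E3) : det3 x x y = 0 := by
  simp only [det3]; ring

lemma det3_self_right (x y : E3) : det3 x y y = 0 := by
  simp only [det3]; ring

lemma det3_self_outer (x y : E3) : det3 x y x = 0 := by
  simp only [det3]; ring

lemma det3_comb_left (r s : ℝ) (p q y z : E3) :
    det3 (r • p + s • q) y z = r * det3 p y z + s * det3 q y z := by
  simp [det3]; ring

lemma det3_comb_mid (r s : ℝ) (p q x z : E3) :
    det3 x (r • p + s • q) z = r * det3 x p z + s * det3 x q z := by
  simp [det3]; ring

lemma det3_comb_right (r s : ℝ) (p q x y : E3) :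
    det3 x y (r • p + s • q) = r * det3 x y p + s * det3 x y q := by
  simp [det3]; ring

lemma inner_comb_left (r s : ℝ) (p q x : E3) :
    ⟪r • p + s • q, x⟫ = r * ⟪p, x⟫ + s * ⟪q, x⟫ := by
  simp [inner_add_left, real_inner_smul_left]

lemma inner_comb_right (r s : ℝ) (p q x : E3) :
    ⟪x, r • p + s • q⟫ = r * ⟪x, p⟫ + s * ⟪x, q⟫ := by
  simp [inner_add_right, real_inner_smul_right]

lemma ext_coord {x y : E3} (h0 : x 0 = y 0) (h1 : x 1 = y 1) (h2 : x 2 = y 2) : x = y := by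
  ext i
  fin_cases i <;> assumption

lemma cramer (x y z p : E3) :
    det3 x y z • p = det3 p y z • x + det3 x p z • y + det3 x y p • z := by
  apply ext_coord <;> simp [det3] <;> ring

/-- Up to the factor `det3 x y z`, the cross products of pairs form the basis dual to `x, y, z`. A
vector orthogonal to two of the three is therefore a multiple of a single cross product; this is how
normals of sides are recognised. -/
lemma cramer_dual (x y z p : E3) :
    det3 x y z • p = ⟪p, x⟫ • cross3 y z + ⟪p, y⟫ • cross3 z x + ⟪p, z⟫ • cross3 x y := by
  apply ext_coord <;> simp [det3, cross3, inner_eq_sum] <;> ring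

/-- Multiplicativity of the determinant: the right side is the Gram determinant of `a, b, x` against
`a, b, y`. -/
lemma det3_mul_det3 (a b x y : E3) :
    det3 a b x * det3 a b y = ⟪a, a⟫ * (⟪b, b⟫ * ⟪x, y⟫ - ⟪b, y⟫ * ⟪b, x⟫)
      - ⟪a, b⟫ * (⟪a, b⟫ * ⟪x, y⟫ - ⟪b, y⟫ * ⟪a, x⟫)
      + ⟪a, y⟫ * (⟪a, b⟫ * ⟪b, x⟫ - ⟪b, b⟫ * ⟪a, x⟫) := by
  simp only [det3, inner_eq_sum]; ring

/-- Parseval's identity in the orthonormal basis `a, h, a × h`. -/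
lemma inner_eq_of_orthonormal {a h : E3} (ha : ⟪a, a⟫ = 1) (hh : ⟪h, h⟫ = 1) (hah : ⟪a, h⟫ = 0)
    (x y : E3) : ⟪x, y⟫ = ⟪a, x⟫ * ⟪a, y⟫ + ⟪h, x⟫ * ⟪h, y⟫ + det3 a h x * det3 a h y := by
  rw [det3_mul_det3, ha, hh, hah]; ring

lemma eq_of_inner_eq_one {x y : E3} (hx : ⟪x, x⟫ = 1) (hy : ⟪y, y⟫ = 1) (h : 1 ≤ ⟪x, y⟫) :
    x = y := by
  have : ⟪x - y, x - y⟫ = 2 - 2 * ⟪x, y⟫ := by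
    rw [inner_sub_left, inner_sub_right, inner_sub_right, hx, hy, real_inner_comm]; ring
  have h0 : ⟪x - y, x - y⟫ = 0 := le_antisymm (by rw [this]; linarith) real_inner_self_nonneg
  exact sub_eq_zero.1 (inner_self_eq_zero.1 h0)

/-- A unit normal of a plane is determined by its sign at a point off the plane. -/
lemma unit_normal_unique {p q z y y' : E3} (hz : 0 < det3 p q z) (hy : ⟪y, y⟫ = 1)
    (hy' : ⟪y', y'⟫ = 1) (hp : ⟪y, p⟫ = 0) (hq : ⟪y, q⟫ = 0) (hp' : ⟪y', p⟫ = 0)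
    (hq' : ⟪y', q⟫ = 0) (hyz : 0 ≤ ⟪y, z⟫) (hyz' : 0 ≤ ⟪y', z⟫) : y = y' := by
  have h1 := cramer_dual p q z y
  have h2 := cramer_dual p q z y'
  rw [hp, hq, zero_smul, zero_smul, zero_add, zero_add] at h1
  rw [hp', hq', zero_smul, zero_smul, zero_add, zero_add] at h2
  set D := det3 p q z
  set N := ⟪cross3 p q, cross3 p q⟫
  have e1 : D ^ 2 = ⟪y, z⟫ ^ 2 * N := by
    have := congrArg (fun v => ⟪v, v⟫) h1
    simp only [real_inner_smul_left, real_inner_smul_right, hy] at this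
    linarith
  have e2 : D ^ 2 = ⟪y', z⟫ ^ 2 * N := by
    have := congrArg (fun v => ⟪v, v⟫) h2
    simp only [real_inner_smul_left, real_inner_smul_right, hy'] at this
    linarith
  have hN : N ≠ 0 := fun h => by
    rw [h, mul_zero] at e1
    exact absurd e1 (by positivity)
  have e3 : ⟪y, z⟫ = ⟪y', z⟫ := by
    have : ⟪y, z⟫ ^ 2 = ⟪y', z⟫ ^ 2 := mul_right_cancel₀ hN (e1.symm.trans e2)
    exact (pow_left_inj₀ hyz hyz' two_ne_zero).1 this
  rw [e3, ← h2] at h1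
  exact smul_right_injective E3 hz.ne' h1

lemma real_inner_self_sphere (a : S2) : ⟪(a : E3), (a : E3)⟫ = 1 := by
  rw [real_inner_self_eq_norm_sq, norm_eq_of_mem_sphere, one_pow]

lemma norm_eq_one_of_inner {a : E3} (h : ⟪a, a⟫ = 1) : ‖a‖ = 1 := by
  rw [real_inner_self_eq_norm_sq] at h
  nlinarith [norm_nonneg a]

lemma cos_angle_unit {a b : E3} (ha : ⟪a, a⟫ = 1) (hb : ⟪b, b⟫ = 1) :
    Real.cos (angle a b) = ⟪a, b⟫ := by
  rw [cos_angle, norm_eq_one_of_inner ha, norm_eq_one_of_inner hb]; simp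

lemma abs_inner_le_one {a b : E3} (ha : ⟪a, a⟫ = 1) (hb : ⟪b, b⟫ = 1) : |⟪a, b⟫| ≤ 1 := by
  rw [← cos_angle_unit ha hb]; exact Real.abs_cos_le_one _

lemma angle_eq_angle_iff_inner {a b c d : E3} (ha : ⟪a, a⟫ = 1) (hb : ⟪b, b⟫ = 1)
    (hc : ⟪c, c⟫ = 1) (hd : ⟪d, d⟫ = 1) : angle a b = angle c d ↔ ⟪a, b⟫ = ⟪c, d⟫ := by
  rw [← cos_angle_unit ha hb, ← cos_angle_unit hc hd]
  exact ⟨fun h => by rw [h], fun h => Real.injOn_cos ⟨angle_nonneg _ _, angle_le_pi _ _⟩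
    ⟨angle_nonneg _ _, angle_le_pi _ _⟩ h⟩

/-- The spherical distance is additive along arcs. -/
lemma angle_add_of_comb {x y z : E3} (hy : y ≠ 0) {r s : ℝ} (hr : 0 ≤ r) (hs : 0 ≤ s)
    (h : y = r • x + s • z) : angle x z = angle x y + angle y z := by
  apply angle_eq_angle_add_add_angle_add_of_mem_span hy
  rw [Submodule.mem_span_pair]
  exact ⟨⟨r, hr⟩, ⟨s, hs⟩, by rw [h]; rfl⟩

/-- The strict triangle inequality. -/
lemma angle_lt_angle_add_angle {x y z : E3} (hp : ∀ r s : ℝ, y ≠ r • x + s • z)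
    (hxz : angle x z ≠ Real.pi) (hy : y ≠ 0) : angle x z < angle x y + angle y z := by
  refine lt_of_le_of_ne (angle_le_angle_add_angle x y z) fun h => ?_
  rcases (angle_eq_angle_add_angle_iff hy).1 h with h | h
  · exact hxz h
  · rw [Submodule.mem_span_pair] at h
    obtain ⟨r, s, h⟩ := h
    exact hp r s h.symm

end SphericalPolygon
end

/-! ### Cones over convex sets, separation, convex hulls -/

noncomputable section

namespace SphericalPolygon

open InnerProductGeometry
open scoped RealInnerProductSpace

/-- The open cone spanned by a subset of the sphere. -/
def coneOf (C : Set S2) : Set E3 := {z | ∃ r : ℝ, 0 < r ∧ ∃ x ∈ C, z = r • (x : E3)}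

lemma mem_of_mem_coneOf {C : Set S2} {x : S2} (h : (x : E3) ∈ coneOf C) : x ∈ C := by
  obtain ⟨r, hr, y, hy, h⟩ := h
  have h1 : ‖(x : E3)‖ = r * ‖(y : E3)‖ := by rw [h, norm_smul, Real.norm_of_nonneg hr.le]
  rw [norm_eq_of_mem_sphere, norm_eq_of_mem_sphere, mul_one] at h1
  rw [← h1, one_smul] at h
  rwa [Subtype.ext h]

lemma coneOf_smul {C : Set S2} {r : ℝ} (hr : 0 < r) {x : E3} (hx : x ∈ coneOf C) :
    r • x ∈ coneOf C := by
  obtain ⟨s, hs, y, hy, rfl⟩ := hx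
  exact ⟨r * s, mul_pos hr hs, y, hy, by rw [smul_smul]⟩

/-- The arc condition puts the normalised sum into `C`; the exclusion of antipodes keeps the sum
away from zero. -/
lemma coneOf_add {C : Set S2} (hC : IsConvex C) {x y : E3} (hx : x ∈ coneOf C)
    (hy : y ∈ coneOf C) : x + y ∈ coneOf C := by
  obtain ⟨r, hr, a, ha, rfl⟩ := hx
  obtain ⟨s, hs, b, hb, rfl⟩ := hy
  obtain ⟨h1, h2⟩ := hC a ha b hb
  set z := r • (a : E3) + s • (b : E3) with hz
  have hz0 : z ≠ 0 := by
    intro h0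
    apply h1.ne
    rw [sdist, angle_eq_pi_iff]
    refine ⟨fun h => by simpa [h] using norm_eq_of_mem_sphere a, -(r / s), by
      simp only [Left.neg_neg_iff]; positivity, ?_⟩
    have : s • (b : E3) = -(r • (a : E3)) := by rw [eq_neg_iff_add_eq_zero, add_comm]; exact h0
    have h3 : (b : E3) = s⁻¹ • (s • (b : E3)) := by rw [smul_smul, inv_mul_cancel₀ hs.ne', one_smul]
    rw [h3, this, smul_neg, smul_smul, neg_smul]
    congr 2; field_simp
  have hn : 0 < ‖z‖ := norm_pos_iff.2 hz0
  refine ⟨‖z‖, hn, ⟨‖z‖⁻¹ • z, ?_⟩, h2 ⟨‖z‖⁻¹ * r, ‖z‖⁻¹ * s, by positivity, by positivity, ?_⟩, ?_⟩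
  · simp [norm_smul, hn.ne']
  · simp [hz, smul_add, smul_smul]
  · simp [smul_smul, hn.ne']

lemma sum_mem_coneOf {C : Set S2} (hC : IsConvex C) {ι : Type*} (s : Finset ι) (f : ι → S2)
    (hf : ∀ i ∈ s, f i ∈ C) (l : ι → ℝ) (hl : ∀ i ∈ s, 0 ≤ l i) :
    ∑ i ∈ s, l i • (f i : E3) = 0 ∨ ∑ i ∈ s, l i • (f i : E3) ∈ coneOf C := by
  classical
  induction s using Finset.induction_on with
  | empty => left; simp
  | insert i s hi ih =>
    rw [Finset.sum_insert hi]
    have ih := ih (fun j hj => hf j (Finset.mem_insert_of_mem hj))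
      (fun j hj => hl j (Finset.mem_insert_of_mem hj))
    rcases (hl i (Finset.mem_insert_self _ _)).eq_or_lt with h0 | h0
    · rw [← h0, zero_smul, zero_add]; exact ih
    · have h1 : l i • (f i : E3) ∈ coneOf C := ⟨l i, h0, f i, hf i (Finset.mem_insert_self _ _), rfl⟩
      right
      rcases ih with h | h
      · rwa [h, add_zero]
      · exact coneOf_add hC h1 h

/-- Unit vectors in the cone spanned by points of a convex set belong to the set. -/
lemma IsConvex.mem_of_sum {C : Set S2} (hC : IsConvex C) {ι : Type*} [Fintype ι] (f : ι → S2)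
    (hf : ∀ i, f i ∈ C) (l : ι → ℝ) (hl : ∀ i, 0 ≤ l i) {x : S2}
    (hx : (x : E3) = ∑ i, l i • (f i : E3)) : x ∈ C := by
  rcases sum_mem_coneOf hC Finset.univ f (fun i _ => hf i) l (fun i _ => hl i) with h | h
  · rw [← hx] at h
    simpa [h] using norm_eq_of_mem_sphere x
  · exact mem_of_mem_coneOf (hx ▸ h)

/-- Separation of a point from a closed convex set. -/
lemma exists_separating {R : Set S2} (hR : IsConvex R) (hcl : IsClosed R) {p : S2} (hp : p ∉ R) :
    ∃ y : E3, (∀ x ∈ R, 0 ≤ ⟪y, (x : E3)⟫) ∧ ⟪y, (p : E3)⟫ < 0 := by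
  rcases R.eq_empty_or_nonempty with rfl | ⟨x₀, hx₀⟩
  · exact ⟨-p, by simp, by rw [inner_neg_left, real_inner_self_sphere]; norm_num⟩
  -- The cone together with its apex, written as a projection along the compact sphere so that it is
  -- closed.
  set K : Set E3 := Prod.fst '' {q : E3 × S2 | q.2 ∈ R ∧ q.1 = ‖q.1‖ • (q.2 : E3)} with hK
  have hKcl : IsClosed K := by
    apply isClosedMap_fst_of_compactSpace
    exact (hcl.preimage continuous_snd).inter (isClosed_eq continuous_fst (by fun_prop))
  have hKmem : ∀ z, z ∈ K ↔ z = 0 ∨ z ∈ coneOf R := by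
    intro z
    constructor
    · rintro ⟨⟨z, x⟩, ⟨hx, h⟩, rfl⟩
      by_cases h0 : z = 0
      · exact Or.inl h0
      · exact Or.inr ⟨‖z‖, norm_pos_iff.2 h0, x, hx, h⟩
    · rintro (rfl | ⟨r, hr, x, hx, rfl⟩)
      · exact ⟨(0, x₀), ⟨hx₀, by simp⟩, rfl⟩
      · exact ⟨(r • (x : E3), x), ⟨hx, by simp [norm_smul, abs_of_pos hr]⟩, rfl⟩
  have hKconv : Convex ℝ K := by
    rw [convex_iff_forall_pos]
    intro x hx y hy a b ha hb _
    rw [hKmem] at hx hy ⊢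
    rcases hx with rfl | hx
    · rcases hy with rfl | hy
      · left; simp
      · right; rw [smul_zero, zero_add]; exact coneOf_smul hb hy
    · rcases hy with rfl | hy
      · right; rw [smul_zero, add_zero]; exact coneOf_smul ha hx
      · right; exact coneOf_add hR (coneOf_smul ha hx) (coneOf_smul hb hy)
  have hpK : (p : E3) ∉ K := by
    rw [hKmem]
    rintro (h | h)
    · simpa [h] using norm_eq_of_mem_sphere p
    · exact hp (mem_of_mem_coneOf h)
  obtain ⟨f, u, h1, h2⟩ := geometric_hahn_banach_point_closed hKconv hKcl hpK
  have hu : u < 0 := by simpa using h2 0 ((hKmem 0).2 (Or.inl rfl))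
  set z : E3 := (InnerProductSpace.toDual ℝ E3).symm f with hz
  have hfz : ∀ x, f x = ⟪z, x⟫ := fun x => by simp [hz]
  refine ⟨z, fun x hx => ?_, by rw [← hfz]; linarith⟩
  rw [← hfz]
  by_contra! hneg
  have := h2 ((u / f x) • (x : E3))
    ((hKmem _).2 (Or.inr ⟨u / f x, div_pos_of_neg_of_neg hu hneg, x, hx, rfl⟩))
  rw [map_smul, smul_eq_mul, div_mul_cancel₀ _ hneg.ne] at this
  exact lt_irrefl _ this

/-- Separating `R` from `-x` gives a vector of the dual cone that is positive at `x`; by compactness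
a finite sum of such vectors is positive on all of `R`. -/
lemma exists_inner_pos {R : Set S2} (hR : IsConvex R) (hcl : IsClosed R) :
    ∃ c : E3, ∀ x ∈ R, 0 < ⟪c, (x : E3)⟫ := by
  have h1 : ∀ x : R, ∃ y : E3, (∀ z ∈ R, 0 ≤ ⟪y, (z : E3)⟫) ∧ 0 < ⟪y, (x : E3)⟫ := by
    rintro ⟨x, hx⟩
    have : -x ∉ R := fun h => by
      have := (hR x hx (-x) h).1
      have h0 : (x : E3) ≠ 0 := fun h => by simpa [h] using norm_eq_of_mem_sphere x
      simp [sdist, angle_self_neg_of_nonzero h0] at this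
    obtain ⟨y, hy, h⟩ := exists_separating hR hcl this
    exact ⟨y, hy, by simpa using h⟩
  choose y hy hyx using h1
  obtain ⟨t, ht⟩ := hcl.isCompact.elim_finite_subcover (fun x : R => {z : S2 | 0 < ⟪y x, (z : E3)⟫})
    (fun x => isOpen_lt continuous_const (by fun_prop))
    (fun x hx => Set.mem_iUnion.2 ⟨⟨x, hx⟩, hyx ⟨x, hx⟩⟩)
  refine ⟨∑ x ∈ t, y x, fun z hz => ?_⟩
  rw [sum_inner]
  obtain ⟨x, hxt, hx⟩ := Set.mem_iUnion₂.1 (ht hz)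
  exact Finset.sum_pos' (fun x _ => hy x z hz) ⟨x, hxt, hx⟩

/-- The points of a polygon are nonnegative combinations of its vertices. -/
lemma exists_sum_of_mem_hull {n : ℕ} {v : Fin n → S2} {c : E3} (hc : ∀ i, 0 < ⟪c, (v i : E3)⟫)
    {x : S2} (hx : x ∈ hull (Set.range v)) :
    ∃ l : Fin n → ℝ, (∀ i, 0 ≤ l i) ∧ (x : E3) = ∑ i, l i • (v i : E3) := by
  -- The unit vectors among the nonnegative combinations form a convex set containing the vertices;
  -- positivity of `c` on them excludes antipodes.
  refine hx {x : S2 | ∃ l : Fin n → ℝ, (∀ i, 0 ≤ l i) ∧ (x : E3) = ∑ i, l i • (v i : E3)} ⟨?_, ?_⟩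
  · rintro a ⟨l, hl, ha⟩ b ⟨m, hm, hb⟩
    have key : ∀ (a : S2) (l : Fin n → ℝ), (∀ i, 0 ≤ l i) → (a : E3) = ∑ i, l i • (v i : E3) →
        0 < ⟪c, (a : E3)⟫ := by
      intro a l hl ha
      have h0 : 0 ≤ ⟪c, (a : E3)⟫ := by
        rw [ha, inner_sum]
        exact Finset.sum_nonneg fun i _ => by
          rw [real_inner_smul_right]; exact mul_nonneg (hl i) (hc i).le
      refine lt_of_le_of_ne h0 fun h => ?_
      rw [ha, inner_sum, eq_comm, Finset.sum_eq_zero_iff_of_nonneg] at h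
      · have : ∀ i, l i = 0 := fun i => by
          have := h i (Finset.mem_univ i)
          rw [real_inner_smul_right] at this
          exact (mul_eq_zero.1 this).resolve_right (hc i).ne'
        have h1 : (a : E3) = 0 := by rw [ha]; simp [this]
        simpa [h1] using norm_eq_of_mem_sphere a
      · exact fun i _ => by rw [real_inner_smul_right]; exact mul_nonneg (hl i) (hc i).le
    constructor
    · refine lt_of_le_of_ne (angle_le_pi _ _) fun h => ?_
      obtain ⟨-, r, hr, h⟩ := angle_eq_pi_iff.1 h
      have h1 := key a l hl ha
      have h2 := key b m hm hb
      rw [h, real_inner_smul_right] at h2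
      nlinarith
    · rintro y ⟨s, t, hs, ht, hy⟩
      refine ⟨fun i => s * l i + t * m i, fun i => by have := hl i; have := hm i; positivity, ?_⟩
      rw [hy, ha, hb, Finset.smul_sum, Finset.smul_sum, ← Finset.sum_add_distrib]
      exact Finset.sum_congr rfl fun i _ => by rw [add_smul, smul_smul, smul_smul]
  · rintro _ ⟨i, rfl⟩
    refine ⟨fun j => if j = i then 1 else 0, fun j => by
      dsimp only; split_ifs <;> norm_num, by simp⟩

lemma subset_hull (A : Set S2) : A ⊆ hull A := fun _ hx _ hC => hC.2 hx

/-- A vertex is not a nonnegative combination of three other vertices. -/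
lemma IsConvexGon.vertex_ne {n : ℕ} {v : Fin n → S2} {V : Set S2} (hV : IsConvexGon v V)
    {i j k l : Fin n} (hj : j ≠ i) (hk : k ≠ i) (hl : l ≠ i) {p q r : ℝ} (hp : 0 ≤ p) (hq : 0 ≤ q)
    (hr : 0 ≤ r) : (v i : E3) ≠ p • (v j : E3) + q • (v k : E3) + r • (v l : E3) := by
  intro h
  apply hV.notMem_hull i
  rintro C ⟨hC, hsub⟩
  refine hC.mem_of_sum ![v j, v k, v l] ?_ ![p, q, r] ?_ (x := v i) (by
    simpa [Fin.sum_univ_three] using h)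
  · intro a; fin_cases a
    · exact hsub ⟨j, hj, rfl⟩
    · exact hsub ⟨k, hk, rfl⟩
    · exact hsub ⟨l, hl, rfl⟩
  · intro a; fin_cases a <;> assumption

end SphericalPolygon
end

/-! ### Cyclic order of the vertices -/

noncomputable section

namespace SphericalPolygon

open InnerProductGeometry
open scoped RealInnerProductSpace

/-- The vertices of a spherically convex polygon in cyclic order, indexed by the integers modulo
their number. -/
structure IsCyclicPolygon (n : ℕ) (w : ℤ → E3) : Prop where
  three_le : 3 ≤ n
  unit : ∀ i, ⟪w i, w i⟫ = 1
  periodic : ∀ i, w (i + n) = w i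
  det_pos : ∀ i j k : ℤ, i < j → j < k → k < i + n → 0 < det3 (w i) (w j) (w k)

/-- Three vectors in an open half-space, none of which is a nonnegative combination of the
other two, are linearly independent. -/
lemma det3_ne_zero_of_extreme {x y z c : E3} (hy : ⟪y, y⟫ = 1) (hz : ⟪z, z⟫ = 1)
    (cx : 0 < ⟪c, x⟫) (cy : 0 < ⟪c, y⟫) (cz : 0 < ⟪c, z⟫)
    (ex : ∀ p q : ℝ, 0 ≤ p → 0 ≤ q → x ≠ p • y + q • z)
    (ey : ∀ p q : ℝ, 0 ≤ p → 0 ≤ q → y ≠ p • x + q • z)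
    (ez : ∀ p q : ℝ, 0 ≤ p → 0 ≤ q → z ≠ p • x + q • y) : det3 x y z ≠ 0 := by
  intro h0
  have hA : 0 < det3 (cross3 y z) y z := by
    have h1 := det3_mul_det3 y z (cross3 y z) (cross3 y z)
    have h2 : ⟪cross3 y z, cross3 y z⟫ = ⟪y, y⟫ * ⟪z, z⟫ - ⟪y, z⟫ ^ 2 := by
      simp only [inner_eq_sum, cross3, Matrix.cons_val_zero, Matrix.cons_val_one,
        Matrix.cons_val]; ring
    have h3 : det3 (cross3 y z) y z = ⟪cross3 y z, cross3 y z⟫ := by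
      rw [inner_cross3, ← det3_rotate]
    rw [h3]
    refine lt_of_le_of_ne real_inner_self_nonneg fun h => ?_
    have h4 : (⟪y, z⟫ - 1) * (⟪y, z⟫ + 1) = 0 := by rw [hy, hz] at h2; linarith
    rcases mul_eq_zero.1 h4 with h5 | h5
    · have : y = z := eq_of_inner_eq_one hy hz (by linarith)
      exact ey 0 1 le_rfl zero_le_one (by rw [zero_smul, one_smul, zero_add, this])
    · have : y = -z := eq_of_inner_eq_one hy (by simpa using hz) (by
        rw [inner_neg_right]; linarith)
      rw [this, inner_neg_right] at cy
      linarith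
  -- A linear relation A x + B y + D z = 0 with A = |y × z|² > 0. Whatever the signs of B and D,
  -- pairing with `c` lets one of the vectors be solved for with nonnegative coefficients.
  have hc := cramer x y z (cross3 y z)
  rw [h0, zero_smul] at hc
  set A := det3 (cross3 y z) y z
  set B := det3 x (cross3 y z) z
  set D := det3 x y (cross3 y z)
  have hcc := congrArg (fun v => ⟪c, v⟫) hc
  simp only [inner_zero_right, inner_add_right, real_inner_smul_right] at hcc
  rcases le_or_gt B 0 with hB | hB
  · rcases le_or_gt D 0 with hD | hD
    · refine ex (-B / A) (-D / A) (div_nonneg (by linarith) hA.le) (div_nonneg (by linarith) hA.le)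
        ?_
      apply smul_right_injective E3 hA.ne'
      simp only [smul_add, smul_smul, mul_div_cancel₀ _ hA.ne', neg_smul]
      linear_combination (norm := module) -hc
    · have hB' : B ≠ 0 := fun h => by rw [h] at hcc; nlinarith
      have hB'' : 0 < -B := by
        rcases lt_or_eq_of_le hB with h | h
        · linarith
        · exact absurd h hB'
      refine ey (A / -B) (D / -B) (by positivity) (by positivity) ?_
      apply smul_right_injective E3 hB''.ne'
      simp only [smul_add, smul_smul, mul_div_cancel₀ _ hB''.ne', neg_smul]
      linear_combination (norm := module) hc
  · have hD' : 0 < -D := by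
      by_contra! h
      nlinarith [mul_pos hA cx, mul_pos hB cy, mul_nonneg (by linarith : 0 ≤ D) cz.le]
    refine ez (A / -D) (B / -D) (by positivity) (by positivity) ?_
    apply smul_right_injective E3 hD'.ne'
    simp only [smul_add, smul_smul, mul_div_cancel₀ _ hD'.ne', neg_smul]
    linear_combination (norm := module) hc

/-- If the triples `(o,x,y)`, `(o,y,z)`, `(o,z,x)` are positively oriented and all vectors lie
in an open half-space, then `o` is a nonnegative combination of `x`, `y`, `z`. -/
lemma exists_comb_of_det3_pos {o x y z c : E3} (co : 0 < ⟪c, o⟫)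
    (cx : 0 < ⟪c, x⟫) (cy : 0 < ⟪c, y⟫) (cz : 0 < ⟪c, z⟫) (h1 : 0 < det3 o x y)
    (h2 : 0 < det3 o y z) (h3 : 0 ≤ det3 o z x) :
    ∃ p q r : ℝ, 0 ≤ p ∧ 0 ≤ q ∧ 0 ≤ r ∧ o = p • x + q • y + r • z := by
  have hc := cramer x y z o
  have e1 : det3 x o z = det3 o z x := by simp only [det3]; ring
  have e2 : det3 x y o = det3 o x y := by simp only [det3]; ring
  rw [e1, e2] at hc
  have hcc := congrArg (fun v => ⟪c, v⟫) hc
  simp only [inner_add_right, real_inner_smul_right] at hcc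
  have hD : 0 < det3 x y z := by
    by_contra! h
    nlinarith [mul_pos h2 cx, mul_nonneg h3 cy.le, mul_pos h1 cz,
      mul_nonneg (neg_nonneg.2 h) co.le]
  refine ⟨det3 o y z / det3 x y z, det3 o z x / det3 x y z, det3 o x y / det3 x y z,
    by positivity, by positivity, by positivity, ?_⟩
  apply smul_right_injective E3 hD.ne'
  simp only [smul_add, smul_smul, mul_div_cancel₀ _ hD.ne']
  exact hc

/-- A strict total order on a finite type lists its elements. -/
lemma exists_equiv_of_isStrictTotalOrder {α : Type*} [Fintype α] (r : α → α → Prop)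
    [IsStrictTotalOrder α r] {m : ℕ} (h : Fintype.card α = m) :
    ∃ f : Fin m ≃ α, ∀ i j, i < j → r (f i) (f j) := by
  classical
  let _ : LinearOrder α := linearOrderOfSTO r
  let f := Fintype.orderIsoFinOfCardEq α h
  exact ⟨f.toEquiv, fun i j hij => (f.lt_iff_lt.2 hij : f i < f j)⟩

section order

variable {m : ℕ} {v : Fin (m + 1) → S2} {c : E3}

/-- The vertices of a convex polygon can be listed in cyclic order. -/
lemma exists_equiv_det3_pos (hc : ∀ i, 0 < ⟪c, (v i : E3)⟫)
    (hext : ∀ i j k l, j ≠ i → k ≠ i → l ≠ i → ∀ p q r : ℝ, 0 ≤ p → 0 ≤ q → 0 ≤ r →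
      (v i : E3) ≠ p • (v j : E3) + q • (v k : E3) + r • (v l : E3)) :
    ∃ e : Fin (m + 1) ≃ Fin (m + 1), ∀ i j k, i < j → j < k →
      0 < det3 (v (e i)) (v (e j)) (v (e k)) := by
  classical
  have hne : ∀ i j k, i ≠ j → j ≠ k → i ≠ k → det3 (v i) (v j) (v k) ≠ 0 := by
    intro i j k hij hjk hik
    have aux : ∀ i j k, j ≠ i → k ≠ i → ∀ p q : ℝ, 0 ≤ p → 0 ≤ q →
        (v i : E3) ≠ p • (v j : E3) + q • (v k : E3) := by
      intro i j k hj hk p q hp hq h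
      exact hext i j k j hj hk hj p q 0 hp hq le_rfl (by simpa using h)
    exact det3_ne_zero_of_extreme (real_inner_self_sphere _)
      (real_inner_self_sphere _) (hc i) (hc j) (hc k) (aux _ _ _ hij.symm hik.symm)
      (aux _ _ _ hij hjk.symm) (aux _ _ _ hik hjk)
  -- The remaining vertices are ordered by direction as seen from `v 0`. A failure of transitivity
  -- would put `v 0` into the cone over three other vertices.
  let r : {j : Fin (m + 1) // j ≠ 0} → {j : Fin (m + 1) // j ≠ 0} → Prop :=
    fun j k => 0 < det3 (v 0) (v j) (v k)
  have hr_asymm : ∀ j k, r j k → ¬ r k j := by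
    intro j k h h'
    simp only [r] at h h'
    rw [det3_swap_right] at h'
    linarith
  have hr_tri : ∀ j k, j ≠ k → r j k ∨ r k j := by
    intro j k hjk
    have := hne 0 j k j.2.symm (fun h => hjk (Subtype.ext h)) k.2.symm
    rcases lt_or_gt_of_ne this with h | h
    · right
      simp only [r]
      rw [det3_swap_right]; linarith
    · exact Or.inl h
  have hr_trans : ∀ j k l, r j k → r k l → r j l := by
    intro j k l hjk hkl
    by_contra h
    have hjl : 0 ≤ det3 (v 0) (v l) (v j) := by
      rw [det3_swap_right]
      have : det3 (v 0) (v j) (v l) ≤ 0 := not_lt.1 h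
      linarith
    obtain ⟨p, q, s, hp, hq, hs, h⟩ := exists_comb_of_det3_pos (hc 0) (hc j) (hc k) (hc l)
      hjk hkl hjl
    exact hext 0 j k l j.2 k.2 l.2 p q s hp hq hs h
  have hsto : IsStrictTotalOrder _ r :=
    { trichotomous := fun j k h1 h2 => by
        by_contra h
        exact (hr_tri j k h).elim h1 h2
      irrefl := fun j h => hr_asymm j j h h
      trans := hr_trans }
  have hcard : Fintype.card {j : Fin (m + 1) // j ≠ 0} = m := by
    simp [Fintype.card_subtype_compl]
  obtain ⟨f, hf⟩ := exists_equiv_of_isStrictTotalOrder r hcard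
  let u : Fin (m + 1) → Fin (m + 1) := Fin.cons 0 (fun i => (f i : Fin (m + 1)))
  have hu : Function.Injective u := by
    rw [Fin.cons_injective_iff]
    exact ⟨fun ⟨i, hi⟩ => (f i).2 hi, Subtype.val_injective.comp f.injective⟩
  refine ⟨Equiv.ofBijective u (Finite.injective_iff_bijective.1 hu), ?_⟩
  intro i j k hij hjk
  simp only [Equiv.ofBijective_apply]
  obtain ⟨j, rfl⟩ := Fin.exists_succ_eq.2 (Fin.ne_zero_of_lt hij)
  obtain ⟨k, rfl⟩ := Fin.exists_succ_eq.2 (Fin.ne_zero_of_lt hjk)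
  have hjk' := hf j k (Fin.succ_lt_succ_iff.1 hjk)
  rcases Fin.eq_zero_or_eq_succ i with rfl | ⟨i, rfl⟩
  · simpa [u] using hjk'
  · have hij' := hf i j (Fin.succ_lt_succ_iff.1 hij)
    have hik' := hf i k ((Fin.succ_lt_succ_iff.1 hij).trans (Fin.succ_lt_succ_iff.1 hjk))
    simp only [u, Fin.cons_succ]
    -- Otherwise Cramer's rule exhibits `v (f j)` as a nonnegative combination of `v 0`, `v (f i)`
    -- and `v (f k)`.
    by_contra! h
    have hc' := cramer (v 0) (v (f i)) (v (f k)) (v (f j))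
    have hne' : ∀ a b, a ≠ b → (f a : Fin (m + 1)) ≠ f b := fun a b hab h =>
      hab (f.injective (Subtype.ext h))
    have hij1 := Fin.succ_lt_succ_iff.1 hij
    have hjk1 := Fin.succ_lt_succ_iff.1 hjk
    set D := det3 (v 0) (v (f i)) (v (f k))
    refine hext (f j) 0 (f i) (f k) (f j).2.symm (hne' _ _ hij1.ne) (hne' _ _ hjk1.ne')
      (det3 (v (f j)) (v (f i)) (v (f k)) / D) (det3 (v 0) (v (f j)) (v (f k)) / D)
      (det3 (v 0) (v (f i)) (v (f j)) / D) ?_ (by positivity) (by positivity) ?_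
    · rw [det3_swap_left]
      exact div_nonneg (by linarith) hik'.le
    · apply smul_right_injective E3 hik'.ne'
      simp only [smul_add, smul_smul]
      rw [mul_div_cancel₀ _ hik'.ne', mul_div_cancel₀ _ hik'.ne', mul_div_cancel₀ _ hik'.ne']
      exact hc'

end order

/-- The vertices of a spherically convex polygon in cyclic order. -/
lemma IsConvexGon.exists_cyclic {n : ℕ} {v : Fin n → S2} {V : Set S2} (hV : IsConvexGon v V)
    {c : E3} (hc : ∀ i, 0 < ⟪c, (v i : E3)⟫) :
    ∃ w : ℤ → E3, IsCyclicPolygon n w ∧ (∀ z, ∃ i, w z = v i) ∧ ∀ i, ∃ z, w z = v i := by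
  obtain ⟨m, rfl⟩ : ∃ m, n = m + 1 := ⟨n - 1, by have := hV.three_le; omega⟩
  obtain ⟨e, he⟩ := exists_equiv_det3_pos hc
    (fun i j k l hj hk hl p q r hp hq hr => hV.vertex_ne hj hk hl hp hq hr)
  let f : ℤ → Fin (m + 1) := fun z => ⟨(z % (m + 1 : ℕ)).toNat, by
    have := Int.emod_nonneg z (b := (m + 1 : ℕ)) (by omega)
    have := Int.emod_lt_of_pos z (b := (m + 1 : ℕ)) (by omega)
    omega⟩
  have hf : ∀ i : Fin (m + 1), f (i : ℕ) = i := by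
    intro i
    ext
    simp only [f]
    rw [Int.emod_eq_of_lt (by omega) (by omega)]
    simp
  refine ⟨fun z => v (e (f z)), ⟨hV.three_le, fun i => real_inner_self_sphere _, fun i => ?_, ?_⟩,
    fun z => ⟨_, rfl⟩, fun i => ⟨((e.symm i : Fin (m + 1)) : ℕ), by simp [hf]⟩⟩
  · have : f (i + (m + 1 : ℕ)) = f i := by
      ext; simp only [f, Int.add_emod_right]
    rw [this]
  · intro i j k hij hjk hki
    have hval : ∀ z, ((f z : Fin (m + 1)) : ℕ) = (z % (m + 1 : ℕ)).toNat := fun z => rfl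
    have key : ∀ z, i ≤ z → z < i + (m + 1 : ℕ) →
        (((f z : ℕ) : ℤ) = i % (m + 1 : ℕ) + (z - i) ∨
          ((f z : ℕ) : ℤ) = i % (m + 1 : ℕ) + (z - i) - (m + 1 : ℕ)) := by
      intro z h1 h2
      rw [hval]
      have a1 := Int.emod_nonneg z (b := (m + 1 : ℕ)) (by omega)
      have a2 := Int.emod_lt_of_pos z (b := (m + 1 : ℕ)) (by omega)
      have a3 := Int.emod_nonneg i (b := (m + 1 : ℕ)) (by omega)
      have a4 := Int.emod_lt_of_pos i (b := (m + 1 : ℕ)) (by omega)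
      rw [Int.toNat_of_nonneg a1]
      generalize hN : ((m + 1 : ℕ) : ℤ) = N at *
      by_cases h : i % N + (z - i) < N
      · left
        have e : (i % N + (z - i)) % N = i % N + (z - i) := Int.emod_eq_of_lt (by omega) h
        rw [← e, Int.emod_add_emod]; congr 1; ring
      · right
        have e : (i % N + (z - i) - N) % N = i % N + (z - i) - N :=
          Int.emod_eq_of_lt (by omega) (by omega)
        rw [← e, Int.sub_emod_right, Int.emod_add_emod]; congr 1; ring
    have b1 := key i le_rfl (by omega)
    have b2 := key j (by omega) (by omega)
    have b3 := key k (by omega) (by omega)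
    have c1 := (f i).2
    have c2 := (f j).2
    have c3 := (f k).2
    have a3 := Int.emod_nonneg i (b := (m + 1 : ℕ)) (by omega)
    have a4 := Int.emod_lt_of_pos i (b := (m + 1 : ℕ)) (by omega)
    -- Within one window the residues wrap around at most once, so they are increasing up to a
    -- cyclic rotation, which does not change the determinant.
    have : (f i < f j ∧ f j < f k) ∨ (f j < f k ∧ f k < f i) ∨ (f k < f i ∧ f i < f j) := by
      simp only [Fin.lt_def]
      omega
    rcases this with h | h | h
    · exact he _ _ _ h.1 h.2
    · rw [← det3_rotate]; exact he _ _ _ h.1 h.2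
    · rw [det3_rotate]; exact he _ _ _ h.1 h.2

end SphericalPolygon
end

/-! ### Thickness as an inner product bound on the dual cone -/

noncomputable section

namespace SphericalPolygon

open InnerProductGeometry Filter Topology
open scoped RealInnerProductSpace

/-- The dual cone of a subset of the sphere. -/
def dual (R : Set S2) : Set E3 := {y | ∀ x ∈ R, 0 ≤ ⟪y, (x : E3)⟫}

lemma coe_neg_S2 (a : S2) : ((-a : S2) : E3) = -(a : E3) := rfl

lemma sphere_ne_zero (a : S2) : (a : E3) ≠ 0 := fun h => by simpa [h] using norm_eq_of_mem_sphere a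

lemma eq_or_eq_neg_of_inner_sq {x y : S2} (h : ⟪(x : E3), (y : E3)⟫ ^ 2 = 1) : x = y ∨ x = -y := by
  have h' : (⟪(x : E3), (y : E3)⟫ - 1) * (⟪(x : E3), (y : E3)⟫ + 1) = 0 := by linarith
  rcases mul_eq_zero.1 h' with h | h
  · left
    exact Subtype.ext (eq_of_inner_eq_one (real_inner_self_sphere x) (real_inner_self_sphere y)
      (by linarith))
  · right
    refine Subtype.ext (eq_of_inner_eq_one (real_inner_self_sphere x)
      (real_inner_self_sphere (-y)) ?_)
    rw [coe_neg_S2, inner_neg_right]; linarith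

/-- With m = ⟪g, h⟫ both orthogonal components have squared norm 1 − m², and their inner product is
−m(1 − m²), so the cosine of the thickness is −m. -/
lemma luneThickness_eq {g h : S2} (h1 : g ≠ h) (h2 : g ≠ -h) :
    luneThickness g h = Real.pi - angle (g : E3) (h : E3) := by
  have hg := real_inner_self_sphere g
  have hh := real_inner_self_sphere h
  set m := ⟪(g : E3), (h : E3)⟫ with hm
  have hm' : ⟪(h : E3), (g : E3)⟫ = m := real_inner_comm _ _
  have hm1 : m ^ 2 < 1 := by
    have := abs_inner_le_one hg hh
    rw [← sq_le_one_iff_abs_le_one] at this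
    refine lt_of_le_of_ne this fun h => ?_
    exact (eq_or_eq_neg_of_inner_sq h).elim h1 h2
  have n1 : ⟪orthComponent g h, orthComponent g h⟫ = 1 - m ^ 2 := by
    simp only [orthComponent, inner_sub_left, inner_sub_right, real_inner_smul_left,
      real_inner_smul_right, hg, hh, hm', ← hm]; ring
  have n2 : ⟪orthComponent h g, orthComponent h g⟫ = 1 - m ^ 2 := by
    simp only [orthComponent, inner_sub_left, inner_sub_right, real_inner_smul_left,
      real_inner_smul_right, hg, hh, hm', ← hm]; ring
  have n3 : ⟪orthComponent g h, orthComponent h g⟫ = -m * (1 - m ^ 2) := by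
    simp only [orthComponent, inner_sub_left, inner_sub_right, real_inner_smul_left,
      real_inner_smul_right, hg, hh, hm', ← hm]; ring
  have p1 : 0 < ‖orthComponent g h‖ := by
    rw [norm_pos_iff]; intro h0; rw [h0, inner_zero_left] at n1; linarith
  have p2 : 0 < ‖orthComponent h g‖ := by
    rw [norm_pos_iff]; intro h0; rw [h0, inner_zero_left] at n2; linarith
  rw [luneThickness, semicircleCenter, semicircleCenter,
    angle_smul_left_of_pos _ _ (inv_pos.2 p1), angle_smul_right_of_pos _ _ (inv_pos.2 p2)]
  rw [real_inner_self_eq_norm_sq] at n1 n2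
  have n4 : ‖orthComponent g h‖ = ‖orthComponent h g‖ :=
    (pow_left_inj₀ p1.le p2.le two_ne_zero).1 (n1.trans n2.symm)
  rw [angle, angle, n3, n4, ← pow_two, n2, norm_eq_of_mem_sphere, norm_eq_of_mem_sphere, ← hm,
    mul_div_cancel_right₀ _ (by linarith), ← Real.arccos_neg]
  simp

/-- Normalisation is continuous near `x`, so an open subset of the sphere leaves room for small
linear moves in any direction. -/
lemma exists_perturb {U : Set S2} (hU : IsOpen U) {x : S2} (hx : x ∈ U) (y : E3) :
    ∃ s : ℝ, 0 < s ∧ ∃ z ∈ U, ∃ r : ℝ, 0 < r ∧ (z : E3) = r • ((x : E3) + s • y) := by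
  obtain ⟨O, hO, rfl⟩ := isOpen_induced_iff.1 hU
  have hcont : Continuous fun s : ℝ => (x : E3) + s • y := by fun_prop
  have h0 : (x : E3) + (0 : ℝ) • y ≠ 0 := by simpa using sphere_ne_zero x
  have hc : ContinuousAt (fun s : ℝ => ‖(x : E3) + s • y‖⁻¹ • ((x : E3) + s • y)) 0 :=
    ((hcont.norm.continuousAt).inv₀ (norm_ne_zero_iff.2 h0)).smul hcont.continuousAt
  have h1 : ∀ᶠ s in 𝓝 (0 : ℝ), ‖(x : E3) + s • y‖⁻¹ • ((x : E3) + s • y) ∈ O := by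
    apply hc.eventually_mem
    simpa using hO.mem_nhds hx
  have h2 : ∀ᶠ s in 𝓝 (0 : ℝ), (x : E3) + s • y ≠ 0 := hcont.continuousAt.eventually_ne h0
  obtain ⟨s, ⟨hs1, hs2⟩, hs⟩ := (((h1.and h2).filter_mono nhdsWithin_le_nhds).and
    (self_mem_nhdsWithin : Set.Ioi (0 : ℝ) ∈ 𝓝[>] 0)).exists
  refine ⟨s, hs, ⟨‖(x : E3) + s • y‖⁻¹ • ((x : E3) + s • y), ?_⟩, hs1, _,
    inv_pos.2 (norm_pos_iff.2 hs2), rfl⟩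
  rw [mem_sphere_zero_iff_norm, norm_smul, norm_inv, norm_norm,
    inv_mul_cancel₀ (norm_ne_zero_iff.2 hs2)]

/-- A set with interior does not lie on a great circle. In particular its dual cone contains no pair
of antipodal unit vectors. -/
lemma exists_inner_ne_zero {R : Set S2} (hR : (interior R).Nonempty) {g : E3} (hg : g ≠ 0) :
    ∃ x ∈ R, ⟪g, (x : E3)⟫ ≠ 0 := by
  obtain ⟨x, hx⟩ := hR
  by_cases h : ⟪g, (x : E3)⟫ = 0
  · obtain ⟨s, hs, z, hz, r, hr, h'⟩ := exists_perturb isOpen_interior hx g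
    refine ⟨z, interior_subset hz, ?_⟩
    rw [h', real_inner_smul_right, inner_add_right, real_inner_smul_right, h, zero_add]
    have : 0 < ⟪g, g⟫ := real_inner_self_pos.2 hg
    positivity
  · exact ⟨x, interior_subset hx, h⟩

lemma mem_dual_iff {R : Set S2} {g : S2} : (g : E3) ∈ dual R ↔ R ⊆ hemisphere g := by
  refine forall₂_congr fun x _ => ?_
  have := cos_angle_unit (real_inner_self_sphere g) (real_inner_self_sphere x)
  rw [← this]
  constructor
  · intro h
    by_contra h'
    have h' : Real.pi / 2 < angle (g : E3) (x : E3) := not_le.1 h'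
    have := Real.cos_neg_of_pi_div_two_lt_of_lt h' (by linarith [angle_le_pi (g : E3) x, Real.pi_pos])
    linarith
  · intro h
    exact Real.cos_nonneg_of_neg_pi_div_two_le_of_le
      (by linarith [angle_nonneg (g : E3) x, Real.pi_pos]) h

lemma thickness_nonneg (R : Set S2) : 0 ≤ thickness R := by
  apply Real.sInf_nonneg
  rintro _ ⟨g, h, -, -, -, rfl⟩
  exact angle_nonneg _ _

lemma neg_cos_thickness_le {R : Set S2} (hR : (interior R).Nonempty) {g h : S2}
    (hg : (g : E3) ∈ dual R) (hh : (h : E3) ∈ dual R) :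
    -Real.cos (thickness R) ≤ ⟪(g : E3), (h : E3)⟫ := by
  by_cases h1 : g = h
  · rw [h1, real_inner_self_sphere]; linarith [Real.neg_one_le_cos (thickness R)]
  by_cases h2 : g = -h
  · obtain ⟨x, hx, hne⟩ := exists_inner_ne_zero hR (sphere_ne_zero h)
    have h3 := hg x hx
    rw [h2, coe_neg_S2, inner_neg_left] at h3
    exact absurd (le_antisymm (by linarith) (hh x hx)) hne
  have hle : thickness R ≤ Real.pi - angle (g : E3) h := by
    rw [← luneThickness_eq h1 h2]
    refine csInf_le ⟨0, ?_⟩ ⟨g, h, h1, h2, Set.subset_inter (mem_dual_iff.1 hg)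
      (mem_dual_iff.1 hh), rfl⟩
    rintro _ ⟨g, h, -, -, -, rfl⟩
    exact angle_nonneg _ _
  rw [← cos_angle_unit (real_inner_self_sphere g) (real_inner_self_sphere h), ← Real.cos_pi_sub]
  exact Real.cos_le_cos_of_nonneg_of_le_pi (angle_nonneg _ _) (by linarith [thickness_nonneg R])
    (by linarith)

lemma neg_cos_thickness_mul_le {R : Set S2} (hR : (interior R).Nonempty) {y z : E3}
    (hy : y ∈ dual R) (hz : z ∈ dual R) :
    -Real.cos (thickness R) * (‖y‖ * ‖z‖) ≤ ⟪y, z⟫ := by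
  by_cases hy0 : y = 0
  · simp [hy0]
  by_cases hz0 : z = 0
  · simp [hz0]
  have py := norm_pos_iff.2 hy0
  have pz := norm_pos_iff.2 hz0
  have key := neg_cos_thickness_le hR (g := ⟨‖y‖⁻¹ • y, by simp [norm_smul, hy0]⟩)
    (h := ⟨‖z‖⁻¹ • z, by simp [norm_smul, hz0]⟩)
    (fun x hx => by
      rw [real_inner_smul_left]; exact mul_nonneg (inv_nonneg.2 py.le) (hy x hx))
    (fun x hx => by
      rw [real_inner_smul_left]; exact mul_nonneg (inv_nonneg.2 pz.le) (hz x hx))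
  rw [real_inner_smul_left, real_inner_smul_right] at key
  have e : ⟪y, z⟫ = (‖y‖⁻¹ * (‖z‖⁻¹ * ⟪y, z⟫)) * (‖y‖ * ‖z‖) := by field_simp
  rw [e]
  exact mul_le_mul_of_nonneg_right key (by positivity)

/-- If `h` and `g` are unit vectors in the dual of a closed convex set that minimize the inner
product, then the center of the semicircle `h/g` belongs to the set. -/
lemma center_mem {R : Set S2} (hR : IsConvex R) (hcl : IsClosed R) {g h : E3} {m : ℝ}
    (hh1 : ⟪h, h⟫ = 1) (hg1 : ⟪g, g⟫ = 1) (hm : ⟪g, h⟫ = m) (hm0 : m ≤ 0)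
    (hg : g ∈ dual R) (hh : h ∈ dual R)
    (hmin : ∀ y ∈ dual R, ∀ z ∈ dual R, m * (‖y‖ * ‖z‖) ≤ ⟪y, z⟫) {y : S2} {r : ℝ} (hr : 0 < r)
    (hy : r • (y : E3) = g - m • h) : y ∈ R := by
  by_contra hyR
  obtain ⟨z, hz, hzy⟩ := exists_separating hR hcl hyR
  have hd : ⟪z, g⟫ - m * ⟪z, h⟫ < 0 := by
    rw [← real_inner_smul_right, ← inner_sub_right, ← hy, real_inner_smul_right]
    exact mul_neg_of_pos_of_neg hr hzy
  set q := ⟪z, z⟫ with hq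
  have hq0 : 0 ≤ q := real_inner_self_nonneg
  set δ := -(⟪z, g⟫ - m * ⟪z, h⟫) with hδ
  have hmq : 0 ≤ -m * q := mul_nonneg (by linarith) hq0
  -- Tilting `h` to `h + s • z` stays in the dual cone. Minimality would give δ ≤ −mqs/2, while this
  -- `s` satisfies δ = s(−mq + 1), which is larger.
  set s := δ / (-m * q + 1) with hs
  have hs0 : 0 < s := div_pos (by linarith) (by linarith)
  have h1 := hmin g hg (h + s • z) (fun x hx => by
    rw [inner_add_left, real_inner_smul_left]
    exact add_nonneg (hh x hx) (mul_nonneg hs0.le (hz x hx)))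
  rw [norm_eq_one_of_inner hg1, one_mul, inner_add_right, real_inner_smul_right, hm,
    real_inner_comm z g] at h1
  have h2 : ‖h + s • z‖ ^ 2 = 1 + 2 * (s * ⟪z, h⟫) + s ^ 2 * q := by
    rw [← real_inner_self_eq_norm_sq, inner_add_left, inner_add_right, inner_add_right,
      real_inner_smul_left, real_inner_smul_left, real_inner_smul_right, real_inner_smul_right, hh1,
      real_inner_comm z h, ← hq]; ring
  have h3 : ‖h + s • z‖ ≤ 1 + s * ⟪z, h⟫ + s ^ 2 * q / 2 := by
    nlinarith [sq_nonneg (‖h + s • z‖ - 1)]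
  have h4 : s * δ ≤ -m * q * s ^ 2 / 2 := by nlinarith
  have h5 : δ ≤ -m * q * s / 2 := by nlinarith
  have h6 : s * (-m * q + 1) = δ := div_mul_cancel₀ _ (by linarith)
  nlinarith

lemma exists_minimal_pair (R : Set S2) (hne : ∃ g : S2, (g : E3) ∈ dual R) :
    ∃ g h : S2, (g : E3) ∈ dual R ∧ (h : E3) ∈ dual R ∧
      ∀ g' h' : S2, (g' : E3) ∈ dual R → (h' : E3) ∈ dual R →
        ⟪(g : E3), (h : E3)⟫ ≤ ⟪(g' : E3), (h' : E3)⟫ := by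
  have hcl : IsClosed {g : S2 | (g : E3) ∈ dual R} := by
    have : {g : S2 | (g : E3) ∈ dual R} = ⋂ x ∈ R, {g : S2 | 0 ≤ ⟪(g : E3), (x : E3)⟫} := by
      ext g; simp [dual]
    rw [this]
    exact isClosed_biInter fun x _ => isClosed_le continuous_const (by fun_prop)
  obtain ⟨g₀, hg₀⟩ := hne
  obtain ⟨⟨g, h⟩, ⟨hg, hh⟩, hmin⟩ := (hcl.isCompact.prod hcl.isCompact).exists_isMinOn
    ⟨(g₀, g₀), hg₀, hg₀⟩ (f := fun p : S2 × S2 => ⟪(p.1 : E3), (p.2 : E3)⟫) (by fun_prop)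
  exact ⟨g, h, hg, hh, fun g' h' hg' hh' => hmin (Set.mk_mem_prod hg' hh')⟩

end SphericalPolygon
end

/-! ### Lunes of minimal thickness at exposed points of a reduced body -/

noncomputable section

namespace SphericalPolygon

open InnerProductGeometry Filter Topology
open scoped RealInnerProductSpace

lemma exists_dual_of_thickness_lt {R V : Set S2} (hRV : R ⊆ V) (h : thickness R < thickness V) :
    ∃ g h : S2, (g : E3) ∈ dual R ∧ (h : E3) ∈ dual R ∧
      ⟪(g : E3), (h : E3)⟫ < -Real.cos (thickness V) := by
  have hne : {d | ∃ g h : S2, g ≠ h ∧ g ≠ -h ∧ R ⊆ hemisphere g ∩ hemisphere h ∧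
      d = luneThickness g h}.Nonempty := by
    -- If no lune contained `R`, none would contain `V`, and both infima would be the default value
    -- 0 for the empty set.
    by_contra h0
    have hV0 : ¬ {d | ∃ g h : S2, g ≠ h ∧ g ≠ -h ∧ V ⊆ hemisphere g ∩ hemisphere h ∧
        d = luneThickness g h}.Nonempty := by
      rintro ⟨d, g, h, h1, h2, h3, rfl⟩
      exact h0 ⟨_, g, h, h1, h2, hRV.trans h3, rfl⟩
    have := thickness_nonneg R
    rw [thickness, thickness, Set.not_nonempty_iff_eq_empty.1 h0,
      Set.not_nonempty_iff_eq_empty.1 hV0] at h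
    exact lt_irrefl _ h
  obtain ⟨_, ⟨g, h', h1, h2, h3, rfl⟩, hlt⟩ := exists_lt_of_csInf_lt hne h
  rw [luneThickness_eq h1 h2] at hlt
  refine ⟨g, h', mem_dual_iff.2 (h3.trans Set.inter_subset_left),
    mem_dual_iff.2 (h3.trans Set.inter_subset_right), ?_⟩
  have hle : thickness V ≤ Real.pi := by
    have hb : BddBelow {d | ∃ g h : S2, g ≠ h ∧ g ≠ -h ∧ V ⊆ hemisphere g ∩ hemisphere h ∧
        d = luneThickness g h} := by
      refine ⟨0, ?_⟩
      rintro _ ⟨g, h, -, -, -, rfl⟩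
      exact angle_nonneg _ _
    by_cases hV0 : {d | ∃ g h : S2, g ≠ h ∧ g ≠ -h ∧ V ⊆ hemisphere g ∩ hemisphere h ∧
        d = luneThickness g h}.Nonempty
    · obtain ⟨d, hd⟩ := hV0
      refine (csInf_le hb hd).trans ?_
      obtain ⟨g, h, -, -, -, rfl⟩ := hd
      exact angle_le_pi _ _
    · rw [thickness, Set.not_nonempty_iff_eq_empty.1 hV0, Real.sInf_empty]
      exact Real.pi_pos.le
  rw [← cos_angle_unit (real_inner_self_sphere g) (real_inner_self_sphere h'), ← Real.cos_pi_sub]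
  exact Real.cos_lt_cos_of_nonneg_of_le_pi (by linarith) (angle_le_pi _ _) (by linarith)

lemma mem_of_comb {V : Set S2} (hV : IsConvex V) {x y z : S2} (hx : x ∈ V) (hy : y ∈ V) {s t : ℝ}
    (hs : 0 ≤ s) (ht : 0 ≤ t) (h : (z : E3) = s • (x : E3) + t • (y : E3)) : z ∈ V :=
  (hV x hx y hy).2 ⟨s, t, hs, ht, h⟩

/-- The part of a set beyond a plane at positive height. -/
def cut (V : Set S2) (c : E3) (η : ℝ) : Set S2 := V ∩ {x | η ≤ ⟪c, (x : E3)⟫}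

section

variable {V : Set S2} {a : S2} {c : E3}

lemma exists_interior_inner_pos (hV : IsConvexBody V) (hca : ⟪c, (a : E3)⟫ = 0)
    (hc : ∀ x ∈ V, x ≠ a → 0 < ⟪c, (x : E3)⟫) (hc0 : c ≠ 0) :
    ∃ x ∈ interior V, 0 < ⟪c, (x : E3)⟫ := by
  obtain ⟨x, hx⟩ := hV.interior_nonempty
  by_cases h : x = a
  · obtain ⟨s, hs, z, hz, r, hr, h'⟩ := exists_perturb isOpen_interior hx c
    refine ⟨z, hz, ?_⟩
    rw [h', real_inner_smul_right, inner_add_right, real_inner_smul_right, h, hca, zero_add]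
    have : 0 < ⟪c, c⟫ := real_inner_self_pos.2 hc0
    positivity
  · exact ⟨x, hx, hc x (interior_subset hx) h⟩

lemma cut_isConvexBody (hV : IsConvexBody V) {η : ℝ} (hη : 0 < η) {x : S2} (hx : x ∈ interior V)
    (hxη : η < ⟪c, (x : E3)⟫) : IsConvexBody (cut V c η) := by
  refine ⟨fun p hp q hq => ⟨(hV.convex p hp.1 q hq.1).1, fun z hz => ?_⟩,
    hV.closed.inter (isClosed_le continuous_const (by fun_prop)), x, ?_⟩
  · refine ⟨(hV.convex p hp.1 q hq.1).2 hz, ?_⟩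
    obtain ⟨s, t, hs, ht, h⟩ := hz
    -- A unit vector combined from two unit vectors has coefficient sum at least 1 by the triangle
    -- inequality; since η > 0, the height bound passes to the whole arc.
    have h1 : (1 : ℝ) ≤ s + t := by
      have := norm_add_le (s • (p : E3)) (t • (q : E3))
      rw [← h, norm_smul, norm_smul, norm_eq_of_mem_sphere, norm_eq_of_mem_sphere,
        norm_eq_of_mem_sphere, Real.norm_of_nonneg hs, Real.norm_of_nonneg ht] at this
      linarith
    have h2 : η ≤ ⟪c, (p : E3)⟫ := hp.2
    have h3 : η ≤ ⟪c, (q : E3)⟫ := hq.2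
    change η ≤ ⟪c, (z : E3)⟫
    rw [h, inner_comb_right]
    nlinarith [mul_le_mul_of_nonneg_left h2 hs, mul_le_mul_of_nonneg_left h3 ht]
  · rw [mem_interior]
    exact ⟨interior V ∩ {x | η < ⟪c, (x : E3)⟫},
      fun z hz => ⟨interior_subset hz.1, Set.mem_ofPred.2 (Set.mem_ofPred.1 hz.2).le⟩,
      isOpen_interior.inter (isOpen_lt continuous_const (by fun_prop)), hx, hxη⟩

/-- Cutting off a neighborhood of `a` from a reduced body `V` yields a lune, thinner than `V`,
around the rest, for which the center of one semicircle lies on the cut. -/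
lemma IsReduced.exists_lune_cut (hV : IsReduced V) (ha : a ∈ V) (hca : ⟪c, (a : E3)⟫ = 0)
    (hcos : 0 < Real.cos (thickness V))
    {η : ℝ} (hη : 0 < η) {x : S2} (hx : x ∈ interior V) (hxη : η < ⟪c, (x : E3)⟫) :
    ∃ g h y : S2, (g : E3) ∈ dual (cut V c η) ∧ (h : E3) ∈ dual (cut V c η) ∧ y ∈ V ∧
      ⟪(g : E3), (h : E3)⟫ ≤ -Real.cos (thickness V) ∧ ⟪c, (y : E3)⟫ = η ∧
      √(1 - ⟪(g : E3), (h : E3)⟫ ^ 2) • (y : E3) = (g : E3) - ⟪(g : E3), (h : E3)⟫ • (h : E3) := by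
  have hR := cut_isConvexBody hV.convexBody hη hx hxη
  set R := cut V c η with hRdef
  have hRV : R ⊂ V := by
    refine ⟨Set.inter_subset_left, fun h => ?_⟩
    have : η ≤ ⟪c, (a : E3)⟫ := (h ha).2
    linarith
  obtain ⟨g₀, h₀, hg₀, hh₀, hlt⟩ :=
    exists_dual_of_thickness_lt hRV.1 (hV.thickness_lt R hR hRV)
  obtain ⟨g, h, hg, hh, hmin⟩ := exists_minimal_pair R ⟨g₀, hg₀⟩
  have hm := (hmin g₀ h₀ hg₀ hh₀).trans_lt hlt
  -- The two hemispheres cannot both contain `V`, as the lune is thinner than `V`. The argument is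
  -- symmetric, so `h` may be taken to be one that does not.
  have key : ∀ g h : S2, (g : E3) ∈ dual R → (h : E3) ∈ dual R →
      (∀ g' h' : S2, (g' : E3) ∈ dual R → (h' : E3) ∈ dual R →
        ⟪(g : E3), (h : E3)⟫ ≤ ⟪(g' : E3), (h' : E3)⟫) →
      ⟪(g : E3), (h : E3)⟫ < -Real.cos (thickness V) → (h : E3) ∉ dual V →
      ∃ g h y : S2, (g : E3) ∈ dual R ∧ (h : E3) ∈ dual R ∧ y ∈ V ∧
      ⟪(g : E3), (h : E3)⟫ ≤ -Real.cos (thickness V) ∧ ⟪c, (y : E3)⟫ = η ∧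
      √(1 - ⟪(g : E3), (h : E3)⟫ ^ 2) • (y : E3) =
        (g : E3) - ⟪(g : E3), (h : E3)⟫ • (h : E3) := by
    intro g h hg hh hmin hm hhV
    have hg1 := real_inner_self_sphere g
    have hh1 := real_inner_self_sphere h
    set m := ⟪(g : E3), (h : E3)⟫ with hmdef
    have hm' : ⟪(h : E3), (g : E3)⟫ = m := real_inner_comm _ _
    have hm1 : m ^ 2 < 1 := by
      have h1 := (sq_le_one_iff_abs_le_one m).2 (abs_inner_le_one hg1 hh1)
      refine lt_of_le_of_ne h1 fun h2 => ?_
      rcases eq_or_eq_neg_of_inner_sq h2 with h3 | h3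
      · rw [h3] at hmdef; linarith
      · obtain ⟨z, hz, hne⟩ := exists_inner_ne_zero hR.interior_nonempty (sphere_ne_zero h)
        have h4 := hg z hz
        rw [h3, coe_neg_S2, inner_neg_left] at h4
        exact hne (le_antisymm (by linarith) (hh z hz))
    have hr : 0 < √(1 - m ^ 2) := Real.sqrt_pos.2 (by linarith)
    have hr2 : √(1 - m ^ 2) ^ 2 = 1 - m ^ 2 := Real.sq_sqrt (by linarith)
    set r := √(1 - m ^ 2) with hrdef
    have hn : ⟪(g : E3) - m • (h : E3), (g : E3) - m • (h : E3)⟫ = r ^ 2 := by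
      simp only [inner_sub_left, inner_sub_right, real_inner_smul_left, real_inner_smul_right, hg1,
        hh1, hm', ← hmdef, hr2]; ring
    have hn' : ‖(g : E3) - m • (h : E3)‖ = r := by
      rw [real_inner_self_eq_norm_sq] at hn
      exact (pow_left_inj₀ (norm_nonneg _) hr.le two_ne_zero).1 hn
    obtain ⟨y, hy⟩ : ∃ y : S2, r • (y : E3) = (g : E3) - m • (h : E3) :=
      ⟨⟨r⁻¹ • ((g : E3) - m • (h : E3)), by
        rw [mem_sphere_zero_iff_norm, norm_smul, hn', norm_inv, Real.norm_of_nonneg hr.le,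
          inv_mul_cancel₀ hr.ne']⟩, by rw [smul_smul, mul_inv_cancel₀ hr.ne', one_smul]⟩
    have hyR : y ∈ R := by
      refine center_mem hR.convex hR.closed hh1 hg1 rfl (by linarith) hg hh ?_ hr hy
      intro p hp q hq
      by_cases hp0 : p = 0
      · simp [hp0]
      by_cases hq0 : q = 0
      · simp [hq0]
      have pp := norm_pos_iff.2 hp0
      have pq := norm_pos_iff.2 hq0
      have key := hmin ⟨‖p‖⁻¹ • p, by simp [norm_smul, hp0]⟩ ⟨‖q‖⁻¹ • q, by simp [norm_smul, hq0]⟩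
        (fun x hx => by
          rw [real_inner_smul_left]; exact mul_nonneg (inv_nonneg.2 pp.le) (hp x hx))
        (fun x hx => by
          rw [real_inner_smul_left]; exact mul_nonneg (inv_nonneg.2 pq.le) (hq x hx))
      rw [real_inner_smul_left, real_inner_smul_right] at key
      have e : ⟪p, q⟫ = (‖p‖⁻¹ * (‖q‖⁻¹ * ⟪p, q⟫)) * (‖p‖ * ‖q‖) := by field_simp
      rw [e]
      exact mul_le_mul_of_nonneg_right key (by positivity)
    have hhy : ⟪(h : E3), (y : E3)⟫ = 0 := by
      have : r * ⟪(h : E3), (y : E3)⟫ = 0 := by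
        rw [← real_inner_smul_right, hy, inner_sub_right, real_inner_smul_right, hm', hh1]; ring
      exact (mul_eq_zero.1 this).resolve_left hr.ne'
    refine ⟨g, h, y, hg, hh, hyR.1, hm.le, le_antisymm ?_ hyR.2, hy⟩
    -- If `y` were strictly beyond the cut, a small move from `y` towards a point of `V` outside the
    -- hemisphere of `h` would stay in the cut body and leave that hemisphere, because `h` is
    -- orthogonal to `y`.
    by_contra! hlt
    have : ∃ z ∈ V, ⟪(h : E3), (z : E3)⟫ < 0 := by
      by_contra! h'
      exact hhV h'
    obtain ⟨z, hz, hhz⟩ := this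
    obtain ⟨s, hs, p, hp, t, ht, hpe⟩ := exists_perturb (U := {p : S2 | η < ⟪c, (p : E3)⟫})
      (isOpen_lt continuous_const (by fun_prop)) (x := y) hlt z
    have hpV : p ∈ V := mem_of_comb hV.convexBody.convex hyR.1 hz ht.le (mul_pos ht hs).le
      (by rw [hpe, smul_add, smul_smul])
    have h5 : 0 ≤ ⟪(h : E3), (p : E3)⟫ := hh p ⟨hpV, Set.mem_ofPred.2 (Set.mem_ofPred.1 hp).le⟩
    rw [hpe, real_inner_smul_right, inner_add_right, real_inner_smul_right, hhy, zero_add] at h5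
    have := mul_neg_of_pos_of_neg hs hhz
    have := mul_neg_of_pos_of_neg ht this
    linarith
  by_cases hgV : (g : E3) ∈ dual V
  · refine key g h hg hh hmin hm fun hhV => ?_
    have := neg_cos_thickness_le hV.convexBody.interior_nonempty hgV hhV
    linarith
  · refine key h g hh hg (fun g' h' hg' hh' => ?_) (by rwa [real_inner_comm]) hgV
    rw [real_inner_comm]; exact hmin g' h' hg' hh'

lemma IsReduced.thickness_pos (hV : IsReduced V) (ha : a ∈ V) (hca : ⟪c, (a : E3)⟫ = 0)
    (hc : ∀ x ∈ V, x ≠ a → 0 < ⟪c, (x : E3)⟫) (hc0 : c ≠ 0) : 0 < thickness V := by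
  obtain ⟨x, hx, hxc⟩ := exists_interior_inner_pos hV.convexBody hca hc hc0
  have hR := cut_isConvexBody hV.convexBody (half_pos hxc) hx (half_lt_self hxc)
  refine (thickness_nonneg _).trans_lt (hV.thickness_lt _ hR ⟨Set.inter_subset_left, fun h => ?_⟩)
  have : ⟪c, (x : E3)⟫ / 2 ≤ ⟪c, (a : E3)⟫ := (h ha).2
  linarith

/-- Every exposed point `a` of a reduced body is the center of one of the two semicircles that
bound a lune of minimal thickness around the body; the other center belongs to the body. -/
lemma IsReduced.exists_lune (hV : IsReduced V) (hth : thickness V < Real.pi / 2) (ha : a ∈ V)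
    (hca : ⟪c, (a : E3)⟫ = 0) (hc : ∀ x ∈ V, x ≠ a → 0 < ⟪c, (x : E3)⟫) (hc0 : c ≠ 0) :
    ∃ h : E3, ⟪h, h⟫ = 1 ∧ ⟪(a : E3), h⟫ = 0 ∧ h ∈ dual V ∧
      Real.sin (thickness V) • (a : E3) - Real.cos (thickness V) • h ∈ dual V ∧
      ∃ t ∈ V, (t : E3) = Real.cos (thickness V) • (a : E3) + Real.sin (thickness V) • h := by
  have hpos := hV.thickness_pos ha hca hc hc0
  have hcos : 0 < Real.cos (thickness V) := Real.cos_pos_of_mem_Ioo ⟨by linarith, hth⟩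
  have hsin : 0 < Real.sin (thickness V) := Real.sin_pos_of_pos_of_lt_pi hpos (by linarith)
  have hcs := Real.sin_sq_add_cos_sq (thickness V)
  have hT1 := fun g h => neg_cos_thickness_le hV.convexBody.interior_nonempty (g := g) (h := h)
  have hT2 := fun y z => neg_cos_thickness_mul_le hV.convexBody.interior_nonempty (y := y) (z := z)
  obtain ⟨x, hx, hxc⟩ := exists_interior_inner_pos hV.convexBody hca hc hc0
  -- Cuts of height tending to 0; the summand 2 keeps even the first one strictly below the interior
  -- point `x`.
  have hseq : ∀ k : ℕ, ∃ p : S2 × S2 × S2, (p.1 : E3) ∈ dual (cut V c (⟪c, (x : E3)⟫ / (k + 2))) ∧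
      (p.2.1 : E3) ∈ dual (cut V c (⟪c, (x : E3)⟫ / (k + 2))) ∧ p.2.2 ∈ V ∧
      ⟪(p.1 : E3), (p.2.1 : E3)⟫ ≤ -Real.cos (thickness V) ∧
      ⟪c, (p.2.2 : E3)⟫ = ⟪c, (x : E3)⟫ / (k + 2) ∧
      √(1 - ⟪(p.1 : E3), (p.2.1 : E3)⟫ ^ 2) • (p.2.2 : E3) =
        (p.1 : E3) - ⟪(p.1 : E3), (p.2.1 : E3)⟫ • (p.2.1 : E3) := by
    intro k
    have hk : (0 : ℝ) < k + 2 := by positivity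
    obtain ⟨g, h, y, h1⟩ := hV.exists_lune_cut ha hca hcos (div_pos hxc hk) hx
      (div_lt_self hxc (by linarith [(Nat.cast_nonneg k : (0 : ℝ) ≤ k)]))
    exact ⟨(g, h, y), h1⟩
  choose p hp1 hp2 hp3 hp4 hp5 hp6 using hseq
  obtain ⟨⟨g, h, y⟩, -, φ, hφ, hlim⟩ := isCompact_univ.tendsto_subseq (fun k => Set.mem_univ (p k))
  have hη : Tendsto (fun k : ℕ => ⟪c, (x : E3)⟫ / ((φ k : ℝ) + 2)) atTop (𝓝 0) := by
    apply Tendsto.div_atTop tendsto_const_nhds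
    exact tendsto_atTop_add_const_right _ _ (tendsto_natCast_atTop_atTop.comp hφ.tendsto_atTop)
  have hlg : Tendsto (fun k => (p (φ k)).1) atTop (𝓝 g) := (continuous_fst.tendsto _).comp hlim
  have hlh : Tendsto (fun k => (p (φ k)).2.1) atTop (𝓝 h) :=
    ((continuous_fst.comp continuous_snd).tendsto _).comp hlim
  have hly : Tendsto (fun k => (p (φ k)).2.2) atTop (𝓝 y) :=
    ((continuous_snd.comp continuous_snd).tendsto _).comp hlim
  have hlg' : Tendsto (fun k => ((p (φ k)).1 : E3)) atTop (𝓝 (g : E3)) :=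
    (continuous_subtype_val.tendsto _).comp hlg
  have hlh' : Tendsto (fun k => ((p (φ k)).2.1 : E3)) atTop (𝓝 (h : E3)) :=
    (continuous_subtype_val.tendsto _).comp hlh
  have hly' : Tendsto (fun k => ((p (φ k)).2.2 : E3)) atTop (𝓝 (y : E3)) :=
    (continuous_subtype_val.tendsto _).comp hly
  have hyV : y ∈ V := hV.convexBody.closed.mem_of_tendsto hly (Eventually.of_forall fun k => hp3 _)
  have hya : y = a := by
    by_contra hne
    have h1 : Tendsto (fun k => ⟪c, ((p (φ k)).2.2 : E3)⟫) atTop (𝓝 ⟪c, (y : E3)⟫) :=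
      tendsto_const_nhds.inner hly'
    simp only [hp5] at h1
    have := tendsto_nhds_unique h1 hη
    exact absurd this (hc y hyV hne).ne'
  subst hya
  obtain ⟨x₀, hx₀V, hx₀⟩ : ∃ x₀ ∈ V, 0 < ⟪c, (x₀ : E3)⟫ := ⟨x, interior_subset hx, hxc⟩
  -- Every point of `V` other than the apex belongs to all late cuts. The apex itself is handled by
  -- moving slightly towards `x₀`, where the limit vector would still be negative.
  have hdual : ∀ (q : ℕ → E3) (u : E3),
      (∀ k, q k ∈ dual (cut V c (⟪c, (x : E3)⟫ / ((φ k : ℝ) + 2)))) →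
      Tendsto q atTop (𝓝 u) → u ∈ dual V := by
    intro q u hq hu
    have h1 : ∀ z ∈ V, z ≠ y → 0 ≤ ⟪u, (z : E3)⟫ := by
      intro z hz hzy
      have hl : Tendsto (fun k => ⟪q k, (z : E3)⟫) atTop (𝓝 ⟪u, (z : E3)⟫) :=
        hu.inner tendsto_const_nhds
      refine ge_of_tendsto hl ?_
      filter_upwards [hη.eventually_le_const (hc z hz hzy)] with k hk
      exact hq k z ⟨hz, hk⟩
    intro z hz
    by_cases hzy : z = y
    · rw [hzy]
      by_contra! hneg
      obtain ⟨s, hs, b, hb, r, hr, hbe⟩ := exists_perturb (U := {z : S2 | ⟪u, (z : E3)⟫ < 0})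
        (isOpen_lt (by fun_prop) continuous_const) (x := y) hneg x₀
      have hbV : b ∈ V := mem_of_comb hV.convexBody.convex ha hx₀V hr.le (mul_pos hr hs).le
        (by rw [hbe, smul_add, smul_smul])
      have hcb : 0 < ⟪c, (b : E3)⟫ := by
        rw [hbe, real_inner_smul_right, inner_add_right, real_inner_smul_right, hca, zero_add]
        positivity
      have := h1 b hbV fun h => by rw [h, hca] at hcb; exact lt_irrefl _ hcb
      exact absurd hb (not_lt.2 this)
    · exact h1 z hz hzy
  have hg : (g : E3) ∈ dual V := hdual _ _ (fun k => hp1 _) hlg'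
  have hh : (h : E3) ∈ dual V := hdual _ _ (fun k => hp2 _) hlh'
  have hlm : Tendsto (fun k => ⟪((p (φ k)).1 : E3), ((p (φ k)).2.1 : E3)⟫) atTop
      (𝓝 ⟪(g : E3), (h : E3)⟫) := hlg'.inner hlh'
  have hm : ⟪(g : E3), (h : E3)⟫ = -Real.cos (thickness V) :=
    le_antisymm (le_of_tendsto hlm (Eventually.of_forall fun k => hp4 _)) (hT1 g h hg hh)
  have hL : Tendsto (fun k => √(1 - ⟪((p (φ k)).1 : E3), ((p (φ k)).2.1 : E3)⟫ ^ 2) •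
      ((p (φ k)).2.2 : E3)) atTop (𝓝 (√(1 - ⟪(g : E3), (h : E3)⟫ ^ 2) • (y : E3))) :=
    ((tendsto_const_nhds.sub (hlm.pow 2)).sqrt).smul hly'
  simp only [hp6] at hL
  have hR : Tendsto (fun k => ((p (φ k)).1 : E3) - ⟪((p (φ k)).1 : E3), ((p (φ k)).2.1 : E3)⟫ •
      ((p (φ k)).2.1 : E3)) atTop (𝓝 ((g : E3) - ⟪(g : E3), (h : E3)⟫ • (h : E3))) :=
    hlg'.sub (hlm.smul hlh')
  have heq := tendsto_nhds_unique hL hR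
  have hroot : √(1 - ⟪(g : E3), (h : E3)⟫ ^ 2) = Real.sin (thickness V) := by
    rw [hm, show 1 - (-Real.cos (thickness V)) ^ 2 = Real.sin (thickness V) ^ 2 by linarith,
      Real.sqrt_sq hsin.le]
  rw [hroot, hm] at heq
  set C := Real.cos (thickness V)
  set S := Real.sin (thickness V)
  have hgeq : S • (y : E3) - C • (h : E3) = (g : E3) := by
    rw [heq]; module
  have hh1 := real_inner_self_sphere h
  have hy1 := real_inner_self_sphere y
  have hyh : ⟪(y : E3), (h : E3)⟫ = 0 := by
    have h1 : S * ⟪(y : E3), (h : E3)⟫ - C * 1 = -C := by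
      rw [← hm, ← hgeq, inner_sub_left, real_inner_smul_left, real_inner_smul_left, hh1]
    have : S * ⟪(y : E3), (h : E3)⟫ = 0 := by linarith
    exact (mul_eq_zero.1 this).resolve_left hsin.ne'
  have htn : ‖C • (y : E3) + S • (h : E3)‖ = 1 := by
    apply norm_eq_one_of_inner
    rw [inner_comb_left, inner_comb_right, inner_comb_right, hy1, hh1, hyh, real_inner_comm, hyh]
    linarith
  refine ⟨h, hh1, hyh, hh, hgeq ▸ hg, ⟨C • (y : E3) + S • (h : E3), by simpa using htn⟩, ?_, rfl⟩
  -- The pair (g, h) is minimal for `V` itself, so the variational argument applies with the roles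
  -- of the hemispheres exchanged and yields the second center.
  refine center_mem hV.convexBody.convex hV.convexBody.closed (h := g) (g := h) (m := -C)
    (real_inner_self_sphere g) hh1 (by rw [real_inner_comm, hm]) (by linarith) hh hg (fun y hy z hz => hT2 y z hy hz) hsin ?_
  rw [← hgeq]
  match_scalars
  · ring
  · linear_combination hcs

end

end SphericalPolygon
end

/-! ### Cyclic polygons and their systems of minimal lunes -/

noncomputable section

namespace SphericalPolygon

open InnerProductGeometry Filter Topology
open scoped RealInnerProductSpace

namespace IsCyclicPolygon

variable {n : ℕ} {w : ℤ → E3}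

lemma periodic_of_dvd (hw : IsCyclicPolygon n w) {i j : ℤ} (h : (n : ℤ) ∣ i - j) : w i = w j := by
  obtain ⟨k, hk⟩ := h
  have hp : Function.Periodic w n := hw.periodic
  have := hp.int_mul k j
  rw [← this]; congr 1; simp only [Int.cast_id] at *; linarith

lemma exists_window (hw : IsCyclicPolygon n w) (i l : ℤ) :
    ∃ l', i ≤ l' ∧ l' < i + n ∧ (n : ℤ) ∣ l' - l := by
  have hn : (0 : ℤ) < n := by have := hw.three_le; omega
  refine ⟨i + (l - i) % n, by linarith [Int.emod_nonneg (l - i) hn.ne'],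
    by linarith [Int.emod_lt_of_pos (l - i) hn], ?_⟩
  have : (n : ℤ) ∣ l - i - (l - i) % n := Int.dvd_self_sub_emod
  rw [show i + (l - i) % n - l = -(l - i - (l - i) % n) by ring]
  exact this.neg_right

lemma exists_window_eq (hw : IsCyclicPolygon n w) (i l : ℤ) :
    ∃ l', i ≤ l' ∧ l' < i + n ∧ (n : ℤ) ∣ l' - l ∧ w l = w l' := by
  obtain ⟨l', h1, h2, h3⟩ := hw.exists_window i l
  exact ⟨l', h1, h2, h3, (hw.periodic_of_dvd h3).symm⟩

lemma ne_of_lt (hw : IsCyclicPolygon n w) {i j : ℤ} (h1 : i < j) (h2 : j < i + n) : w i ≠ w j := by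
  intro h
  have := hw.three_le
  by_cases h3 : j + 1 < i + n
  · have := hw.det_pos i j (j + 1) h1 (by omega) h3
    rw [h, det3_self_left] at this
    exact lt_irrefl _ this
  · have := hw.det_pos i (i + 1) j (by omega) (by omega) h2
    rw [h, det3_self_outer] at this
    exact lt_irrefl _ this

lemma eq_iff (hw : IsCyclicPolygon n w) {i j : ℤ} : w i = w j ↔ (n : ℤ) ∣ i - j := by
  refine ⟨fun h => ?_, hw.periodic_of_dvd⟩
  obtain ⟨l, h1, h2, h3, h4⟩ := hw.exists_window_eq i j
  rcases h1.eq_or_lt with rfl | h5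
  · exact h3
  · exact absurd (h.trans h4) (hw.ne_of_lt h5 h2)

/-- A normal of a plane that supports the polygon exactly at a given vertex. -/
lemma exists_exposing (hw : IsCyclicPolygon n w) (i : ℤ) :
    ∃ c : E3, ⟪c, w i⟫ = 0 ∧ ∀ l, w l ≠ w i → 0 < ⟪c, w l⟫ := by
  have h3 := hw.three_le
  -- The sum of the inner normals of the two sides at `w i`.
  refine ⟨cross3 (w (i - 1)) (w i) + cross3 (w i) (w (i + 1)), ?_, fun l hl => ?_⟩
  · rw [inner_add_left, inner_cross3, inner_cross3, det3_self_right, det3_self_outer, add_zero]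
  · obtain ⟨l', h1, h2, -, h4⟩ := hw.exists_window_eq i l
    rw [h4] at hl ⊢
    have h5 : i < l' := lt_of_le_of_ne h1 fun h => hl (by rw [h])
    rw [inner_add_left, inner_cross3, inner_cross3]
    have hA : 0 ≤ det3 (w (i - 1)) (w i) (w l') := by
      by_cases h : l' = i - 1 + n
      · rw [h, hw.periodic, det3_self_outer]
      · exact (hw.det_pos _ _ _ (by omega) h5 (by omega)).le
    have hB : 0 ≤ det3 (w i) (w (i + 1)) (w l') := by
      by_cases h : l' = i + 1
      · rw [h, det3_self_right]
      · exact (hw.det_pos _ _ _ (by omega) (by omega) (by omega)).le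
    by_cases h : l' = i + 1
    · have := hw.det_pos (i - 1) i l' (by omega) h5 (by omega)
      linarith
    · have := hw.det_pos i (i + 1) l' (by omega) (by omega) (by omega)
      linarith

/-- Nonnegative on all vertices after a small move in an admissible direction. -/
lemma eventually_nonneg (hw : IsCyclicPolygon n w) {y z : E3} (hy : ∀ l, 0 ≤ ⟪y, w l⟫)
    (hz : ∀ l, ⟪y, w l⟫ = 0 → 0 ≤ ⟪z, w l⟫) :
    ∀ᶠ τ : ℝ in 𝓝[>] 0, ∀ l, 0 ≤ ⟪y + τ • z, w l⟫ := by
  have h1 : ∀ᶠ τ : ℝ in 𝓝[>] 0, ∀ l ∈ Finset.Ico (0 : ℤ) n, 0 ≤ ⟪y + τ • z, w l⟫ := by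
    rw [Filter.eventually_all_finset]
    intro l _
    rcases (hy l).eq_or_lt with h | h
    · filter_upwards [self_mem_nhdsWithin] with τ hτ
      rw [inner_add_left, real_inner_smul_left, ← h, zero_add]
      exact mul_nonneg (le_of_lt hτ) (hz l h.symm)
    · have hc : Continuous fun τ : ℝ => ⟪y + τ • z, w l⟫ := by fun_prop
      have := (hc.tendsto 0).eventually_const_le (u := 0) (by simpa using h)
      exact this.filter_mono nhdsWithin_le_nhds
  filter_upwards [h1] with τ hτ l
  obtain ⟨l', h2, h3, -, h4⟩ := hw.exists_window_eq 0 l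
  rw [h4]
  exact hτ l' (Finset.mem_Ico.2 ⟨h2, by omega⟩)

end IsCyclicPolygon

/-- A convex polygon of thickness `arccos C` together with, for each vertex `w i`, a lune of that
thickness around the polygon: `w i` and `t i` are the centers of the semicircles that bound the
lune, `h i` and `g i` the centers of the hemispheres. -/
structure IsLuneSystem (n : ℕ) (w : ℤ → E3) (C S : ℝ) (g h t : ℤ → E3) : Prop where
  poly : IsCyclicPolygon n w
  C_pos : 0 < C
  S_pos : 0 < S
  sq_add_sq : S ^ 2 + C ^ 2 = 1
  inner_ge : ∀ y z : E3, (∀ l, 0 ≤ ⟪y, w l⟫) → (∀ l, 0 ≤ ⟪z, w l⟫) → -C * (‖y‖ * ‖z‖) ≤ ⟪y, z⟫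
  h_unit : ∀ i, ⟪h i, h i⟫ = 1
  h_orth : ∀ i, ⟪w i, h i⟫ = 0
  h_nonneg : ∀ i l, 0 ≤ ⟪h i, w l⟫
  g_nonneg : ∀ i l, 0 ≤ ⟪g i, w l⟫
  g_eq : ∀ i, g i = S • w i - C • h i
  t_eq : ∀ i, t i = C • w i + S • h i
  h_periodic : ∀ i, h (i + n) = h i
  t_comb : ∀ i, ∃ (z : Fin n → ℤ) (l : Fin n → ℝ), (∀ j, 0 ≤ l j) ∧ t i = ∑ j, l j • w (z j)

namespace IsLuneSystem

variable {n : ℕ} {w g h t : ℤ → E3} {C S : ℝ}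

lemma C_lt_one (H : IsLuneSystem n w C S g h t) : C < 1 := by
  nlinarith [H.C_pos, H.S_pos, H.sq_add_sq]

lemma h_orth' (H : IsLuneSystem n w C S g h t) (i : ℤ) : ⟪h i, w i⟫ = 0 := by
  rw [real_inner_comm, H.h_orth]

lemma inner_g (H : IsLuneSystem n w C S g h t) (i : ℤ) (x : E3) :
    ⟪g i, x⟫ = S * ⟪w i, x⟫ - C * ⟪h i, x⟫ := by
  rw [H.g_eq, inner_sub_left, real_inner_smul_left, real_inner_smul_left]

lemma inner_t (H : IsLuneSystem n w C S g h t) (i : ℤ) (x : E3) :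
    ⟪t i, x⟫ = C * ⟪w i, x⟫ + S * ⟪h i, x⟫ := by
  rw [H.t_eq, inner_comb_left]

lemma g_w (H : IsLuneSystem n w C S g h t) (i : ℤ) : ⟪g i, w i⟫ = S := by
  rw [H.inner_g, H.poly.unit, H.h_orth']; ring

lemma t_w (H : IsLuneSystem n w C S g h t) (i : ℤ) : ⟪t i, w i⟫ = C := by
  rw [H.inner_t, H.poly.unit, H.h_orth']; ring

lemma h_t (H : IsLuneSystem n w C S g h t) (i : ℤ) : ⟪h i, t i⟫ = S := by
  rw [H.t_eq, inner_comb_right, H.h_unit, H.h_orth']; ring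

lemma g_unit (H : IsLuneSystem n w C S g h t) (i : ℤ) : ⟪g i, g i⟫ = 1 := by
  rw [H.inner_g, H.g_eq, inner_sub_right, inner_sub_right, real_inner_smul_right,
    real_inner_smul_right, real_inner_smul_right, real_inner_smul_right, H.poly.unit, H.h_unit,
    H.h_orth, H.h_orth']
  linear_combination H.sq_add_sq

lemma t_unit (H : IsLuneSystem n w C S g h t) (i : ℤ) : ⟪t i, t i⟫ = 1 := by
  rw [H.inner_t, H.h_t, real_inner_comm, H.t_w]
  linear_combination H.sq_add_sq

lemma g_t (H : IsLuneSystem n w C S g h t) (i : ℤ) : ⟪g i, t i⟫ = 0 := by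
  rw [H.inner_g, H.h_t, real_inner_comm, H.t_w]; ring

lemma g_h (H : IsLuneSystem n w C S g h t) (i : ℤ) : ⟪g i, h i⟫ = -C := by
  rw [H.inner_g, H.h_unit, H.h_orth]; ring

lemma w_eq (H : IsLuneSystem n w C S g h t) (i : ℤ) : w i = C • t i + S • g i := by
  rw [H.t_eq, H.g_eq]
  match_scalars
  · linear_combination -H.sq_add_sq
  · ring

lemma g_periodic (H : IsLuneSystem n w C S g h t) (i : ℤ) : g (i + n) = g i := by
  rw [H.g_eq, H.g_eq, H.poly.periodic, H.h_periodic]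

lemma t_periodic (H : IsLuneSystem n w C S g h t) (i : ℤ) : t (i + n) = t i := by
  rw [H.t_eq, H.t_eq, H.poly.periodic, H.h_periodic]

/-- The hemispheres of a minimal lune cannot be tilted in opposite directions. -/
lemma not_tilt (H : IsLuneSystem n w C S g h t) {i : ℤ} {u : E3} (hu : ⟪u, u⟫ = 1)
    (huw : ⟪w i, u⟫ = 0) (huh : ⟪h i, u⟫ = 0) (hg : ∀ l, ⟪g i, w l⟫ = 0 → 0 ≤ ⟪u, w l⟫)
    (hh : ∀ l, ⟪h i, w l⟫ = 0 → ⟪u, w l⟫ ≤ 0) : False := by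
  have e1 := H.poly.eventually_nonneg (H.g_nonneg i) hg
  have e2 := H.poly.eventually_nonneg (y := h i) (z := -u) (H.h_nonneg i)
    (fun l hl => by rw [inner_neg_left]; linarith [hh l hl])
  obtain ⟨τ, ⟨h1, h2⟩, hτ⟩ := ((e1.and e2).and (self_mem_nhdsWithin :
    Set.Ioi (0 : ℝ) ∈ 𝓝[>] 0)).exists
  have hτ : 0 < τ := hτ
  have key := H.inner_ge _ _ h1 h2
  have hgu : ⟪g i, u⟫ = 0 := by rw [H.inner_g, huw, huh]; ring
  have n1 : ‖g i + τ • u‖ ^ 2 = 1 + τ ^ 2 := by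
    rw [← real_inner_self_eq_norm_sq, inner_add_left, inner_add_right, inner_add_right,
      real_inner_smul_left, real_inner_smul_left, real_inner_smul_right, real_inner_smul_right,
      H.g_unit, hu, real_inner_comm (g i) u, hgu]; ring
  have n2 : ‖h i + τ • -u‖ ^ 2 = 1 + τ ^ 2 := by
    rw [← real_inner_self_eq_norm_sq, inner_add_left, inner_add_right, inner_add_right,
      real_inner_smul_left, real_inner_smul_left, real_inner_smul_right, real_inner_smul_right,
      inner_neg_left, inner_neg_left, inner_neg_right, inner_neg_right,
      H.h_unit, hu, real_inner_comm (h i) u, huh]; ring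
  have n3 : ‖g i + τ • u‖ = ‖h i + τ • -u‖ :=
    (pow_left_inj₀ (norm_nonneg _) (norm_nonneg _) two_ne_zero).1 (n1.trans n2.symm)
  have n4 : ⟪g i + τ • u, h i + τ • -u⟫ = -C - τ ^ 2 := by
    rw [inner_add_left, inner_add_right, inner_add_right, real_inner_smul_left,
      real_inner_smul_left, real_inner_smul_right, real_inner_smul_right, inner_neg_right,
      inner_neg_right, H.g_h, hu, hgu, real_inner_comm, huh]; ring
  -- The bound now reads −C(1 + τ²) ≤ −C − τ², impossible for τ > 0 since C < 1.
  rw [n3, ← pow_two, n2, n4] at key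
  have := H.C_lt_one
  nlinarith [pow_pos hτ 2]

/-- This cross product is a corner of the lune: a unit vector orthogonal to both hemisphere centers.
It is the direction in which the hemispheres get tilted. -/
lemma axis (H : IsLuneSystem n w C S g h t) (i : ℤ) :
    ⟪cross3 (w i) (h i), cross3 (w i) (h i)⟫ = 1 ∧ ⟪w i, cross3 (w i) (h i)⟫ = 0 ∧
      ⟪h i, cross3 (w i) (h i)⟫ = 0 := by
  have h1 : ⟪w i, cross3 (w i) (h i)⟫ = 0 := by
    rw [real_inner_comm, inner_cross3, det3_self_outer]
  have h2 : ⟪h i, cross3 (w i) (h i)⟫ = 0 := by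
    rw [real_inner_comm, inner_cross3, det3_self_right]
  refine ⟨?_, h1, h2⟩
  have e : ⟪cross3 (w i) (h i), cross3 (w i) (h i)⟫ =
      ⟪w i, w i⟫ * ⟪h i, h i⟫ - ⟪w i, h i⟫ ^ 2 := by
    simp only [inner_eq_sum, cross3, Matrix.cons_val_zero, Matrix.cons_val_one,
      Matrix.cons_val]; ring
  rw [e, H.poly.unit, H.h_unit, H.h_orth]; norm_num

end IsLuneSystem

end SphericalPolygon
end

/-! ### The side opposite to a vertex -/

noncomputable section

namespace SphericalPolygon

open InnerProductGeometry Filter Topology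
open scoped RealInnerProductSpace

/-- The side `w m, w (m + 1)` is opposite to the vertex `w i`: it lies on the great circle with
pole `g i` and contains the point `t i`. -/
structure IsOpposite (n : ℕ) (w g t : ℤ → E3) (i m : ℤ) : Prop where
  lt : i < m
  add_one_lt : m + 1 < i + n
  inner_left : ⟪g i, w m⟫ = 0
  inner_right : ⟪g i, w (m + 1)⟫ = 0
  inner_pos : ∀ l, i ≤ l → l < i + n → l ≠ m → l ≠ m + 1 → 0 < ⟪g i, w l⟫
  comb : ∃ p q : ℝ, 0 ≤ p ∧ 0 ≤ q ∧ t i = p • w m + q • w (m + 1)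

namespace IsLuneSystem

variable {n : ℕ} {w g h t : ℤ → E3} {C S : ℝ}

/-- The great circle through `t i` that bounds the lune contains two vertices. -/
lemma exists_two_zeros (H : IsLuneSystem n w C S g h t) (i : ℤ) :
    ∃ j l, i < j ∧ j < l ∧ l < i + n ∧ ⟪g i, w j⟫ = 0 ∧ ⟪g i, w l⟫ = 0 := by
  have hgi : ⟪g i, w i⟫ ≠ 0 := by rw [H.g_w]; exact H.S_pos.ne'
  by_contra hcon
  push Not at hcon
  have huniq : ∀ a b, ⟪g i, w a⟫ = 0 → ⟪g i, w b⟫ = 0 → w a = w b := by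
    intro a b ha hb
    obtain ⟨a', h1, h2, -, h3⟩ := H.poly.exists_window_eq i a
    obtain ⟨b', h4, h5, -, h6⟩ := H.poly.exists_window_eq i b
    rw [h3] at ha ⊢
    rw [h6] at hb ⊢
    have ha' : i < a' := lt_of_le_of_ne h1 fun h => hgi (h ▸ ha)
    have hb' : i < b' := lt_of_le_of_ne h4 fun h => hgi (h ▸ hb)
    rcases lt_trichotomy a' b' with h | h | h
    · exact absurd hb (hcon a' b' ha' h h5 ha)
    · rw [h]
    · exact absurd ha (hcon b' a' hb' h h2 hb)
  obtain ⟨z, l, hl, hsum⟩ := H.t_comb i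
  have hterm : ∀ j, l j * ⟪g i, w (z j)⟫ = 0 := by
    have h0 := H.g_t i
    rw [hsum, inner_sum] at h0
    simp only [real_inner_smul_right] at h0
    rw [Finset.sum_eq_zero_iff_of_nonneg fun j _ => mul_nonneg (hl j) (H.g_nonneg i _)] at h0
    exact fun j => h0 j (Finset.mem_univ j)
  obtain ⟨j₀, hj₀⟩ : ∃ j, l j ≠ 0 := by
    by_contra! h0
    have h1 := H.t_unit i
    rw [hsum] at h1
    simp [h0] at h1
  have hz₀ := (mul_eq_zero.1 (hterm j₀)).resolve_left hj₀
  have htw : t i = (∑ j, l j) • w (z j₀) := by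
    rw [hsum, Finset.sum_smul]
    refine Finset.sum_congr rfl fun j _ => ?_
    by_cases h0 : l j = 0
    · simp [h0]
    · rw [huniq _ _ ((mul_eq_zero.1 (hterm j)).resolve_left h0) hz₀]
  obtain ⟨hu1, huw, huh⟩ := H.axis i
  set u := cross3 (w i) (h i) with hu
  have hut : ⟪u, t i⟫ = 0 := by
    rw [H.t_eq, inner_comb_right, real_inner_comm, huw, real_inner_comm, huh]; ring
  have huz : ∀ a, ⟪g i, w a⟫ = 0 → ⟪u, w a⟫ = 0 := by
    intro a ha
    rw [huniq _ _ ha hz₀]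
    rw [htw, real_inner_smul_right] at hut
    refine (mul_eq_zero.1 hut).resolve_left fun h0 => ?_
    have := H.t_unit i
    rw [htw, h0] at this
    simp at this
  -- With a single vertex on the circle of `g i`, and `u` zero there, the `g` side permits tilting
  -- either way. Hence the circle of `h i` must obstruct both tilts, by vertices on both sides of `w
  -- i`.
  have e1 : ∃ a, ⟪h i, w a⟫ = 0 ∧ 0 < ⟪u, w a⟫ := by
    by_contra! h1
    exact H.not_tilt hu1 huw huh (fun a ha => (huz a ha).ge) h1
  have e2 : ∃ a, ⟪h i, w a⟫ = 0 ∧ ⟪u, w a⟫ < 0 := by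
    by_contra! h1
    refine H.not_tilt (u := -u) (by simpa using hu1) (by simpa using huw) (by simpa using huh)
      (fun a ha => by rw [inner_neg_left, huz a ha]; simp) fun a ha => ?_
    rw [inner_neg_left]; linarith [h1 a ha]
  obtain ⟨a, ha1, ha2⟩ := e1
  obtain ⟨b, hb1, hb2⟩ := e2
  obtain ⟨c, hc1, hc2⟩ := H.poly.exists_exposing i
  have hca : 0 < ⟪c, w a⟫ := hc2 a fun h0 => by
    rw [h0, real_inner_comm, huw] at ha2; exact lt_irrefl _ ha2
  have hcb : 0 < ⟪c, w b⟫ := hc2 b fun h0 => by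
    rw [h0, real_inner_comm, huw] at hb2; exact lt_irrefl _ hb2
  -- The weights cancel the `u`-component, leaving a positive combination of `w a` and `w b` on the
  -- line of `w i`. There `c` vanishes, although it is positive at `w a` and `w b`.
  have e := inner_eq_of_orthonormal (H.poly.unit i) (H.h_unit i) (H.h_orth i) c
    ((-⟪u, w b⟫) • w a + ⟪u, w a⟫ • w b)
  rw [← inner_cross3, ← inner_cross3, ← hu] at e
  simp only [inner_comb_right, ha1, hb1, real_inner_comm c (w i), hc1] at e
  nlinarith [mul_pos (neg_pos.2 hb2) hca, mul_pos ha2 hcb]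

/-- Vanishing at two vertices makes `g i` a positive multiple of their cross product. A vertex
strictly between them would get a negative value, so they are adjacent. All other vertices get
positive values and cannot contribute to `t i`, where `g i` vanishes. -/
lemma exists_isOpposite (H : IsLuneSystem n w C S g h t) (i : ℤ) :
    ∃ m, IsOpposite n w g t i m := by
  obtain ⟨j, l, hij, hjl, hl, hj0, hl0⟩ := H.exists_two_zeros i
  have hd : 0 < det3 (w j) (w l) (w i) := by
    rw [← H.poly.periodic i]
    exact H.poly.det_pos _ _ _ hjl hl (by omega)
  have key : ∀ x, det3 (w j) (w l) (w i) * ⟪g i, x⟫ = S * det3 (w j) (w l) x := by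
    intro x
    have := cramer_dual (w j) (w l) (w i) (g i)
    rw [hj0, hl0, H.g_w, zero_smul, zero_smul, zero_add, zero_add] at this
    have := congrArg (fun v => ⟪v, x⟫) this
    simpa only [real_inner_smul_left, inner_cross3] using this
  have hS := H.S_pos
  have hl1 : l = j + 1 := by
    by_contra hne
    have h1 := H.poly.det_pos j (j + 1) l (by omega) (by omega) (by omega)
    have h2 := key (w (j + 1))
    rw [det3_swap_right (w j) (w (j + 1))] at h2
    have h3 := H.g_nonneg i (j + 1)
    nlinarith [mul_nonneg hd.le h3, mul_pos hS h1]
  subst hl1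
  have hpos : ∀ a, i ≤ a → a < i + n → a ≠ j → a ≠ j + 1 → 0 < ⟪g i, w a⟫ := by
    intro a h1 h2 h3 h4
    have : 0 < det3 (w j) (w (j + 1)) (w a) := by
      rcases lt_or_gt_of_ne h3 with h5 | h5
      · rw [← H.poly.periodic a]
        exact H.poly.det_pos _ _ _ (by omega) (by omega) (by omega)
      · exact H.poly.det_pos _ _ _ (by omega) (by omega) (by omega)
    have h5 := key (w a)
    by_contra! h6
    nlinarith [mul_pos hS this]
  refine ⟨j, hij, hl, hj0, hl0, hpos, ?_⟩
  obtain ⟨z, c, hc, hsum⟩ := H.t_comb i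
  have hterm : ∀ k, c k * ⟪g i, w (z k)⟫ = 0 := by
    have h0 := H.g_t i
    rw [hsum, inner_sum] at h0
    simp only [real_inner_smul_right] at h0
    rw [Finset.sum_eq_zero_iff_of_nonneg fun j _ => mul_nonneg (hc j) (H.g_nonneg i _)] at h0
    exact fun j => h0 j (Finset.mem_univ j)
  have hk : ∀ k, ∃ p q : ℝ, 0 ≤ p ∧ 0 ≤ q ∧ c k • w (z k) = p • w j + q • w (j + 1) := by
    intro k
    obtain ⟨b, h1, h2, -, h3⟩ := H.poly.exists_window_eq i (z k)
    rw [h3]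
    by_cases h4 : b = j
    · exact ⟨c k, 0, hc k, le_rfl, by simp [h4]⟩
    by_cases h5 : b = j + 1
    · exact ⟨0, c k, le_rfl, hc k, by simp [h5]⟩
    have h6 := hterm k
    rw [h3] at h6
    have h7 := (mul_eq_zero.1 h6).resolve_right (hpos b h1 h2 h4 h5).ne'
    exact ⟨0, 0, le_rfl, le_rfl, by simp [h7]⟩
  choose p q hp hq hpq using hk
  refine ⟨∑ k, p k, ∑ k, q k, Finset.sum_nonneg fun k _ => hp k,
    Finset.sum_nonneg fun k _ => hq k, ?_⟩
  rw [hsum, Finset.sum_smul, Finset.sum_smul, ← Finset.sum_add_distrib]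
  exact Finset.sum_congr rfl fun k _ => hpq k

lemma isOpposite_unique {i m m' : ℤ} (h1 : IsOpposite n w g t i m)
    (h2 : IsOpposite n w g t i m') : m = m' := by
  have a1 := h1.lt
  have a2 := h1.add_one_lt
  have b1 := h2.lt
  have b2 := h2.add_one_lt
  have e1 : m = m' ∨ m = m' + 1 := by
    by_contra! hne
    exact (h2.inner_pos m (by omega) (by omega) hne.1 hne.2).ne' h1.inner_left
  have e2 : m + 1 = m' ∨ m + 1 = m' + 1 := by
    by_contra! hne
    exact (h2.inner_pos (m + 1) (by omega) (by omega) hne.1 hne.2).ne' h1.inner_right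
  omega

lemma isOpposite_add (H : IsLuneSystem n w C S g h t) {i m : ℤ} (h1 : IsOpposite n w g t i m) :
    IsOpposite n w g t (i + n) (m + n) := by
  refine ⟨by linarith [h1.lt], by linarith [h1.add_one_lt], ?_, ?_, fun l a1 a2 a3 a4 => ?_, ?_⟩
  · rw [H.g_periodic, H.poly.periodic, h1.inner_left]
  · rw [H.g_periodic, show m + n + 1 = m + 1 + n by ring, H.poly.periodic, h1.inner_right]
  · rw [H.g_periodic, ← sub_add_cancel l n, H.poly.periodic]
    exact h1.inner_pos _ (by omega) (by omega) (by omega) (by omega)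
  · rw [H.t_periodic, show m + n + 1 = m + 1 + n by ring, H.poly.periodic, H.poly.periodic]
    exact h1.comb

/-- A point of the lune at the same height as `w i` above the great circle with pole `g i`. -/
lemma eq_w_of_inner_g (H : IsLuneSystem n w C S g h t) {i : ℤ} {x : E3} (hx : ⟪x, x⟫ = 1)
    (h1 : ⟪g i, x⟫ = S) (h2 : 0 ≤ ⟪h i, x⟫) : x = w i := by
  symm
  apply eq_of_inner_eq_one (H.poly.unit i) hx
  rw [H.inner_g] at h1
  nlinarith [H.S_pos, H.C_pos, mul_nonneg H.C_pos.le h2]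

lemma eq_t_of_inner_h (H : IsLuneSystem n w C S g h t) {i : ℤ} {x : E3} (hx : ⟪x, x⟫ = 1)
    (h1 : ⟪h i, x⟫ = S) (h2 : 0 ≤ ⟪g i, x⟫) : x = t i := by
  symm
  apply eq_of_inner_eq_one (H.t_unit i) hx
  rw [H.inner_t, h1]
  rw [H.inner_g, h1] at h2
  have h3 : C ≤ ⟪w i, x⟫ := by nlinarith [H.S_pos]
  nlinarith [H.C_pos, H.sq_add_sq]

end IsLuneSystem

/-- A lune system together with the opposite sides of the vertices. -/
structure IsSideSystem (n : ℕ) (w : ℤ → E3) (C S : ℝ) (g h t : ℤ → E3) (m : ℤ → ℤ) : Prop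
    extends IsLuneSystem n w C S g h t where
  opp : ∀ i, IsOpposite n w g t i (m i)

namespace IsSideSystem

variable {n : ℕ} {w g h t : ℤ → E3} {C S : ℝ} {m : ℤ → ℤ}

lemma m_add (H : IsSideSystem n w C S g h t m) (i : ℤ) : m (i + n) = m i + n :=
  IsLuneSystem.isOpposite_unique (H.opp (i + n)) (H.isOpposite_add (H.opp i))

lemma m_add_mul (H : IsSideSystem n w C S g h t m) (i k : ℤ) : m (i + k * n) = m i + k * n := by
  induction k using Int.induction_on with
  | zero => simp
  | succ k ih =>
    rw [show i + ((k : ℤ) + 1) * n = i + k * n + n by ring, H.m_add, ih]; ring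
  | pred k ih =>
    have := H.m_add (i + (-(k : ℤ) - 1) * n)
    rw [show i + (-(k : ℤ) - 1) * n + n = i + -(k : ℤ) * n by ring, ih] at this
    linarith

/-- A normal of the side `w k, w (k + 1)` is unique. -/
lemma normal_unique (H : IsSideSystem n w C S g h t m) {k : ℤ} {y y' : E3} (hy : ⟪y, y⟫ = 1)
    (hy' : ⟪y', y'⟫ = 1) (h1 : ⟪y, w k⟫ = 0) (h2 : ⟪y, w (k + 1)⟫ = 0) (h1' : ⟪y', w k⟫ = 0)
    (h2' : ⟪y', w (k + 1)⟫ = 0) (h3 : ∀ l, 0 ≤ ⟪y, w l⟫) (h3' : ∀ l, 0 ≤ ⟪y', w l⟫) : y = y' :=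
  unit_normal_unique (H.poly.det_pos k (k + 1) (k + 2) (by omega) (by omega)
    (by have := H.poly.three_le; omega)) hy hy' h1 h2 h1' h2' (h3 _) (h3' _)

/-- A common opposite side means a common unit normal `g i = g j`. Then `w i` has height S above
that side, which in the lune of `w j` happens only at `w j`. -/
lemma m_injective (H : IsSideSystem n w C S g h t m) {i j : ℤ} (h0 : (n : ℤ) ∣ m i - m j) :
    (n : ℤ) ∣ i - j := by
  have e1 : w (m i) = w (m j) := H.poly.periodic_of_dvd h0
  have e2 : w (m i + 1) = w (m j + 1) := H.poly.periodic_of_dvd (by simpa using h0)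
  have hg : g i = g j := H.normal_unique (H.g_unit i) (H.g_unit j) (H.opp i).inner_left
    (H.opp i).inner_right (by rw [e1]; exact (H.opp j).inner_left)
    (by rw [e2]; exact (H.opp j).inner_right) (H.g_nonneg i) (H.g_nonneg j)
  have := H.eq_w_of_inner_g (H.poly.unit i) (i := j) (by rw [← hg, H.g_w]) (H.h_nonneg j i)
  exact H.poly.eq_iff.1 this

/-- Every side is opposite to a vertex. -/
lemma m_surjective (H : IsSideSystem n w C S g h t m) (k : ℤ) : ∃ i, (n : ℤ) ∣ m i - k := by
  have hn : (0 : ℤ) < n := by have := H.poly.three_le; omega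
  have hne : NeZero n := ⟨by omega⟩
  let f : Fin n → Fin n := fun i => ⟨(m (i : ℕ) % n).toNat, by
    have := Int.emod_nonneg (m (i : ℕ)) hn.ne'
    have := Int.emod_lt_of_pos (m (i : ℕ)) hn
    omega⟩
  have hinj : Function.Injective f := by
    intro i j hij
    have h1 : (m (i : ℕ) % n).toNat = (m (j : ℕ) % n).toNat := congrArg Fin.val hij
    have a1 := Int.emod_nonneg (m (i : ℕ)) hn.ne'
    have a2 := Int.emod_nonneg (m (j : ℕ)) hn.ne'
    have h2 : m (i : ℕ) % n = m (j : ℕ) % n := by omega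
    have h3 := H.m_injective
      (Int.ModEq.dvd (show m (j : ℕ) ≡ m (i : ℕ) [ZMOD n] from h2.symm))
    obtain ⟨q, hq⟩ := h3
    have b1 := i.2
    have b2 := j.2
    have : q = 0 := by
      by_contra hq0
      rcases lt_or_gt_of_ne hq0 with h | h
      · have : (n : ℤ) * q ≤ n * (-1) := mul_le_mul_of_nonneg_left (by omega) hn.le
        omega
      · have : (n : ℤ) * 1 ≤ n * q := mul_le_mul_of_nonneg_left (by omega) hn.le
        omega
    rw [this] at hq
    ext; omega
  have hsurj := Finite.surjective_of_injective hinj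
  obtain ⟨i, hi⟩ := hsurj ⟨(k % n).toNat, by
    have := Int.emod_nonneg k hn.ne'
    have := Int.emod_lt_of_pos k hn
    omega⟩
  have h1 : (m (i : ℕ) % n).toNat = (k % n).toNat := congrArg Fin.val hi
  have a1 := Int.emod_nonneg (m (i : ℕ)) hn.ne'
  have a2 := Int.emod_nonneg k hn.ne'
  have h2 : k % n = m (i : ℕ) % n := by omega
  exact ⟨(i : ℕ), Int.ModEq.dvd h2⟩

/-- If the lune of `w i` has a side `w k, w (k + 1)` of the polygon, with `w i` as an endpoint, on
its semicircle with center `w i`, then its other center is a vertex `w l`, for which that side is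
the opposite one. -/
lemma opposite_of_h (H : IsSideSystem n w C S g h t m) {i k l : ℤ} (h1 : ⟪h i, w k⟫ = 0)
    (h2 : ⟪h i, w (k + 1)⟫ = 0) (hl : t i = w l) : t l = w i ∧ (n : ℤ) ∣ m l - k := by
  -- The side is opposite to some vertex, whose normal must be `h i`; its height S identifies that
  -- vertex with `t i`.
  obtain ⟨j, hj⟩ := H.m_surjective k
  have e1 : w (m j) = w k := H.poly.periodic_of_dvd hj
  have e2 : w (m j + 1) = w (k + 1) := H.poly.periodic_of_dvd (by simpa using hj)
  have hg : g j = h i := H.normal_unique (H.g_unit j) (H.h_unit i)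
    (by rw [← e1]; exact (H.opp j).inner_left) (by rw [← e2]; exact (H.opp j).inner_right) h1 h2
    (H.g_nonneg j) (H.h_nonneg i)
  have e3 : w j = t i := H.eq_t_of_inner_h (H.poly.unit j) (by rw [← hg, H.g_w]) (H.g_nonneg i j)
  have e4 : (n : ℤ) ∣ l - j := H.poly.eq_iff.1 (hl.symm.trans e3.symm)
  obtain ⟨q, hq⟩ := e4
  have hlj : l = j + q * n := by linarith
  have hml : m l = m j + q * n := by rw [hlj, H.m_add_mul]
  have hdvd : (n : ℤ) ∣ m l - k := by
    rw [hml, show m j + q * n - k = m j - k + n * q by ring]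
    exact dvd_add hj (dvd_mul_right _ _)
  refine ⟨?_, hdvd⟩
  have e5 : w (m l) = w k := H.poly.periodic_of_dvd hdvd
  have e6 : w (m l + 1) = w (k + 1) := H.poly.periodic_of_dvd (by simpa using hdvd)
  have hg' : g l = h i := H.normal_unique (H.g_unit l) (H.h_unit i)
    (by rw [← e5]; exact (H.opp l).inner_left) (by rw [← e6]; exact (H.opp l).inner_right) h1 h2
    (H.g_nonneg l) (H.h_nonneg i)
  have e7 := H.w_eq l
  rw [hg', ← hl, H.t_eq i] at e7
  have : C • t l = C • w i := by
    have e8 : C • t l + S • h i = C • w i + S • h i := e7.symm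
    exact add_right_cancel e8
  exact smul_right_injective E3 H.C_pos.ne' this

end IsSideSystem

end SphericalPolygon
end

/-! ### Crossing chords and the parity of the number of vertices -/

noncomputable section

namespace SphericalPolygon

open InnerProductGeometry Filter Topology
open scoped RealInnerProductSpace

/-- When y₁ > 0, the slope comparison transfers C y₁ ≤ x₁ to the second coordinate, and the two
bounds are added with weights y₁, y₂. -/
lemma two_dim_bound {x₁ x₂ y₁ y₂ C : ℝ} (h1 : 0 ≤ y₁) (h2 : 0 ≤ y₂)
    (h : C * y₁ ≤ x₁) (hxy : x₁ * y₂ ≤ x₂ * y₁) (h0 : y₁ = 0 → y₂ = 0) :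
    C * (y₁ ^ 2 + y₂ ^ 2) ≤ x₁ * y₁ + x₂ * y₂ := by
  rcases h1.eq_or_lt with h3 | h3
  · rw [h0 h3.symm, ← h3]; simp
  · have h4 : C * y₂ ≤ x₂ := by
      refine le_of_mul_le_mul_right ?_ h3
      nlinarith [mul_le_mul_of_nonneg_right h h2]
    nlinarith [mul_le_mul_of_nonneg_right h h1, mul_le_mul_of_nonneg_right h4 h2]

/-- Algebraic form of: a spherical quadrilateral with two opposite sides of equal length and
no obtuse angle is degenerate. -/
lemma quadrilateral_degenerate {x₁ x₂ x₃ y₁ y₂ y₃ C S : ℝ} (hC : 0 < C) (hC1 : C < 1) (hS : 0 < S)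
    (hCS : S ^ 2 + C ^ 2 = 1) (hy : y₁ ^ 2 + y₂ ^ 2 + y₃ ^ 2 = 1)
    (hxy : x₁ * y₁ + x₂ * y₂ + x₃ * y₃ = C) (hx2 : 0 ≤ x₂) (hy2 : 0 ≤ y₂)
    (hxg : 0 ≤ S * x₁ - C * x₂) (hyg : 0 ≤ S * y₁ - C * y₂) (h1 : C * y₁ ≤ x₁)
    (h2 : C * (C * y₁ + S * y₂) ≤ C * x₁ + S * x₂) (h3 : 0 ≤ x₃ * y₃) (h4 : y₃ ^ 2 ≤ x₃ ^ 2) :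
    y₃ = 0 := by
  have hx1 : 0 ≤ x₁ := by nlinarith
  have hy1 : 0 ≤ y₁ := by nlinarith
  -- Depending on the orientation of the planar projections of x and y, the bound is applied in the
  -- given coordinates or in those along the other end of the chord, (C, S) and (S, −C).
  have key : C * (y₁ ^ 2 + y₂ ^ 2) ≤ x₁ * y₁ + x₂ * y₂ := by
    rcases le_total (x₁ * y₂) (x₂ * y₁) with h | h
    · refine two_dim_bound hy1 hy2 h1 h fun h0 => ?_
      rw [h0] at hyg
      nlinarith
    · have := two_dim_bound (x₂ := S * x₁ - C * x₂) (y₂ := S * y₁ - C * y₂)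
        (add_nonneg (mul_nonneg hC.le hy1) (mul_nonneg hS.le hy2)) hyg h2
        (by nlinarith [mul_le_mul_of_nonneg_left h (by positivity : 0 ≤ S ^ 2 + C ^ 2)])
        (fun h0 => by
          have e1 : C * y₁ = 0 := by nlinarith [mul_nonneg hC.le hy1, mul_nonneg hS.le hy2]
          have e2 : S * y₂ = 0 := by nlinarith [mul_nonneg hC.le hy1, mul_nonneg hS.le hy2]
          rw [(mul_eq_zero.1 e1).resolve_left hC.ne', (mul_eq_zero.1 e2).resolve_left hS.ne']
          simp)
      have e1 : (C * y₁ + S * y₂) ^ 2 + (S * y₁ - C * y₂) ^ 2 = y₁ ^ 2 + y₂ ^ 2 := by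
        linear_combination (y₁ ^ 2 + y₂ ^ 2) * hCS
      have e2 : (C * x₁ + S * x₂) * (C * y₁ + S * y₂) + (S * x₁ - C * x₂) * (S * y₁ - C * y₂) =
          x₁ * y₁ + x₂ * y₂ := by
        linear_combination (x₁ * y₁ + x₂ * y₂) * hCS
      rwa [e1, e2] at this
  -- Together, x₃y₃ = C − x₁y₁ − x₂y₂ ≤ C y₃², whereas equal signs and |y₃| ≤ |x₃| give x₃y₃ ≥ y₃².
  have h5 : y₃ ^ 2 ≤ x₃ * y₃ := by
    rw [← sq_abs y₃, ← abs_of_nonneg h3, abs_mul, pow_two]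
    exact mul_le_mul_of_nonneg_right (sq_le_sq.1 h4) (abs_nonneg _)
  have h6 : (1 - C) * y₃ ^ 2 ≤ 0 := by nlinarith
  have h7 : y₃ ^ 2 ≤ 0 := by
    by_contra! h
    nlinarith [mul_pos (by linarith : 0 < 1 - C) h]
  exact pow_eq_zero_iff two_ne_zero |>.1 (le_antisymm h7 (sq_nonneg _))

lemma eq_of_eq_smul {x y : E3} (hx : ⟪x, x⟫ = 1) (hy : ⟪y, y⟫ = 1) {r : ℝ} (hr : 0 ≤ r)
    (h : x = r • y) : x = y := by
  have : r ^ 2 = 1 := by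
    have h1 := hx
    rw [h, real_inner_smul_left, real_inner_smul_right, hy] at h1
    linarith
  have : r = 1 := by nlinarith
  rw [h, this, one_smul]

lemma not_dvd_of_lt {n : ℕ} {a : ℤ} (h1 : 0 < a) (h2 : a < n) : ¬ (n : ℤ) ∣ a := fun h => by
  have := Int.le_of_dvd h1 h
  omega

namespace IsSideSystem

variable {n : ℕ} {w g h t : ℤ → E3} {C S : ℝ} {m : ℤ → ℤ}

lemma t_nonneg (H : IsSideSystem n w C S g h t m) {y : E3} (hy : ∀ l, 0 ≤ ⟪y, w l⟫) (i : ℤ) :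
    0 ≤ ⟪y, t i⟫ := by
  obtain ⟨p, q, hp, hq, e⟩ := (H.opp i).comb
  rw [e, inner_comb_right]
  exact add_nonneg (mul_nonneg hp (hy _)) (mul_nonneg hq (hy _))

lemma inner_h_of_t (H : IsSideSystem n w C S g h t m) (j : ℤ) (z : E3) :
    S * ⟪h j, z⟫ = ⟪t j, z⟫ - C * ⟪w j, z⟫ := by
  rw [H.inner_t]; ring

lemma inner_g_of_t (H : IsSideSystem n w C S g h t m) (j : ℤ) (z : E3) :
    S * ⟪g j, z⟫ = ⟪w j, z⟫ - C * ⟪t j, z⟫ := by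
  rw [H.inner_t, H.inner_g]
  linear_combination ⟪w j, z⟫ * H.sq_add_sq

/-- The chords `w i, t i` and `w j, t j` cross. -/
lemma chords_cross (H : IsSideSystem n w C S g h t m) (i j : ℤ)
    (h0 : 0 ≤ det3 (w i) (h i) (w j) * det3 (w i) (h i) (t j)) :
    det3 (w i) (h i) (w j) = 0 ∨ det3 (w i) (h i) (t j) = 0 := by
  have par := inner_eq_of_orthonormal (H.poly.unit i) (H.h_unit i) (H.h_orth i)
  have nx := par (w j) (w j)
  have ny := par (t j) (t j)
  have nxy := par (w j) (t j)
  rw [H.poly.unit] at nx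
  rw [H.t_unit] at ny
  rw [real_inner_comm, H.t_w] at nxy
  have hS := H.S_pos
  have a1 := H.h_nonneg i j
  have a2 := H.t_nonneg (H.h_nonneg i) j
  have a3 := H.g_nonneg i j
  have a4 := H.t_nonneg (H.g_nonneg i) j
  rw [H.inner_g] at a3 a4
  -- Since S g j = w j − C t j and S h j = t j − C w j, nonnegativity of both normals at `w i` and
  -- at `t i` gives four comparisons.
  have b1 : C * ⟪w i, t j⟫ ≤ ⟪w i, w j⟫ := by
    have := mul_nonneg hS.le (H.g_nonneg j i)
    rw [H.inner_g_of_t, real_inner_comm, real_inner_comm (w i) (t j)] at this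
    linarith
  have b2 : C * ⟪w i, w j⟫ ≤ ⟪w i, t j⟫ := by
    have := mul_nonneg hS.le (H.h_nonneg j i)
    rw [H.inner_h_of_t, real_inner_comm, real_inner_comm (w i) (w j)] at this
    linarith
  have b3 : C * (C * ⟪w i, t j⟫ + S * ⟪h i, t j⟫) ≤ C * ⟪w i, w j⟫ + S * ⟪h i, w j⟫ := by
    have := mul_nonneg hS.le (H.t_nonneg (H.g_nonneg j) i)
    rw [H.inner_g_of_t, real_inner_comm, real_inner_comm (t i) (t j), H.inner_t, H.inner_t] at this
    linarith
  have b4 : C * (C * ⟪w i, w j⟫ + S * ⟪h i, w j⟫) ≤ C * ⟪w i, t j⟫ + S * ⟪h i, t j⟫ := by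
    have := mul_nonneg hS.le (H.t_nonneg (H.h_nonneg j) i)
    rw [H.inner_h_of_t, real_inner_comm, real_inner_comm (t i) (w j), H.inner_t, H.inner_t] at this
    linarith
  -- The end of the second chord farther from the plane of the first plays x; the nearer one is then
  -- forced into that plane.
  rcases le_total (det3 (w i) (h i) (t j) ^ 2) (det3 (w i) (h i) (w j) ^ 2) with h1 | h1
  · right
    exact quadrilateral_degenerate H.C_pos H.C_lt_one hS H.sq_add_sq (by linarith) nxy.symm
      a1 a2 a3 a4 b1 b3 h0 h1
  · left
    exact quadrilateral_degenerate H.C_pos H.C_lt_one hS H.sq_add_sq (by linarith)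
      (by linarith) a2 a1 a4 a3 b2 b4 (by linarith) h1

lemma det3_h (H : IsSideSystem n w C S g h t m) (i : ℤ) (x : E3) :
    S * det3 (w i) (h i) x = det3 (w i) (t i) x := by
  rw [H.t_eq, det3_comb_mid, det3_self_left]; ring

/-- The chord from `w i` ends on its opposite side, so it separates the vertices. The only way to
touch the chord is for `t i` to be a vertex. -/
lemma det3_t_left (H : IsSideSystem n w C S g h t m) {i l : ℤ} (h1 : i < l) (h2 : l ≤ m i) :
    det3 (w i) (t i) (w l) < 0 ∨ (det3 (w i) (t i) (w l) = 0 ∧ l = m i ∧ t i = w (m i)) := by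
  obtain ⟨p, q, hp, hq, e⟩ := (H.opp i).comb
  have h4 := (H.opp i).add_one_lt
  have e' : det3 (w i) (t i) (w l) = p * det3 (w i) (w (m i)) (w l) +
    q * det3 (w i) (w (m i + 1)) (w l) := by rw [e, det3_comb_mid]
  have d2 := H.poly.det_pos i l (m i + 1) h1 (by omega) h4
  rw [e', det3_swap_right _ (w l) (w (m i + 1)), det3_swap_right _ (w l) (w (m i))]
  rcases h2.eq_or_lt with rfl | h3
  · rw [det3_self_right]
    rcases hq.eq_or_lt with h5 | h5
    · right
      refine ⟨by rw [← h5]; ring, rfl, ?_⟩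
      rw [← h5, zero_smul, add_zero] at e
      exact eq_of_eq_smul (H.t_unit i) (H.poly.unit _) hp e
    · left; nlinarith [mul_pos h5 d2]
  · left
    have d1 := H.poly.det_pos i l (m i) h1 h3 (by omega)
    rcases hp.eq_or_lt with h5 | h5
    · rcases hq.eq_or_lt with h6 | h6
      · exfalso
        have := H.t_unit i
        rw [e, ← h5, ← h6] at this
        simp at this
      · nlinarith [mul_pos h6 d2]
    · nlinarith [mul_pos h5 d1, mul_nonneg hq d2.le]

lemma det3_t_right (H : IsSideSystem n w C S g h t m) {i l : ℤ} (h1 : m i + 1 ≤ l)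
    (h2 : l < i + n) :
    0 < det3 (w i) (t i) (w l) ∨ (det3 (w i) (t i) (w l) = 0 ∧ l = m i + 1 ∧ t i = w (m i + 1)) := by
  obtain ⟨p, q, hp, hq, e⟩ := (H.opp i).comb
  have h4 := (H.opp i).lt
  have e' : det3 (w i) (t i) (w l) = p * det3 (w i) (w (m i)) (w l) +
    q * det3 (w i) (w (m i + 1)) (w l) := by rw [e, det3_comb_mid]
  have d2 := H.poly.det_pos i (m i) l h4 (by omega) h2
  rw [e']
  rcases h1.eq_or_lt with rfl | h3
  · rw [det3_self_right]
    rcases hp.eq_or_lt with h5 | h5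
    · right
      refine ⟨by rw [← h5]; ring, rfl, ?_⟩
      rw [← h5, zero_smul, zero_add] at e
      exact eq_of_eq_smul (H.t_unit i) (H.poly.unit _) hq e
    · left; nlinarith [mul_pos h5 d2]
  · left
    have d1 := H.poly.det_pos i (m i + 1) l (by omega) h3 h2
    rcases hp.eq_or_lt with h5 | h5
    · rcases hq.eq_or_lt with h6 | h6
      · exfalso
        have := H.t_unit i
        rw [e, ← h5, ← h6] at this
        simp at this
      · nlinarith [mul_pos h6 d1]
    · nlinarith [mul_pos h5 d2, mul_nonneg hq d1.le]

/-- On the circle of `g i` nothing now obstructs one of the tilts, so the circle of `h i` must: it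
contains a vertex besides `w i`, which has to be `w (i - 1)`. That side is then opposite to `t i`,
and the lune reads the same from both ends. -/
lemma foot_eq_left (H : IsSideSystem n w C S g h t m) {i : ℤ} (h0 : t i = w (m i)) :
    t (m i) = w i ∧ (n : ℤ) ∣ m (m i) - (i - 1) := by
  have hS := H.S_pos
  have hm1 := (H.opp i).lt
  have hm2 := (H.opp i).add_one_lt
  obtain ⟨hu1, huw, huh⟩ := H.axis i
  have hu : ∀ l, S * ⟪cross3 (w i) (h i), w l⟫ = det3 (w i) (w (m i)) (w l) := by
    intro l; rw [inner_cross3, H.det3_h, h0]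
  obtain ⟨a, ha1, ha2⟩ : ∃ a, ⟪h i, w a⟫ = 0 ∧ 0 < ⟪cross3 (w i) (h i), w a⟫ := by
    by_contra! h1
    refine H.not_tilt hu1 huw huh (fun a ha => ?_) h1
    obtain ⟨b, b1, b2, -, b4⟩ := H.poly.exists_window_eq i a
    have h3 := hu b
    rw [b4] at ha ⊢
    by_cases hb : b = m i
    · rw [hb, det3_self_right] at h3
      rw [hb]; nlinarith
    by_cases hb' : b = m i + 1
    · rw [hb'] at h3 ⊢
      have := H.poly.det_pos i (m i) (m i + 1) hm1 (by omega) hm2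
      by_contra! hneg
      nlinarith
    · exact absurd ha ((H.opp i).inner_pos b b1 b2 hb hb').ne'
  obtain ⟨b, b1, b2, -, b4⟩ := H.poly.exists_window_eq i a
  rw [b4] at ha1 ha2
  have hb3 := hu b
  have hpos := mul_pos hS ha2
  rw [hb3] at hpos
  have hbm : m i < b := by
    by_contra! hle
    rcases b1.eq_or_lt with rfl | h5
    · rw [det3_self_outer] at hpos; exact lt_irrefl _ hpos
    · rcases hle.eq_or_lt with h6 | h6
      · rw [h6, det3_self_right] at hpos; exact lt_irrefl _ hpos
      · have := H.poly.det_pos i b (m i) h5 h6 (by omega)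
        rw [det3_swap_right] at this; linarith
  have hd := H.poly.det_pos i (m i) b hm1 hbm b2
  have hbn : b = i - 1 + n := by
    by_contra hne
    have h5 := cramer_dual (w b) (w i) (w (m i)) (h i)
    rw [ha1, H.h_orth', ← h0, H.h_t, zero_smul, zero_smul, zero_add, zero_add] at h5
    have h6 := congrArg (fun v => ⟪v, w (i - 1)⟫) h5
    simp only [real_inner_smul_left, inner_cross3] at h6
    rw [h0, ← det3_rotate (w b), ← det3_rotate (w b) (w i) (w (i - 1))] at h6
    have h7 := H.poly.det_pos (i - 1) i b (by omega) (by omega) (by omega)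
    have h8 := H.poly.det_pos i b (i - 1 + n) (by omega) (by omega) (by omega)
    rw [H.poly.periodic, det3_rotate (w (i - 1)), ] at h8
    have h9 := H.h_nonneg i (i - 1)
    have h10 : det3 (w i) (w (i - 1)) (w b) = -det3 (w (i - 1)) (w i) (w b) :=
      det3_swap_left _ _ _
    nlinarith [mul_pos hS h7, mul_nonneg hd.le h9]
  have hz : ⟪h i, w (i - 1)⟫ = 0 := by rw [hbn, H.poly.periodic] at ha1; exact ha1
  exact H.opposite_of_h hz (by rw [sub_add_cancel]; exact H.h_orth' i) h0

lemma foot_eq_right (H : IsSideSystem n w C S g h t m) {i : ℤ} (h0 : t i = w (m i + 1)) :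
    t (m i + 1) = w i ∧ (n : ℤ) ∣ m (m i + 1) - i := by
  have hS := H.S_pos
  have hm1 := (H.opp i).lt
  have hm2 := (H.opp i).add_one_lt
  obtain ⟨hu1, huw, huh⟩ := H.axis i
  have hu : ∀ l, S * ⟪cross3 (w i) (h i), w l⟫ = det3 (w i) (w (m i + 1)) (w l) := by
    intro l; rw [inner_cross3, H.det3_h, h0]
  obtain ⟨a, ha1, ha2⟩ : ∃ a, ⟪h i, w a⟫ = 0 ∧ ⟪cross3 (w i) (h i), w a⟫ < 0 := by
    by_contra! h1
    refine H.not_tilt (u := -cross3 (w i) (h i)) (by simpa using hu1) (by simpa using huw)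
      (by simpa using huh) (fun a ha => ?_) (fun a ha => by
        rw [inner_neg_left]; linarith [h1 a ha])
    obtain ⟨b, b1, b2, -, b4⟩ := H.poly.exists_window_eq i a
    have h3 := hu b
    rw [b4] at ha ⊢
    rw [inner_neg_left]
    by_cases hb : b = m i
    · rw [hb] at h3 ⊢
      have := H.poly.det_pos i (m i) (m i + 1) hm1 (by omega) hm2
      rw [det3_swap_right] at this
      by_contra! hneg
      nlinarith
    by_cases hb' : b = m i + 1
    · rw [hb', det3_self_right] at h3
      rw [hb']; nlinarith
    · exact absurd ha ((H.opp i).inner_pos b b1 b2 hb hb').ne'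
  obtain ⟨b, b1, b2, -, b4⟩ := H.poly.exists_window_eq i a
  rw [b4] at ha1 ha2
  have hb3 := hu b
  have hneg := mul_neg_of_pos_of_neg hS ha2
  rw [hb3] at hneg
  have hib : i < b := by
    refine lt_of_le_of_ne b1 fun h => ?_
    rw [← h, det3_self_outer] at hneg; exact lt_irrefl _ hneg
  have hbm : b < m i + 1 := by
    by_contra! hle
    rcases hle.eq_or_lt with h6 | h6
    · rw [← h6, det3_self_right] at hneg; exact lt_irrefl _ hneg
    · have := H.poly.det_pos i (m i + 1) b (by omega) h6 b2
      linarith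
  have hd := H.poly.det_pos i b (m i + 1) hib hbm hm2
  have hbn : b = i + 1 := by
    by_contra hne
    have h5 := cramer_dual (w i) (w b) (w (m i + 1)) (h i)
    rw [ha1, H.h_orth', ← h0, H.h_t, zero_smul, zero_smul, zero_add, zero_add] at h5
    have h6 := congrArg (fun v => ⟪v, w (i + 1)⟫) h5
    simp only [real_inner_smul_left, inner_cross3] at h6
    rw [h0, det3_swap_right (w i) (w (i + 1)) (w b)] at h6
    have h7 := H.poly.det_pos i (i + 1) b (by omega) (by omega) (by omega)
    have h9 := H.h_nonneg i (i + 1)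
    nlinarith [mul_pos hS h7, mul_nonneg hd.le h9]
  exact H.opposite_of_h (H.h_orth' i) (by rw [← hbn]; exact ha1) h0

lemma t_periodic_of_dvd (H : IsSideSystem n w C S g h t m) {i j : ℤ} (h1 : (n : ℤ) ∣ i - j) :
    t i = t j := by
  obtain ⟨k, hk⟩ := h1
  have hp : Function.Periodic t n := H.t_periodic
  have := hp.int_mul k j
  rw [← this]; congr 1; simp only [Int.cast_id]; linarith

lemma eq_of_inner_g_eq_zero (H : IsSideSystem n w C S g h t m) {i l : ℤ} (h1 : ⟪g i, w l⟫ = 0) :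
    (n : ℤ) ∣ l - m i ∨ (n : ℤ) ∣ l - (m i + 1) := by
  obtain ⟨b, b1, b2, b3, b4⟩ := H.poly.exists_window_eq i l
  rw [b4] at h1
  have b3' : (n : ℤ) ∣ l - b := by rw [← neg_sub]; exact b3.neg_right
  by_cases hb : b = m i
  · left; rwa [hb] at b3'
  by_cases hb' : b = m i + 1
  · right; rwa [hb'] at b3'
  · exact absurd h1 ((H.opp i).inner_pos b b1 b2 hb hb').ne'

lemma foot_symm (H : IsSideSystem n w C S g h t m) {i l : ℤ} (h0 : t i = w l) : t l = w i := by
  have h1 : ⟪g i, w l⟫ = 0 := by rw [← h0, H.g_t]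
  rcases H.eq_of_inner_g_eq_zero h1 with h2 | h2
  · rw [H.t_periodic_of_dvd h2]
    exact (H.foot_eq_left (h0.trans (H.poly.periodic_of_dvd h2))).1
  · rw [H.t_periodic_of_dvd h2]
    exact (H.foot_eq_right (h0.trans (H.poly.periodic_of_dvd h2))).1

lemma t_comb_of_dvd (H : IsSideSystem n w C S g h t m) {j k : ℤ} (h1 : (n : ℤ) ∣ m j - k) :
    ∃ p q : ℝ, 0 ≤ p ∧ 0 ≤ q ∧ t j = p • w k + q • w (k + 1) := by
  obtain ⟨p, q, hp, hq, e⟩ := (H.opp j).comb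
  rw [H.poly.periodic_of_dvd h1, H.poly.periodic_of_dvd (i := m j + 1) (j := k + 1)
    (by simpa using h1)] at e
  exact ⟨p, q, hp, hq, e⟩

/-- Here both ends of the chord from `w j` lie on the same closed side of the chord from `w i`, so
`chords_cross` puts an end onto it. The foot of a chord is then a vertex, and the description of
opposite sides in that case is contradicted. -/
lemma crossing_left (H : IsSideSystem n w C S g h t m) {i j k : ℤ} (h1 : i < j) (h2 : j ≤ m i)
    (h3 : i ≤ k) (h4 : k < m i) (h5 : (n : ℤ) ∣ m j - k) : False := by
  have hS := H.S_pos
  have hm2 := (H.opp i).add_one_lt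
  obtain ⟨p, q, hp, hq, e⟩ := H.t_comb_of_dvd h5
  -- if `t i` is the vertex `w j` then its opposite side contains `w i`
  have base : j = m i → t i = w (m i) → False := by
    intro a1 a2
    have a3 := (H.foot_eq_left a2).2
    rw [a1] at h5
    have a4 := dvd_sub a3 h5
    rw [show m (m i) - (i - 1) - (m (m i) - k) = k - i + 1 by ring] at a4
    exact not_dvd_of_lt (by omega) (by omega) a4
  have dj := H.det3_t_left h1 h2
  have dk : det3 (w i) (t i) (w k) ≤ 0 ∧ (det3 (w i) (t i) (w k) = 0 → k = i) := by
    rcases h3.eq_or_lt with rfl | h6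
    · rw [det3_self_outer]; simp
    · rcases H.det3_t_left h6 h4.le with h7 | ⟨-, h7, -⟩
      · exact ⟨h7.le, fun h => absurd h h7.ne⟩
      · omega
  have dk1 := H.det3_t_left (i := i) (l := k + 1) (by omega) (by omega)
  have dk1' : det3 (w i) (t i) (w (k + 1)) ≤ 0 := dk1.elim (fun h => h.le) (fun h => h.1.le)
  have dj' : det3 (w i) (t i) (w j) ≤ 0 := dj.elim (fun h => h.le) (fun h => h.1.le)
  have et : det3 (w i) (t i) (t j) = p * det3 (w i) (t i) (w k) +
      q * det3 (w i) (t i) (w (k + 1)) := by rw [e, det3_comb_right]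
  have hpk := mul_nonneg hp (neg_nonneg.2 dk.1)
  have hqk := mul_nonneg hq (neg_nonneg.2 dk1')
  have hcr := H.chords_cross i j (by
    have a1 : det3 (w i) (h i) (w j) ≤ 0 := by
      rw [← H.det3_h] at dj'; by_contra! hpos; nlinarith [mul_pos hS hpos]
    have a2 : det3 (w i) (h i) (t j) ≤ 0 := by
      have : S * det3 (w i) (h i) (t j) ≤ 0 := by rw [H.det3_h, et]; linarith
      by_contra! hpos; nlinarith [mul_pos hS hpos]
    exact mul_nonneg_of_nonpos_of_nonpos a1 a2)
  rcases hcr with h6 | h6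
  · have h7 : det3 (w i) (t i) (w j) = 0 := by rw [← H.det3_h, h6, mul_zero]
    rcases dj with h8 | ⟨-, h8, h9⟩
    · exact h8.ne h7
    · exact base h8 h9
  · have h7 : det3 (w i) (t i) (t j) = 0 := by rw [← H.det3_h, h6, mul_zero]
    rw [et] at h7
    have hp0 : p * det3 (w i) (t i) (w k) = 0 := by linarith
    have hq0 : q * det3 (w i) (t i) (w (k + 1)) = 0 := by linarith
    by_cases hq' : q = 0
    · have hp' : p ≠ 0 := fun hp' => by
        have := H.t_unit j
        rw [e, hp', hq'] at this
        simp at this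
      have hk := dk.2 ((mul_eq_zero.1 hp0).resolve_left hp')
      rw [hq', zero_smul, add_zero, hk] at e
      have ht := H.foot_symm (eq_of_eq_smul (H.t_unit j) (H.poly.unit i) hp e)
      have h8 : ⟪g i, w j⟫ = 0 := by rw [← ht, H.g_t]
      have h9 : j = m i := by
        by_contra hne
        exact ((H.opp i).inner_pos j h1.le (by omega) hne (by omega)).ne' h8
      exact base h9 (by rw [← h9]; exact ht)
    · rcases dk1 with h8 | ⟨-, h8, h9⟩
      · exact h8.ne ((mul_eq_zero.1 hq0).resolve_left hq')
      · by_cases hp' : p = 0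
        · rw [hp', zero_smul, zero_add, h8] at e
          have a1 := H.foot_symm (eq_of_eq_smul (H.t_unit j) (H.poly.unit _) hq e)
          have a2 := H.foot_symm h9
          exact H.poly.ne_of_lt h1 (by omega) (a2.symm.trans a1)
        · have hk := dk.2 ((mul_eq_zero.1 hp0).resolve_left hp')
          exact base (by omega) h9

lemma crossing_right (H : IsSideSystem n w C S g h t m) {i j k : ℤ} (h1 : m i + 1 ≤ j)
    (h2 : j < i + n) (h3 : m i + 1 ≤ k) (h4 : k < i + n) (h5 : (n : ℤ) ∣ m j - k) : False := by
  have hS := H.S_pos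
  have hm1 := (H.opp i).lt
  obtain ⟨p, q, hp, hq, e⟩ := H.t_comb_of_dvd h5
  have base : j = m i + 1 → t i = w (m i + 1) → False := by
    intro a1 a2
    have a3 := (H.foot_eq_right a2).2
    rw [a1] at h5
    have a4 := dvd_sub a3 h5
    rw [show m (m i + 1) - i - (m (m i + 1) - k) = k - i by ring] at a4
    exact not_dvd_of_lt (by omega) (by omega) a4
  have dj := H.det3_t_right h1 h2
  have dk := H.det3_t_right h3 h4
  have dk1 : 0 ≤ det3 (w i) (t i) (w (k + 1)) ∧
      (det3 (w i) (t i) (w (k + 1)) = 0 → k + 1 = i + n) := by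
    by_cases h6 : k + 1 = i + n
    · rw [h6, H.poly.periodic, det3_self_outer]; simp
    · rcases H.det3_t_right (i := i) (l := k + 1) (by omega) (by omega) with h7 | ⟨-, h7, -⟩
      · exact ⟨h7.le, fun h => absurd h h7.ne'⟩
      · omega
  have dk' : 0 ≤ det3 (w i) (t i) (w k) := dk.elim (fun h => h.le) (fun h => h.1.ge)
  have dj' : 0 ≤ det3 (w i) (t i) (w j) := dj.elim (fun h => h.le) (fun h => h.1.ge)
  have et : det3 (w i) (t i) (t j) = p * det3 (w i) (t i) (w k) +
      q * det3 (w i) (t i) (w (k + 1)) := by rw [e, det3_comb_right]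
  have hpk := mul_nonneg hp dk'
  have hqk := mul_nonneg hq dk1.1
  have hcr := H.chords_cross i j (by
    have a1 : 0 ≤ det3 (w i) (h i) (w j) := by
      rw [← H.det3_h] at dj'; exact nonneg_of_mul_nonneg_right dj' hS
    have a2 : 0 ≤ det3 (w i) (h i) (t j) := by
      have : 0 ≤ S * det3 (w i) (h i) (t j) := by rw [H.det3_h, et]; linarith
      exact nonneg_of_mul_nonneg_right this hS
    exact mul_nonneg a1 a2)
  rcases hcr with h6 | h6
  · have h7 : det3 (w i) (t i) (w j) = 0 := by rw [← H.det3_h, h6, mul_zero]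
    rcases dj with h8 | ⟨-, h8, h9⟩
    · exact h8.ne' h7
    · exact base h8 h9
  · have h7 : det3 (w i) (t i) (t j) = 0 := by rw [← H.det3_h, h6, mul_zero]
    rw [et] at h7
    have hp0 : p * det3 (w i) (t i) (w k) = 0 := by linarith
    have hq0 : q * det3 (w i) (t i) (w (k + 1)) = 0 := by linarith
    by_cases hp' : p = 0
    · have hq' : q ≠ 0 := fun hq' => by
        have := H.t_unit j
        rw [e, hp', hq'] at this
        simp at this
      have hk := dk1.2 ((mul_eq_zero.1 hq0).resolve_left hq')
      rw [hp', zero_smul, zero_add, hk, H.poly.periodic] at e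
      have ht := H.foot_symm (eq_of_eq_smul (H.t_unit j) (H.poly.unit i) hq e)
      have h8 : ⟪g i, w j⟫ = 0 := by rw [← ht, H.g_t]
      have h9 : j = m i + 1 := by
        by_contra hne
        exact ((H.opp i).inner_pos j (by omega) h2 (by omega) hne).ne' h8
      exact base h9 (by rw [← h9]; exact ht)
    · rcases dk with h8 | ⟨-, h8, h9⟩
      · exact h8.ne' ((mul_eq_zero.1 hp0).resolve_left hp')
      · by_cases hq' : q = 0
        · rw [hq', zero_smul, add_zero, h8] at e
          have a1 := H.foot_symm (eq_of_eq_smul (H.t_unit j) (H.poly.unit _) hp e)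
          have a2 := H.foot_symm h9
          exact H.poly.ne_of_lt (by omega) h2 (a2.symm.trans a1)
        · have hk := dk1.2 ((mul_eq_zero.1 hq0).resolve_left hq')
          exact base (by omega) h9

/-- The number of vertices is odd, and the side opposite to a vertex is the one that halves the
vertices. -/
lemma exists_half (H : IsSideSystem n w C S g h t m) :
    ∃ k : ℕ, 1 ≤ k ∧ n = 2 * k + 1 ∧ ∀ i, m i = i + k := by
  have hn := H.poly.three_le
  -- Crossing forbids `m` to decrease and injectivity forbids it to stay, so `m i - i` is monotone;
  -- being periodic, it is constant.
  have step : ∀ i, m i - i ≤ m (i + 1) - (i + 1) := by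
    intro i
    have a1 := (H.opp i).lt
    have b1 := (H.opp (i + 1)).lt
    have b2 := (H.opp (i + 1)).add_one_lt
    have c1 : m i ≤ m (i + 1) := by
      by_contra! hlt
      exact H.crossing_left (i := i) (j := i + 1) (k := m (i + 1)) (by omega) (by omega)
        (by omega) hlt (by simp)
    have c2 : m i ≠ m (i + 1) := fun heq => by
      have := H.m_injective (i := i + 1) (j := i) (by simp [heq])
      exact not_dvd_of_lt (by omega) (by omega) this
    omega
  have hmono : Monotone fun i => m i - i := monotone_int_of_le_succ step
  have hconst : ∀ i, m i - i = m 0 := by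
    intro i
    obtain ⟨b, b1, b2, ⟨q, hq⟩⟩ := H.poly.exists_window 0 i
    have e1 : m b = m i + q * n := by rw [← H.m_add_mul]; congr 1; linarith
    have e2 : m 0 - 0 ≤ m b - b := hmono b1
    have e3 : m b - b ≤ m (0 + n) - (0 + n) := hmono b2.le
    rw [H.m_add] at e3
    have : m i - i = m b - b := by rw [e1]; linarith
    omega
  have a1 := (H.opp 0).lt
  have a2 := (H.opp 0).add_one_lt
  obtain ⟨k, hk⟩ := Int.eq_ofNat_of_zero_le a1.le
  have hm : ∀ i, m i = i + k := fun i => by have := hconst i; omega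
  -- Test the chords from 0 and k: if n ≤ 2k, the second would end on the side 2k − n, left of the
  -- first. For the next bound the chords from 0 and k + 1 are tested in the same way.
  have u1 : 2 * (k : ℤ) < n := by
    by_contra! hle
    exact H.crossing_left (i := 0) (j := k) (k := 2 * k - n) (by omega) (by omega) (by omega)
      (by omega) (by rw [hm]; exact ⟨1, by ring⟩)
  have u2 : (n : ℤ) ≤ 2 * k + 1 := by
    by_contra! hlt
    exact H.crossing_right (i := 0) (j := k + 1) (k := 2 * k + 1) (by omega) (by omega) (by omega)
      (by omega) (by rw [hm]; exact ⟨0, by ring⟩)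
  exact ⟨k, by omega, by omega, hm⟩

end IsSideSystem

end SphericalPolygon
end

/-! ### Perimeter halving and the trigonometric bound -/

noncomputable section

namespace SphericalPolygon

open InnerProductGeometry Filter Topology
open scoped RealInnerProductSpace

/-- A convex spherical polygonal line inside a triangle is at most as long as the two sides of the
triangle around it. -/
lemma sum_angle_le_of_convex (N : ℕ) (x : ℕ → E3) (p : E3)
    (hdet : ∀ i j l, i < j → j < l → l ≤ N + 1 → 0 < det3 (x i) (x j) (x l))
    (hne : ∀ i, x i ≠ 0) {a b : ℝ} (ha : 0 ≤ a) (hb : 0 ≤ b) (h1 : x 1 = a • x 0 + b • p)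
    (hp : ∀ l, l ≤ N + 1 → 0 ≤ det3 (x l) p (x (N + 1))) :
    ∑ l ∈ Finset.range (N + 1), angle (x l) (x (l + 1)) ≤
      angle (x 0) p + angle p (x (N + 1)) := by
  induction N generalizing x p a b with
  | zero => simpa using angle_le_angle_add_angle (x 0) p (x 1)
  | succ N ih =>
    rw [Finset.sum_range_succ']
    have d012 := hdet 0 1 2 (by omega) (by omega) (by omega)
    have hb0 : 0 < b := by
      refine lt_of_le_of_ne hb fun h0 => ?_
      rw [h1, ← h0, det3_comb_mid, det3_self_left] at d012
      simp at d012
    have e01 : angle (x 0) p = angle (x 0) (x 1) + angle (x 1) p :=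
      angle_add_of_comb (hne 1) ha hb h1
    -- If `a = 0`, then `x 1` points towards `p`, and convexity leaves room for only one further
    -- side.
    rcases ha.eq_or_lt with h0 | ha0
    · rw [← h0, zero_smul, zero_add] at h1
      have e2 : angle (x 1) (x (N + 1 + 1)) = angle p (x (N + 1 + 1)) := by
        rw [h1, angle_smul_left_of_pos _ _ hb0]
      have e3 : angle (x 0) (x 1) = angle (x 0) p := by
        rw [h1, angle_smul_right_of_pos _ _ hb0]
      rcases Nat.eq_zero_or_pos N with rfl | hN
      · simp only [zero_add, Finset.sum_range_one] at e2 ⊢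
        linarith
      · exfalso
        have d := hdet 1 2 (N + 1 + 1) (by omega) (by omega) le_rfl
        have d' := hp 2 (by omega)
        have e4 : det3 (x 1) (x 2) (x (N + 1 + 1)) = -(b * det3 (x 2) p (x (N + 1 + 1))) := by
          rw [h1]; simp only [det3, PiLp.smul_apply, smul_eq_mul]; ring
        nlinarith [mul_nonneg hb0.le d']
    · set z := x (N + 1 + 1) with hz
      have d01z := hdet 0 1 (N + 1 + 1) (by omega) (by omega) le_rfl
      have hD : 0 < det3 (x 1) p z := by
        refine lt_of_le_of_ne (hp 1 (by omega)) fun h0 => ?_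
        rw [← hz, h1, det3_comb_mid, det3_self_left] at d01z
        rw [h1, det3_comb_left, det3_self_left] at h0
        have : det3 (x 0) p z = 0 := by
          rcases mul_eq_zero.1 (show a * det3 (x 0) p z = 0 by linarith) with h | h
          · exact absurd h ha0.ne'
          · exact h
        rw [this] at d01z
        simp at d01z
      have hg : 0 < det3 (x 1) p (x 2) := by
        have e4 : b * det3 (x 1) p (x 2) = a * det3 (x 0) (x 1) (x 2) := by
          rw [h1]; simp only [det3, PiLp.smul_apply, PiLp.add_apply, smul_eq_mul]; ring
        have := mul_pos ha0 d012
        rw [← e4] at this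
        exact pos_of_mul_pos_right this hb
      have hB : 0 ≤ det3 (x 1) (x 2) z := by
        rcases Nat.eq_zero_or_pos N with rfl | hN
        · rw [hz, det3_self_right]
        · exact (hdet 1 2 (N + 1 + 1) (by omega) (by omega) le_rfl).le
      have hA : 0 ≤ det3 (x 2) p z := hp 2 (by omega)
      have hc := cramer (x 1) p z (x 2)
      set D := det3 (x 1) p z
      -- The side from `x 1` to `x 2`, prolonged, meets the arc from `p` to `z` in the direction of
      -- `p'`, which becomes the apex for the shorter chain. Cutting the corner at `p` does not
      -- lengthen the path.
      set p' := (det3 (x 1) (x 2) z / D) • p + (det3 (x 1) p (x 2) / D) • z with hp'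
      have h2 : x 2 = (det3 (x 2) p z / D) • x 1 + (1 : ℝ) • p' := by
        apply smul_right_injective E3 hD.ne'
        simp only [hp', smul_add, smul_smul, one_mul, mul_div_cancel₀ _ hD.ne']
        rw [hc, add_assoc]
      have hp'0 : p' ≠ 0 := by
        intro h0
        rw [h2, h0, det3_comb_right, det3_self_right] at d012
        simp [det3] at d012
      have key := ih (fun l => x (l + 1)) p' (fun i j l h3 h4 h5 => hdet _ _ _ (by omega) (by omega)
        (by omega)) (fun i => hne _) (div_nonneg hA hD.le) zero_le_one h2 (fun l hl => by
          change 0 ≤ det3 (x (l + 1)) p' z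
          rw [hp', det3_comb_mid, det3_self_right]
          have := hp (l + 1) (by omega)
          have : 0 ≤ det3 (x 1) (x 2) z / D * det3 (x (l + 1)) p z :=
            mul_nonneg (div_nonneg hB hD.le) this
          linarith)
      have e5 : angle p z = angle p p' + angle p' z :=
        angle_add_of_comb hp'0 (div_nonneg hB hD.le) (div_nonneg hg.le hD.le) hp'
      have e6 := angle_le_angle_add_angle (x 1) p p'
      simp only [zero_add] at key ⊢
      change _ ≤ angle (x 1) p' + angle p' z at key
      linarith

lemma angle_le_sum_angle (x : ℕ → E3) (hne : ∀ i, x i ≠ 0) (N : ℕ) :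
    angle (x 0) (x N) ≤ ∑ l ∈ Finset.range N, angle (x l) (x (l + 1)) := by
  induction N with
  | zero => simp [angle_self (hne 0)]
  | succ N ih =>
    rw [Finset.sum_range_succ]
    exact (angle_le_angle_add_angle _ (x N) _).trans (by linarith)

/-- In an isosceles spherical trapezoid `a, b, x, y`, the lines `b, x` and `a, y` meet. -/
lemma trapezoid {a b x y : E3} {C η : ℝ} (ha : ⟪a, a⟫ = 1) (hb : ⟪b, b⟫ = 1) (hx : ⟪x, x⟫ = 1)
    (hy : ⟪y, y⟫ = 1) (hab : ⟪a, b⟫ = C * η) (hxa : ⟪a, x⟫ = C) (hxb : ⟪b, x⟫ = η)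
    (hya : ⟪a, y⟫ = η) (hyb : ⟪b, y⟫ = C) (dx : 0 < det3 a x b) (dy : 0 < det3 a y b) :
    (1 - C * η) • (x - y) = (η - C) • (b - a) := by
  have e1 : det3 a b x = det3 a b y := by
    have h1 := det3_mul_det3 a b x x
    have h2 := det3_mul_det3 a b y y
    rw [ha, hb, hx, hab, hxa, hxb] at h1
    rw [ha, hb, hy, hab, hya, hyb] at h2
    rw [det3_swap_right] at dx dy
    have h3 : (det3 a b x - det3 a b y) * (det3 a b x + det3 a b y) = 0 := by linarith
    rcases mul_eq_zero.1 h3 with h | h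
    · linarith
    · linarith
  have hc : 0 < ⟪cross3 a b, cross3 a b⟫ := by
    refine real_inner_self_pos.2 fun h => ?_
    rw [det3_swap_right, ← inner_cross3, h] at dx
    simp at dx
  have h0 := cramer_dual a b (cross3 a b) ((1 - C * η) • (x - y) - (η - C) • (b - a))
  have z1 : ⟪(1 - C * η) • (x - y) - (η - C) • (b - a), a⟫ = 0 := by
    simp only [inner_sub_left, real_inner_smul_left]
    rw [real_inner_comm a x, real_inner_comm a y, real_inner_comm a b, ha, hab, hxa, hya]; ring
  have z2 : ⟪(1 - C * η) • (x - y) - (η - C) • (b - a), b⟫ = 0 := by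
    simp only [inner_sub_left, real_inner_smul_left]
    rw [real_inner_comm b x, real_inner_comm b y, hb, hab, hxb, hyb]; ring
  have z3 : ⟪(1 - C * η) • (x - y) - (η - C) • (b - a), cross3 a b⟫ = 0 := by
    rw [real_inner_comm, inner_sub_right, real_inner_smul_right, real_inner_smul_right,
      inner_sub_right, inner_sub_right]
    simp only [inner_cross3]
    rw [e1, det3_self_right, det3_self_outer]; ring
  rw [z1, z2, z3, zero_smul, zero_smul, zero_smul, zero_add, zero_add, ← inner_cross3] at h0
  exact sub_eq_zero.1 ((smul_eq_zero.1 h0).resolve_left hc.ne')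

/-- The trigonometric core of the diameter bound. -/
lemma cos_bound {C η d e l : ℝ} (hC : 0 < C) (hC1 : C < 1) (hη : 0 ≤ η) (hη1 : η < 1)
    (hd0 : 0 ≤ d) (he0 : 0 ≤ e) (heπ : e ≤ Real.pi) (hl0 : 0 ≤ l)
    (hlπ : l ≤ Real.pi) (hd : Real.cos d = C * η) (he : Real.cos e = η)
    (hl : Real.cos l * √((1 - η ^ 2) * (1 - 2 * C * η + C ^ 2)) = C * (1 - η ^ 2))
    (h : d + 2 * e ≤ 2 * l) :
    0 ≤ 2 * η ^ 2 - C * η - 1 ∧ (d + 2 * e < 2 * l → 0 < 2 * η ^ 2 - C * η - 1) := by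
  have hσ : 0 < 1 - η ^ 2 := by nlinarith
  have hN : 0 < 1 - 2 * C * η + C ^ 2 := by nlinarith [sq_nonneg (η - C)]
  set N := 1 - 2 * C * η + C ^ 2 with hNdef
  have hse : 0 ≤ Real.sin e := Real.sin_nonneg_of_nonneg_of_le_pi he0 heπ
  have hsl : 0 ≤ Real.sin l := Real.sin_nonneg_of_nonneg_of_le_pi hl0 hlπ
  have hse2 : Real.sin e ^ 2 = 1 - η ^ 2 := by
    have := Real.sin_sq_add_cos_sq e; rw [he] at this; linarith
  have hse' : 0 < Real.sin e := by
    refine lt_of_le_of_ne hse fun h0 => ?_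
    rw [← h0] at hse2; norm_num at hse2; linarith
  set R := √N with hR
  have hR0 : 0 < R := Real.sqrt_pos.2 hN
  have hR2 : R ^ 2 = N := Real.sq_sqrt hN.le
  have hroot : √((1 - η ^ 2) * N) = Real.sin e * R := by
    rw [Real.sqrt_mul hσ.le, ← hse2, Real.sqrt_sq hse]
  rw [hroot, ← hse2] at hl
  have hcl : Real.cos l * R = C * Real.sin e := by
    apply mul_left_cancel₀ hse'.ne'
    linear_combination hl
  have hslR : Real.sin l * R = 1 - C * η := by
    have h1 : (Real.sin l * R) ^ 2 = (1 - C * η) ^ 2 := by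
      have h2 : (Real.cos l * R) ^ 2 = (C * Real.sin e) ^ 2 := by rw [hcl]
      have h3 := Real.sin_sq_add_cos_sq l
      rw [mul_pow, mul_pow, hse2, hR2] at h2
      rw [mul_pow, hR2]
      linear_combination N * h3 - h2
    exact (pow_left_inj₀ (by positivity) (by nlinarith) two_ne_zero).1 h1
  -- The addition formula applied to R cos l = C sin e and R sin l = 1 − Cη; the terms in Cη cancel.
  have hcos : Real.cos (l - e) * R = Real.sin e := by
    rw [Real.cos_sub, he]
    linear_combination η * hcl + Real.sin e * hslR
  have hcos0 : 0 ≤ Real.cos (l - e) := by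
    by_contra! hneg
    nlinarith [mul_neg_of_neg_of_pos hneg hR0]
  have hd2 : Real.cos (d / 2) ^ 2 = (1 + C * η) / 2 := by
    rw [Real.cos_sq, mul_div_cancel₀ _ two_ne_zero, hd]; ring
  have hsq : Real.cos (l - e) ^ 2 * N = 1 - η ^ 2 := by
    rw [← hR2, ← mul_pow, hcos, hse2]
  -- The sign of cos²(d/2) − cos²(l − e) is thereby the sign of the quadratic.
  have hfac : (1 + C * η) / 2 * N - (1 - η ^ 2) = (1 - C ^ 2) * (2 * η ^ 2 - C * η - 1) / 2 := by
    rw [hNdef]; ring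
  have hC2 : 0 < 1 - C ^ 2 := by nlinarith
  constructor
  · have h1 : Real.cos (l - e) ≤ Real.cos (d / 2) :=
      Real.cos_le_cos_of_nonneg_of_le_pi (by linarith) (by linarith) (by linarith)
    have h2 : Real.cos (l - e) ^ 2 ≤ (1 + C * η) / 2 := by
      rw [← hd2]; exact pow_le_pow_left₀ hcos0 h1 2
    have h3 := mul_le_mul_of_nonneg_right h2 hN.le
    rw [hsq] at h3
    by_contra! hneg
    nlinarith [mul_neg_of_pos_of_neg hC2 hneg]
  · intro hlt
    have h1 : Real.cos (l - e) < Real.cos (d / 2) :=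
      Real.cos_lt_cos_of_nonneg_of_le_pi (by linarith) (by linarith) (by linarith)
    have h2 : Real.cos (l - e) ^ 2 < (1 + C * η) / 2 := by
      rw [← hd2]; exact pow_lt_pow_left₀ h1 hcos0 two_ne_zero
    have h3 := mul_lt_mul_of_pos_right h2 hN
    rw [hsq] at h3
    by_contra! hneg
    nlinarith [mul_nonneg hC2.le (neg_nonneg.2 hneg)]

/-- The vertices, in cyclic order, of a reduced polygon with `2 * k + 1` vertices. -/
structure IsReducedSystem (k : ℕ) (w : ℤ → E3) (C S : ℝ) (g h t : ℤ → E3) : Prop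
    extends IsSideSystem (2 * k + 1) w C S g h t (fun i => i + k) where
  one_le : 1 ≤ k

namespace IsReducedSystem

variable {k : ℕ} {w g h t : ℤ → E3} {C S : ℝ}

lemma ne_zero (H : IsReducedSystem k w C S g h t) (i : ℤ) : w i ≠ 0 := fun h0 => by
  simpa [h0] using H.poly.unit i

lemma shift (H : IsReducedSystem k w C S g h t) {i j : ℤ} (hij : i = j + (2 * k + 1)) :
    w i = w j := by
  rw [hij]; exact_mod_cast H.poly.periodic j

/-- The spherical Pythagorean theorem in the triangle `w i`, `t i`, `w (i + k + 1)`, whose right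
angle is at `t i`. -/
lemma inner_far (H : IsReducedSystem k w C S g h t) (i : ℤ) :
    ⟪w i, w (i + k + 1)⟫ = C * ⟪t i, w (i + k + 1)⟫ := by
  conv_lhs => rw [H.w_eq i, inner_comb_left, (H.opp i).inner_right]
  ring

/-- `w i` is an end of the side opposite to `w (i + k + 1)`, so the same hypotenuse belongs to a
second right triangle with leg Δ; the remaining legs agree. -/
lemma foot_symm' (H : IsReducedSystem k w C S g h t) (i : ℤ) :
    ⟪t (i + k + 1), w i⟫ = ⟪t i, w (i + k + 1)⟫ := by
  have h1 : ⟪w (i + k + 1), w (i + k + 1 + k)⟫ = C * ⟪t (i + k + 1), w (i + k + 1 + k)⟫ := by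
    conv_lhs => rw [H.w_eq (i + k + 1), inner_comb_left, (H.opp (i + k + 1)).inner_left]
    ring
  rw [H.shift (i := i + k + 1 + k) (j := i) (by ring), real_inner_comm, H.inner_far] at h1
  exact (mul_left_cancel₀ H.C_pos.ne' h1).symm

/-- The distance from the point opposite to `w i` to the next vertex. -/
def foot (k : ℕ) (w t : ℤ → E3) (i : ℤ) : ℝ := angle (t i) (w (i + k + 1))

lemma foot_eq (H : IsReducedSystem k w C S g h t) (i : ℤ) :
    angle (w i) (t (i + k + 1)) = foot k w t i := by
  rw [foot, angle_comm, angle_eq_angle_iff_inner (H.t_unit _) (H.poly.unit _) (H.t_unit _)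
    (H.poly.unit _), H.foot_symm']

lemma foot_shift (H : IsReducedSystem k w C S g h t) {i j : ℤ} (hij : i = j + (2 * k + 1)) :
    foot k w t i = foot k w t j := by
  have ht : t i = t j := by rw [hij]; exact_mod_cast H.t_periodic j
  rw [foot, foot, ht, H.shift (i := i + k + 1) (j := j + k + 1) (by rw [hij]; ring)]

/-- This side is opposite to `w (i + k + 1)`, and `t (i + k + 1)` divides it. -/
lemma side_eq (H : IsReducedSystem k w C S g h t) (i : ℤ) :
    angle (w i) (w (i + 1)) = foot k w t i + foot k w t (i + k + 1) := by
  obtain ⟨p, q, hp, hq, e⟩ := (H.opp (i + k + 1)).comb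
  rw [H.shift (i := i + k + 1 + k) (j := i) (by ring),
    H.shift (i := i + k + 1 + k + 1) (j := i + 1) (by ring)] at e
  have h0 : t (i + k + 1) ≠ 0 := fun h0 => by simpa [h0] using H.t_unit (i + k + 1)
  rw [angle_add_of_comb h0 hp hq e, H.foot_eq, foot, foot,
    H.shift (i := i + k + 1 + k + 1) (j := i + 1) (by ring)]

/-- The chords `w i, t i` halve the perimeter. -/
lemma sum_sides (H : IsReducedSystem k w C S g h t) (i : ℤ) :
    ∑ l ∈ Finset.range (k + 1), angle (w (i + l)) (w (i + l + 1)) =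
      ∑ l ∈ Finset.range k, angle (w (i + k + 1 + l)) (w (i + k + 1 + l + 1)) +
        2 * foot k w t i := by
  -- In terms of feet the two chains have the same summands, except that the foot at `i` occurs
  -- twice more on the left.
  simp only [H.side_eq, Finset.sum_add_distrib]
  have e1 : ∀ l : ℕ, foot k w t (i + k + 1 + l + k + 1) = foot k w t (i + (l + 1 : ℕ)) :=
    fun l => H.foot_shift (by push_cast; ring)
  have e2 : ∀ l : ℕ, foot k w t (i + l + k + 1) = foot k w t (i + k + 1 + l) :=
    fun l => by congr 1; ring
  have e3 : foot k w t (i + k + 1 + k) = foot k w t i := H.foot_shift (by ring)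
  simp only [e1, e2]
  rw [Finset.sum_range_succ' (fun l : ℕ => foot k w t (i + l)),
    Finset.sum_range_succ (fun l : ℕ => foot k w t (i + k + 1 + l)), e3]
  simp only [Nat.cast_zero, add_zero]
  ring

lemma dist_le_chain (H : IsReducedSystem k w C S g h t) (i : ℤ) :
    angle (w i) (w (i + k + 1)) ≤
      ∑ l ∈ Finset.range k, angle (w (i + k + 1 + l)) (w (i + k + 1 + l + 1)) := by
  have := angle_le_sum_angle (fun l : ℕ => w (i + k + 1 + l)) (fun _ => H.ne_zero _) k
  simp only [Nat.cast_zero, add_zero] at this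
  rw [H.shift (i := i + k + 1 + k) (j := i) (by ring), angle_comm] at this
  simpa only [Nat.cast_add, Nat.cast_one, add_assoc] using this

lemma dist_lt_chain (H : IsReducedSystem k w C S g h t) (hk : 2 ≤ k) (i : ℤ) :
    angle (w i) (w (i + k + 1)) <
      ∑ l ∈ Finset.range k, angle (w (i + k + 1 + l)) (w (i + k + 1 + l + 1)) := by
  obtain ⟨j, rfl⟩ : ∃ j, k = j + 1 := ⟨k - 1, by omega⟩
  set a := i + (j + 1 : ℕ) + 1 with ha
  have hd := H.poly.det_pos a (a + 1) (a + (j + 1 : ℕ)) (by omega) (by omega) (by omega)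
  have hai : w (a + (j + 1 : ℕ)) = w i := H.shift (by rw [ha]; push_cast; ring)
  have h1 : angle (w a) (w i) < angle (w a) (w (a + 1)) + angle (w (a + 1)) (w i) := by
    refine angle_lt_angle_add_angle (fun r s h => ?_) (fun h => ?_) (H.ne_zero _)
    · rw [h, det3_comb_mid, det3_self_left, hai, det3_self_right] at hd
      simp at hd
    · obtain ⟨-, r, -, h⟩ := angle_eq_pi_iff.1 h
      rw [hai, h] at hd
      simp [det3] at hd
      ring_nf at hd
      exact lt_irrefl _ hd
  have h2 := angle_le_sum_angle (fun l : ℕ => w (a + 1 + l)) (fun _ => H.ne_zero _) j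
  simp only [Nat.cast_zero, add_zero] at h2
  rw [show a + 1 + (j : ℤ) = a + (j + 1 : ℕ) by push_cast; ring, hai] at h2
  rw [Finset.sum_range_succ', angle_comm]
  simp only [Nat.cast_zero, add_zero, Nat.cast_add, Nat.cast_one, ← add_assoc] at h2 ⊢
  have e' : ∀ l : ℕ, a + (l : ℤ) + 1 = a + 1 + l := fun l => by ring
  simp only [e'] at h2 ⊢
  linarith

/-- The value of `h i` at that vertex is, up to the factor S, equal to (1 − C²)η. -/
lemma foot_cos_nonneg (H : IsReducedSystem k w C S g h t) (i : ℤ) :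
    0 ≤ ⟪t i, w (i + k + 1)⟫ := by
  have h1 := mul_nonneg H.S_pos.le (H.h_nonneg i (i + k + 1))
  rw [H.inner_h_of_t, H.inner_far] at h1
  have := H.sq_add_sq
  have : 0 ≤ S ^ 2 * ⟪t i, w (i + k + 1)⟫ := by
    rw [show S ^ 2 = 1 - C ^ 2 by linarith]; linarith
  exact nonneg_of_mul_nonneg_right this (pow_pos H.S_pos 2)

/-- The vertices `w i, …, w (i + k + 1)` form a chain inside an isosceles triangle with base
`w i, w (i + k + 1)`. -/
lemma exists_apex (H : IsReducedSystem k w C S g h t) (i : ℤ)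
    (hη1 : ⟪t i, w (i + k + 1)⟫ < 1) :
    ∃ l : ℝ, 0 ≤ l ∧ l ≤ Real.pi ∧
      Real.cos l * √((1 - ⟪t i, w (i + k + 1)⟫ ^ 2) *
        (1 - 2 * C * ⟪t i, w (i + k + 1)⟫ + C ^ 2)) = C * (1 - ⟪t i, w (i + k + 1)⟫ ^ 2) ∧
      ∑ l ∈ Finset.range (k + 1), angle (w (i + l)) (w (i + l + 1)) ≤ 2 * l := by
  have hη0 := H.foot_cos_nonneg i
  have hk := H.one_le
  have hC := H.C_pos
  have hC1 := H.C_lt_one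
  have hab := H.inner_far i
  have hyb : ⟪w (i + k + 1), t (i + k + 1)⟫ = C := by rw [real_inner_comm, H.t_w]
  have hya : ⟪w i, t (i + k + 1)⟫ = ⟪t i, w (i + k + 1)⟫ := by rw [real_inner_comm, H.foot_symm']
  have hxa : ⟪w i, t i⟫ = C := by rw [real_inner_comm, H.t_w]
  have hxb : ⟪w (i + k + 1), t i⟫ = ⟪t i, w (i + k + 1)⟫ := real_inner_comm _ _
  obtain ⟨p, q, hp, hq, ex⟩ := (H.opp i).comb
  obtain ⟨p', q', hp', hq', ey⟩ := (H.opp (i + k + 1)).comb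
  rw [H.shift (i := i + k + 1 + k) (j := i) (by ring),
    H.shift (i := i + k + 1 + k + 1) (j := i + 1) (by ring)] at ey
  set η := ⟪t i, w (i + k + 1)⟫ with hη
  have hp0 : 0 < p := by
    refine lt_of_le_of_ne hp fun h0 => ?_
    rw [← h0, zero_smul, zero_add] at ex
    have := eq_of_eq_smul (H.t_unit i) (H.poly.unit _) hq ex
    rw [hη, this, H.poly.unit] at hη1
    exact lt_irrefl _ hη1
  have hq0 : 0 < q' := by
    refine lt_of_le_of_ne hq' fun h0 => ?_
    rw [← h0, zero_smul, add_zero] at ey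
    have := eq_of_eq_smul (H.t_unit _) (H.poly.unit _) hp' ey
    rw [this, H.poly.unit] at hya
    linarith
  have dx : 0 < det3 (w i) (t i) (w (i + k + 1)) := by
    rw [ex, det3_comb_mid, det3_self_right, mul_zero, add_zero]
    exact mul_pos hp0 (H.poly.det_pos _ _ _ (by omega) (by omega) (by push_cast; omega))
  have dy : 0 < det3 (w i) (t (i + k + 1)) (w (i + k + 1)) := by
    rw [ey, det3_comb_mid, det3_self_left, mul_zero, zero_add]
    exact mul_pos hq0 (H.poly.det_pos _ _ _ (by omega) (by omega) (by push_cast; omega))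
  have htr := trapezoid (H.poly.unit i) (H.poly.unit _) (H.t_unit i) (H.t_unit _) hab hxa hxb hya
    hyb dx dy
  have hCη : 0 < 1 - C * η := by nlinarith
  -- The apex before normalisation: the trapezoid identity shows that it lies on the lines of both
  -- sides that carry `t i` and `t (i + k + 1)`.
  set P := (1 - C * η) • t i + (-(η - C)) • w (i + k + 1) with hP
  have hP' : P = (1 - C * η) • t (i + k + 1) + (-(η - C)) • w i := by
    rw [hP]
    linear_combination (norm := module) htr
  have hPa : ⟪w i, P⟫ = C * (1 - η ^ 2) := by
    rw [hP, inner_comb_right, hxa, hab]; ring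
  have hPb : ⟪w (i + k + 1), P⟫ = C * (1 - η ^ 2) := by
    rw [hP, inner_comb_right, hxb, H.poly.unit]; ring
  have hPP : ⟪P, P⟫ = (1 - η ^ 2) * (1 - 2 * C * η + C ^ 2) := by
    rw [hP, inner_comb_left, inner_comb_right, inner_comb_right, H.t_unit, H.poly.unit, hxb, ← hη]
    ring
  have hPn : ‖P‖ = √((1 - η ^ 2) * (1 - 2 * C * η + C ^ 2)) := by
    rw [← hPP, real_inner_self_eq_norm_sq, Real.sqrt_sq (norm_nonneg _)]
  have hP0 : 0 < ‖P‖ := by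
    rw [norm_pos_iff]
    intro h0
    rw [h0, inner_zero_right] at hPa
    have : 0 < 1 - η ^ 2 := by nlinarith
    have := mul_pos hC this
    linarith
  have hang : angle P (w (i + k + 1)) = angle (w i) P := by
    rw [angle_comm, angle, angle, hPa, hPb, norm_eq_one_of_inner (H.poly.unit _),
      norm_eq_one_of_inner (H.poly.unit _)]
  refine ⟨angle (w i) P, angle_nonneg _ _, angle_le_pi _ _, ?_, ?_⟩
  · rw [← hPn, cos_angle, hPa, norm_eq_one_of_inner (H.poly.unit _), one_mul,
      div_mul_cancel₀ _ hP0.ne']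
  · have hgP : ⟪g i, P⟫ = 0 := by
      rw [hP, inner_comb_right, H.g_t, (H.opp i).inner_right]; ring
    set c := (1 - C * η) * q' with hc
    have hc0 : 0 < c := mul_pos hCη hq0
    -- `t (i + k + 1)` lies on the side from `w i` to `w (i + 1)`; eliminating it from the second
    -- formula for `P` places `w (i + 1)` on the leg from `w i`.
    have hw1 : w (i + 1) = (-((1 - C * η) * p' - (η - C)) / c) • w i + c⁻¹ • P := by
      apply smul_right_injective E3 hc0.ne'
      simp only [smul_add, smul_smul, mul_div_cancel₀ _ hc0.ne', mul_inv_cancel₀ hc0.ne']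
      rw [hP', ey, hc]
      module
    have hlam : 0 ≤ -((1 - C * η) * p' - (η - C)) / c := by
      have h1 := H.g_nonneg i (i + 1)
      rw [hw1, inner_comb_right, hgP, H.g_w, mul_zero, add_zero] at h1
      exact nonneg_of_mul_nonneg_left h1 H.S_pos
    have key := sum_angle_le_of_convex k (fun l : ℕ => w (i + l)) P
      (fun a b c h1 h2 h3 => H.poly.det_pos _ _ _ (by omega) (by omega) (by push_cast; omega))
      (fun _ => H.ne_zero _) hlam (inv_nonneg.2 hc0.le) (by simpa using hw1) (fun l hl => by
        rw [hP, show (i : ℤ) + ((k + 1 : ℕ) : ℤ) = i + k + 1 by push_cast; ring, det3_comb_mid,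
          det3_self_right, mul_zero, add_zero, ex, det3_comb_mid, det3_self_right, mul_zero,
          add_zero]
        refine mul_nonneg hCη.le (mul_nonneg hp ?_)
        rcases Nat.lt_or_ge l k with h1 | h1
        · exact (H.poly.det_pos _ _ _ (by omega) (by omega) (by push_cast; omega)).le
        · rcases Nat.eq_or_lt_of_le h1 with h2 | h2
          · rw [← h2, det3_self_left]
          · rw [show (i : ℤ) + l = i + k + 1 by omega, det3_self_outer])
    simp only [Nat.cast_add, Nat.cast_one, Nat.cast_zero, add_zero, ← add_assoc] at key
    rw [hang] at key
    linarith

/-- The bound for the distances of the pairs `w i, w (i + k + 1)`. -/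
lemma foot_cos_bound (H : IsReducedSystem k w C S g h t) (i : ℤ) :
    0 ≤ 2 * ⟪t i, w (i + k + 1)⟫ ^ 2 - C * ⟪t i, w (i + k + 1)⟫ - 1 ∧
      (2 ≤ k → 0 < 2 * ⟪t i, w (i + k + 1)⟫ ^ 2 - C * ⟪t i, w (i + k + 1)⟫ - 1) := by
  have h1 := (abs_le.1 (abs_inner_le_one (H.t_unit i) (H.poly.unit (i + k + 1)))).2
  rcases h1.eq_or_lt with h2 | h2
  -- If `t i` is the vertex itself, the triangle degenerates, but the quadratic equals 1 − C > 0.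
  · rw [h2]
    have := H.C_lt_one
    constructor <;> intros <;> linarith
  obtain ⟨l, l0, lπ, hl, hchain⟩ := H.exists_apex i h2
  have hsum := H.sum_sides i
  have hd := H.dist_le_chain i
  have key := cos_bound H.C_pos H.C_lt_one (H.foot_cos_nonneg i) h2
    (d := angle (w i) (w (i + k + 1))) (e := foot k w t i) (l := l) (angle_nonneg _ _)
    (angle_nonneg _ _) (angle_le_pi _ _) l0 lπ
    (by rw [cos_angle_unit (H.poly.unit _) (H.poly.unit _), H.inner_far])
    (cos_angle_unit (H.t_unit _) (H.poly.unit _)) hl (by linarith)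
  refine ⟨key.1, fun hk => key.2 ?_⟩
  have := H.dist_lt_chain hk i
  linarith

end IsReducedSystem

end SphericalPolygon
end

/-! ### Which vertices are farthest apart -/

noncomputable section

namespace SphericalPolygon

open InnerProductGeometry Filter Topology
open scoped RealInnerProductSpace

/-- The frame sits at the foot (1, 0, 0) on the side with ends (x, y, 0) and (u, −v, 0); a is a
third vertex. The foot is a nonnegative combination of the ends, so `h2` also gives a₁x + a₂y ≤ a₁.
If y > 0, then a₂² ≤ a₁(C − a₁), and with the lune bound on a₃ the norm of a would be less than 1.
-/
lemma degenerate_of_minimal {C S a₁ a₂ a₃ x y u v p q : ℝ} (hC : 0 < C) (hS : 0 < S)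
    (hCS : S ^ 2 + C ^ 2 = 1) (ha : a₁ ^ 2 + a₂ ^ 2 + a₃ ^ 2 = 1) (hx : x ^ 2 + y ^ 2 = 1)
    (hu : u ^ 2 + v ^ 2 = 1) (ha2 : 0 < a₂) (ha3 : 0 ≤ a₃) (haS : C * a₃ ≤ S * a₁) (hx0 : 0 ≤ x)
    (hu0 : 0 ≤ u) (hy0 : 0 ≤ y) (hv0 : 0 ≤ v) (hp : 0 ≤ p) (hq : 0 ≤ q) (h1 : a₁ * x + a₂ * y ≤ C * x)
    (h2 : a₁ * x + a₂ * y ≤ a₁ * u - a₂ * v) (h3 : 1 = p * x + q * u) (h4 : p * y = q * v) :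
    x = 1 ∧ u = 1 := by
  have ha1 : 0 ≤ a₁ := nonneg_of_mul_nonneg_right ((mul_nonneg hC.le ha3).trans haS) hS
  have hx1 : x ≤ 1 := by nlinarith [sq_nonneg y]
  have hu1 : u ≤ 1 := by nlinarith [sq_nonneg v]
  rcases hy0.eq_or_lt with h0 | h0
  · subst h0
    have hx' : x = 1 := by nlinarith
    subst hx'
    refine ⟨rfl, ?_⟩
    have hv : v = 0 := by
      by_contra hv
      have := mul_pos ha2 (lt_of_le_of_ne hv0 (Ne.symm hv))
      nlinarith [mul_nonneg ha1 (sub_nonneg.2 hu1)]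
    subst hv
    nlinarith
  · exfalso
    have hc : 0 ≤ a₁ * x + a₂ * y := by positivity
    have h5 : a₁ * x + a₂ * y ≤ a₁ := by
      have e : a₁ = p * (a₁ * x + a₂ * y) + q * (a₁ * u - a₂ * v) := by
        linear_combination a₁ * h3 - a₂ * h4
      have hpq : 1 ≤ p + q := by nlinarith
      nlinarith [mul_le_mul_of_nonneg_left h2 hq, mul_le_mul_of_nonneg_right hpq hc]
    have h6 : a₂ * x ≤ a₁ * y := by
      refine le_of_mul_le_mul_right ?_ h0
      nlinarith [mul_nonneg hx0 (sub_nonneg.2 h5)]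
    have h7 := mul_pos ha2 h0
    have hx' : 0 < x := by
      rcases hx0.eq_or_lt with h | h
      · subst h; linarith
      · exact h
    have h8 : a₁ < C := lt_of_mul_lt_mul_right (by linarith : a₁ * x < C * x) hx0
    have h9 : a₂ ^ 2 ≤ a₁ * (C - a₁) := by
      refine le_of_mul_le_mul_right ?_ hx'
      linarith [mul_le_mul_of_nonneg_left h6 ha2.le, mul_le_mul_of_nonneg_left h1 ha1]
    have h10 : (C * a₃) ^ 2 ≤ (S * a₁) ^ 2 := by
      have := mul_nonneg hC.le ha3
      gcongr
    have h11 : a₁ ^ 2 ≤ C * a₁ := by linarith [mul_le_mul_of_nonneg_left h8.le ha1]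
    have h12 : C * a₁ < C * C := mul_lt_mul_of_pos_left h8 hC
    have h13 : C ^ 2 ≤ C ^ 2 * (C * a₁) + S ^ 2 * a₁ ^ 2 := by
      linear_combination mul_le_mul_of_nonneg_left h9 (sq_nonneg C) + h10 - C ^ 2 * ha
    have h14 := mul_le_mul_of_nonneg_left h11 (sq_nonneg S)
    have h15 : C ^ 2 * (C * a₁) + S ^ 2 * (C * a₁) = C * a₁ := by
      linear_combination C * a₁ * hCS
    linarith

namespace IsReducedSystem

variable {k : ℕ} {w g h t : ℤ → E3} {C S : ℝ}

/-- The pair is compared with two others: `w j` with the vertex q opposite to the side `w j, w (j +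
1)`, and `w i` with `w (j + 1)`. If neither were farther apart, both ends of that side would
coincide with `t q`. -/
lemma not_minimal (H : IsReducedSystem k w C S g h t) {i j : ℤ} (h1 : i < j) (h2 : j < i + k)
    (hmin : ∀ a b, ⟪w i, w j⟫ ≤ ⟪w a, w b⟫) : False := by
  obtain ⟨p, p', hp, hp', hf⟩ := (H.opp (j + k + 1)).comb
  have s1 : w (j + k + 1 + k) = w j := H.shift (by ring)
  have s2 : w (j + k + 1 + k + 1) = w (j + 1) := H.shift (by ring)
  have s3 : w (i + (2 * k + 1)) = w i := H.shift rfl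
  have il := (H.opp (j + k + 1)).inner_left
  have ir := (H.opp (j + k + 1)).inner_right
  have dl := H.det3_t_left (i := j + k + 1) (l := i + (2 * k + 1)) (by omega) (by omega)
  have dx := H.det3_t_left (i := j + k + 1) (l := j + k + 1 + k)
    (by have := H.one_le; omega) (by omega)
  have dw := H.det3_t_right (i := j + k + 1) (l := j + k + 1 + k + 1) (by omega)
    (by have := H.one_le; push_cast; omega)
  have hq := H.inner_t (j + k + 1)
  simp only at s1 s2 hf il ir dl dx dw
  rw [s1, s2] at hf
  rw [s1] at il dx
  rw [s2] at ir dw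
  rw [s3] at dl
  set q := j + k + 1
  have hV : ∀ z, det3 (w q) (t q) z = S * det3 (g q) (t q) z := fun z => by
    conv_lhs => rw [H.w_eq q]
    rw [det3_comb_left, det3_self_left]; ring
  rw [hV] at dl dx dw
  have hS := H.S_pos
  have par := inner_eq_of_orthonormal (H.g_unit q) (H.t_unit q) (H.g_t q)
  have va : det3 (g q) (t q) (w i) < 0 := by
    rcases dl with h | ⟨-, h, -⟩
    · by_contra! h'; nlinarith
    · omega
  have vx : det3 (g q) (t q) (w j) ≤ 0 := by
    by_contra! h'; rcases dx with h | ⟨h, -⟩ <;> nlinarith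
  have vw : 0 ≤ det3 (g q) (t q) (w (j + 1)) := by
    by_contra! h'; rcases dw with h | ⟨h, -⟩ <;> nlinarith
  have nA := par (w i) (w i)
  have nX := par (w j) (w j)
  have nW := par (w (j + 1)) (w (j + 1))
  have AX := par (w i) (w j)
  have AW := par (w i) (w (j + 1))
  rw [H.poly.unit] at nA nX nW
  rw [il] at nX AX
  rw [ir] at nW AW
  have xo : ⟪w j, w q⟫ = C * ⟪t q, w j⟫ := by
    conv_lhs => rw [H.w_eq q]
    rw [inner_comb_right, real_inner_comm (g q), il, real_inner_comm]
    ring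
  have m1 := hmin j q
  have m2 := hmin i (j + 1)
  rw [xo] at m1
  have hh : ∀ z, 0 ≤ ⟪h q, z⟫ → C * ⟪g q, z⟫ ≤ S * ⟪t q, z⟫ := fun z hz => by
    rw [H.inner_g, H.inner_t]
    have := mul_nonneg (by nlinarith [H.sq_add_sq] : 0 ≤ S ^ 2 + C ^ 2) hz
    linarith
  have hx0 := hh _ (H.h_nonneg q j)
  rw [il, mul_zero] at hx0
  have hu0 := hh _ (H.h_nonneg q (j + 1))
  rw [ir, mul_zero] at hu0
  have f1 : 1 = p * ⟪t q, w j⟫ + p' * ⟪t q, w (j + 1)⟫ := by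
    rw [← H.t_unit q]; nth_rw 2 [hf]; rw [inner_comb_right]
  have f2 : p * -det3 (g q) (t q) (w j) = p' * det3 (g q) (t q) (w (j + 1)) := by
    have := det3_self_right (g q) (t q)
    nth_rw 2 [hf] at this
    rw [det3_comb_right] at this
    linarith
  obtain ⟨e1, e2⟩ := degenerate_of_minimal (a₁ := ⟪t q, w i⟫) (a₂ := -det3 (g q) (t q) (w i))
    (y := -det3 (g q) (t q) (w j)) (v := det3 (g q) (t q) (w (j + 1)))
    H.C_pos hS H.sq_add_sq (by linear_combination -nA)
    (by linear_combination -nX) (by linear_combination -nW) (by linarith) (H.g_nonneg q i)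
    (hh _ (H.h_nonneg q i)) (nonneg_of_mul_nonneg_right hx0 hS)
    (nonneg_of_mul_nonneg_right hu0 hS) (by linarith) vw hp hp'
    (by linarith) (by linarith) f1 f2
  have hne := H.poly.ne_of_lt (i := j) (j := j + 1) (by omega)
    (by have := H.one_le; push_cast; omega)
  apply hne
  rw [← eq_of_inner_eq_one (H.t_unit q) (H.poly.unit j) e1.ge,
    ← eq_of_inner_eq_one (H.t_unit q) (H.poly.unit (j + 1)) e2.ge]

lemma exists_min_inner (H : IsReducedSystem k w C S g h t) :
    ∃ i, ∀ a b, C * ⟪t i, w (i + k + 1)⟫ ≤ ⟪w a, w b⟫ := by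
  suffices ∃ i, ∀ a b, ⟪w i, w (i + k + 1)⟫ ≤ ⟪w a, w b⟫ by
    obtain ⟨i, hi⟩ := this
    exact ⟨i, fun a b => by rw [← H.inner_far]; exact hi a b⟩
  have hk := H.one_le
  set n := 2 * k + 1 with hn
  obtain ⟨⟨i, j'⟩, -, hmin⟩ := Finset.exists_min_image
    (Finset.Ico (0 : ℤ) (0 + n) ×ˢ Finset.Ico (0 : ℤ) (0 + n)) (fun x => ⟪w x.1, w x.2⟫)
    ⟨(0, 0), by simp [hn]⟩
  obtain ⟨j, hj1, hj2, -, hj⟩ := H.poly.exists_window_eq i j'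
  have hmin' : ∀ a b, ⟪w i, w j⟫ ≤ ⟪w a, w b⟫ := by
    intro a b
    obtain ⟨a', ha1, ha2, -, ha⟩ := H.poly.exists_window_eq 0 a
    obtain ⟨b', hb1, hb2, -, hb⟩ := H.poly.exists_window_eq 0 b
    rw [ha, hb, ← hj]
    exact hmin (a', b') (Finset.mem_product.2 ⟨Finset.mem_Ico.2 ⟨ha1, ha2⟩,
      Finset.mem_Ico.2 ⟨hb1, hb2⟩⟩)
  have hs : w (i + n) = w i := H.shift (by push_cast [hn]; ring)
  rcases hj1.eq_or_lt with rfl | hlt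
  · have := hmin' i (i + 1)
    rw [H.poly.unit] at this
    exact absurd (eq_of_inner_eq_one (H.poly.unit _) (H.poly.unit _) this)
      (H.poly.ne_of_lt (by omega) (by push_cast; omega))
  rcases lt_trichotomy j (i + k) with h1 | h1 | h1
  · exact (H.not_minimal hlt h1 hmin').elim
  -- A pair k steps apart is k + 1 steps apart when read from its other end.
  · refine ⟨j, fun a b => ?_⟩
    rw [show j + k + 1 = i + n by rw [h1, hn]; push_cast; ring, hs, real_inner_comm]
    exact hmin' a b
  · rcases (show i + k + 1 ≤ j by omega).eq_or_lt with h2 | h2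
    · exact ⟨i, fun a b => by rw [h2]; exact hmin' a b⟩
    · refine (H.not_minimal (i := j) (j := i + n) hj2 (by push_cast [hn]; omega)
        fun a b => ?_).elim
      rw [hs, real_inner_comm]
      exact hmin' a b

end IsReducedSystem

end SphericalPolygon

end

/-! ### From a reduced polygon to a reduced system -/

noncomputable section

namespace SphericalPolygon

open InnerProductGeometry Filter Topology
open scoped RealInnerProductSpace

/-- Carries exposedness from the vertices to the whole polygon: a zero value would put all weight of
the combination on `w z`. -/
lemma IsCyclicPolygon.inner_pos_of_sum {n : ℕ} {w : ℤ → E3} {v : Fin n → S2} {z : ℤ} {c : E3}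
    (hw : IsCyclicPolygon n w) (hvw : ∀ i, ∃ z, w z = v i)
    (hcz : ⟪c, w z⟫ = 0) (hc : ∀ l, w l ≠ w z → 0 < ⟪c, w l⟫) {x : S2} {l : Fin n → ℝ}
    (hl : ∀ i, 0 ≤ l i) (hx : (x : E3) = ∑ i, l i • (v i : E3)) (hne : (x : E3) ≠ w z) :
    0 < ⟪c, (x : E3)⟫ := by
  have hv : ∀ i, (v i : E3) = w z ∨ 0 < ⟪c, (v i : E3)⟫ := fun i => by
    obtain ⟨y, hy⟩ := hvw i
    rw [← hy]
    exact or_iff_not_imp_left.2 (hc y)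
  have hnn : ∀ i, 0 ≤ l i * ⟪c, (v i : E3)⟫ := fun i => mul_nonneg (hl i) (by
    rcases hv i with h | h
    · rw [h, hcz]
    · exact h.le)
  have hsum : ⟪c, (x : E3)⟫ = ∑ i, l i * ⟪c, (v i : E3)⟫ := by
    rw [hx, inner_sum]; simp only [real_inner_smul_right]
  rw [hsum]
  refine lt_of_le_of_ne (Finset.sum_nonneg fun i _ => hnn i) fun h0 => hne ?_
  rw [eq_comm, Finset.sum_eq_zero_iff_of_nonneg fun i _ => hnn i] at h0
  refine eq_of_eq_smul (r := ∑ i, l i) (real_inner_self_sphere x) (hw.unit z)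
    (Finset.sum_nonneg fun i _ => hl i) ?_
  rw [hx, Finset.sum_smul]
  refine Finset.sum_congr rfl fun i hi => ?_
  rcases hv i with h | h
  · rw [h]
  · rw [(mul_eq_zero.1 (h0 i hi)).resolve_right h.ne', zero_smul, zero_smul]

variable {n : ℕ} {v : Fin n → S2} {V : Set S2}

lemma IsConvexGon.exists_reducedSystem (hV : IsConvexGon v V) (hred : IsReduced V)
    (hth : thickness V < Real.pi / 2) :
    ∃ (k : ℕ) (w g h t : ℤ → E3), n = 2 * k + 1 ∧
      IsReducedSystem k w (Real.cos (thickness V)) (Real.sin (thickness V)) g h t ∧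
      (∀ z, ∃ i, w z = v i) ∧ (∀ i, ∃ z, w z = v i) ∧
      ∀ x ∈ V, ∃ l : Fin n → ℝ, (∀ i, 0 ≤ l i) ∧ (x : E3) = ∑ i, l i • (v i : E3) := by
  have hvV : ∀ i, v i ∈ V := fun i => by
    rw [hV.eq_hull]; exact subset_hull _ (Set.mem_range_self i)
  obtain ⟨c, hc⟩ := exists_inner_pos hred.convexBody.convex hred.convexBody.closed
  have hcomb : ∀ x ∈ V, ∃ l : Fin n → ℝ, (∀ i, 0 ≤ l i) ∧ (x : E3) = ∑ i, l i • (v i : E3) :=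
    fun x hx => exists_sum_of_mem_hull (fun i => hc _ (hvV i)) (hV.eq_hull ▸ hx)
  obtain ⟨w, hw, hwv, hvw⟩ := hV.exists_cyclic fun i => hc _ (hvV i)
  have hn := hw.three_le
  have hdual : ∀ y, y ∈ dual V ↔ ∀ l, 0 ≤ ⟪y, w l⟫ := by
    refine fun y => ⟨fun hy l => ?_, fun hy x hx => ?_⟩
    · obtain ⟨i, hi⟩ := hwv l
      rw [hi]; exact hy _ (hvV i)
    · obtain ⟨l, hl, hx⟩ := hcomb x hx
      rw [hx, inner_sum]
      refine Finset.sum_nonneg fun i _ => ?_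
      obtain ⟨z, hz⟩ := hvw i
      rw [real_inner_smul_right, ← hz]
      exact mul_nonneg (hl i) (hy z)
  have hexp : ∀ z, ∃ (a : S2) (c : E3), a ∈ V ∧ (a : E3) = w z ∧ ⟪c, (a : E3)⟫ = 0 ∧
      (∀ x ∈ V, x ≠ a → 0 < ⟪c, (x : E3)⟫) ∧ c ≠ 0 := fun z => by
    obtain ⟨i, hi⟩ := hwv z
    obtain ⟨c, hc0, hc⟩ := hw.exists_exposing z
    refine ⟨v i, c, hvV i, hi.symm, by rw [← hi, hc0], fun x hx hne => ?_, fun h0 => ?_⟩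
    · obtain ⟨l, hl, hx⟩ := hcomb x hx
      exact hw.inner_pos_of_sum hvw hc0 hc hl hx fun h => hne (Subtype.ext (h.trans hi))
    · have := hc (z + 1) (hw.ne_of_lt (i := z) (by omega) (by omega)).symm
      simp [h0] at this
  have hlune : ∀ z, ∃ h : E3, ⟪h, h⟫ = 1 ∧ ⟪w z, h⟫ = 0 ∧ h ∈ dual V ∧
      Real.sin (thickness V) • w z - Real.cos (thickness V) • h ∈ dual V ∧
      ∃ t ∈ V, (t : E3) = Real.cos (thickness V) • w z + Real.sin (thickness V) • h := fun z => by
    obtain ⟨a, c, ha, haw, hca, hc, hc0⟩ := hexp z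
    rw [← haw]
    exact hred.exists_lune hth ha hca hc hc0
  choose h₀ hh using hlune
  have hmod : ∀ z : ℤ, w (z % n) = w z := fun z =>
    hw.periodic_of_dvd ((Int.mod_modEq z n).symm.dvd)
  have hpos : 0 < thickness V := by
    obtain ⟨a, c, ha, -, hca, hc, hc0⟩ := hexp 0
    exact hred.thickness_pos ha hca hc hc0
  set C := Real.cos (thickness V) with hC
  set S := Real.sin (thickness V) with hS
  -- One lune is chosen per residue class, which makes the choice periodic.
  set h : ℤ → E3 := fun z => h₀ (z % n) with hhdef
  have hh' : ∀ z, ⟪h z, h z⟫ = 1 ∧ ⟪w z, h z⟫ = 0 ∧ h z ∈ dual V ∧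
      S • w z - C • h z ∈ dual V ∧ ∃ t ∈ V, (t : E3) = C • w z + S • h z := fun z => by
    rw [← hmod z]; exact hh (z % n)
  have H : IsLuneSystem n w C S (fun z => S • w z - C • h z) h (fun z => C • w z + S • h z) :=
    { poly := hw
      C_pos := Real.cos_pos_of_mem_Ioo ⟨by linarith, hth⟩
      S_pos := Real.sin_pos_of_pos_of_lt_pi hpos (by linarith [Real.pi_pos])
      sq_add_sq := Real.sin_sq_add_cos_sq _
      inner_ge := fun y z hy hz => neg_cos_thickness_mul_le hred.convexBody.interior_nonempty
        ((hdual y).2 hy) ((hdual z).2 hz)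
      h_unit := fun z => (hh' z).1
      h_orth := fun z => (hh' z).2.1
      h_nonneg := fun z => (hdual _).1 (hh' z).2.2.1
      g_nonneg := fun z => (hdual _).1 (hh' z).2.2.2.1
      g_eq := fun _ => rfl
      t_eq := fun _ => rfl
      h_periodic := fun z => by simp [hhdef]
      t_comb := fun z => by
        obtain ⟨t, htV, ht⟩ := (hh' z).2.2.2.2
        obtain ⟨l, hl, hlt⟩ := hcomb t htV
        choose y hy using hvw
        exact ⟨y, l, hl, by simp only [← ht, hlt, hy]⟩ }
  choose m hm using H.exists_isOpposite
  have H' : IsSideSystem n w C S _ h _ m := ⟨H, hm⟩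
  obtain ⟨k, hk, hn', hmk⟩ := H'.exists_half
  obtain rfl : m = fun i : ℤ => i + (k : ℤ) := funext hmk
  subst hn'
  exact ⟨k, w, _, h, _, rfl, ⟨H', hk⟩, hwv, hvw, hcomb⟩

end SphericalPolygon

end

/-! ### Triangles, the diameter and the constant γ -/

noncomputable section

namespace SphericalPolygon

open InnerProductGeometry Filter Topology
open scoped RealInnerProductSpace

namespace IsReducedSystem

variable {k : ℕ} {w g h t : ℤ → E3} {C S : ℝ}

/-- Volume as height times base: the height of `w i` over its opposite side is S, the base is the
sine of that side. -/
lemma det3_sq (H : IsReducedSystem k w C S g h t) (i : ℤ) :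
    det3 (w i) (w (i + k)) (w (i + k + 1)) ^ 2 =
      S ^ 2 * (1 - ⟪w (i + k), w (i + k + 1)⟫ ^ 2) := by
  have h1 := (H.opp i).inner_left
  have h2 := (H.opp i).inner_right
  have h3 := inner_eq_of_orthonormal (H.g_unit i) (H.poly.unit (i + k)) h1
    (w (i + k + 1)) (w (i + k + 1))
  rw [h2, H.poly.unit] at h3
  have h4 := congrArg (fun x => ⟪x, g i⟫) (cramer_dual (w i) (w (i + k)) (w (i + k + 1)) (g i))
  simp only [inner_add_left, real_inner_smul_left, inner_cross3, H.g_unit] at h4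
  rw [H.g_w, h1, h2, ← det3_rotate (g i) (w (i + k))] at *
  rw [mul_one, zero_mul, zero_mul, add_zero, add_zero] at h4
  rw [h4]
  linear_combination -S ^ 2 * h3

/-- All three heights equal S, so computing the same volume over different sides equates their
sines; the cosines are nonnegative, hence equal too. -/
lemma triangle_side_succ (H : IsReducedSystem 1 w C S g h t) (i : ℤ) :
    ⟪w i, w (i + 1)⟫ = ⟪w (i + 1), w (i + 2)⟫ := by
  have h1 := H.det3_sq i
  have h2 := H.det3_sq (i + 2)
  have c1 := H.foot_cos_nonneg (i + 1)
  have c2 := H.foot_cos_nonneg (i + 2)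
  have d1 := H.inner_far (i + 1)
  have d2 := H.inner_far (i + 2)
  simp only [Nat.cast_one, add_assoc] at h1 h2 c1 c2 d1 d2
  norm_num at h1 h2 c1 c2 d1 d2
  have s3 : w (i + 3) = w i := H.shift (by norm_num)
  have s4 : w (i + 4) = w (i + 1) := H.shift (by push_cast; ring)
  rw [s3, s4, ← det3_rotate, h1] at h2
  rw [s3] at d1 c1
  rw [s4] at d2 c2
  have hsq := mul_left_cancel₀ (pow_ne_zero 2 H.S_pos.ne') h2
  rw [real_inner_comm] at d1 d2
  rw [← sq_eq_sq₀ (d1 ▸ mul_nonneg H.C_pos.le c1) (d2 ▸ mul_nonneg H.C_pos.le c2)]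
  linarith

lemma triangle_side_eq (H : IsReducedSystem 1 w C S g h t) (i : ℤ) :
    ⟪w i, w (i + 1)⟫ = ⟪w 0, w 1⟫ := by
  induction i using Int.induction_on with
  | zero => rfl
  | succ i ih => rw [← ih, H.triangle_side_succ i]; ring_nf
  | pred i ih =>
    rw [← ih, H.triangle_side_succ (-i - 1)]; ring_nf

lemma triangle_inner_eq (H : IsReducedSystem 1 w C S g h t) {i j : ℤ} (hne : w i ≠ w j) :
    ⟪w i, w j⟫ = ⟪w 0, w 1⟫ := by
  obtain ⟨l, h1, h2, -, h3⟩ := H.poly.exists_window_eq i j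
  rw [h3] at hne ⊢
  obtain rfl | rfl | rfl : l = i ∨ l = i + 1 ∨ l = i + 2 := by push_cast at h2; omega
  · exact absurd rfl hne
  · exact H.triangle_side_eq i
  · rw [real_inner_comm, ← H.triangle_side_eq (i + 2),
      H.shift (i := i + 2 + 1) (j := i) (by push_cast; ring)]

/-- All feet equal some e, so each side is 2e, while its cosine is C cos e; the doubling formula
gives the equation. -/
lemma triangle_foot (H : IsReducedSystem 1 w C S g h t) (i : ℤ) :
    2 * ⟪t i, w (i + (1 : ℕ) + 1)⟫ ^ 2 - C * ⟪t i, w (i + (1 : ℕ) + 1)⟫ - 1 = 0 := by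
  have key : ∀ j, C * ⟪t j, w (j + (1 : ℕ) + 1)⟫ = ⟪w 0, w 1⟫ := fun j => by
    rw [← H.inner_far]
    exact H.triangle_inner_eq (H.poly.ne_of_lt (by omega) (by push_cast; omega))
  have h1 : ∀ j, foot 1 w t j = foot 1 w t i := fun j => by
    rw [foot, foot, angle_eq_angle_iff_inner (H.t_unit _) (H.poly.unit _) (H.t_unit _)
      (H.poly.unit _)]
    exact mul_left_cancel₀ H.C_pos.ne' ((key j).trans (key i).symm)
  have h2 := cos_angle_unit (H.poly.unit i) (H.poly.unit (i + 1))
  rw [H.side_eq, h1 (i + (1 : ℕ) + 1), ← two_mul, Real.cos_two_mul, foot,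
    cos_angle_unit (H.t_unit _) (H.poly.unit _), H.triangle_side_eq, ← key i] at h2
  linarith

end IsReducedSystem

lemma sdist_eq_arccos (a b : S2) : sdist a b = Real.arccos ⟪(a : E3), (b : E3)⟫ := by
  rw [sdist, angle, norm_eq_of_mem_sphere, norm_eq_of_mem_sphere, mul_one, div_one]

lemma sangle_eq_arccos {a b c : S2} {d : ℝ} (hab : ⟪(a : E3), (b : E3)⟫ = d)
    (hbc : ⟪(b : E3), (c : E3)⟫ = d) (hac : ⟪(a : E3), (c : E3)⟫ = d) :
    sangle a b c = Real.arccos ((d - d ^ 2) / (√(1 - d ^ 2) * √(1 - d ^ 2))) := by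
  have hba : ⟪(b : E3), (a : E3)⟫ = d := by rw [real_inner_comm, hab]
  have ha := real_inner_self_sphere a
  have hb := real_inner_self_sphere b
  have hc := real_inner_self_sphere c
  have hcb : ⟪(c : E3), (b : E3)⟫ = d := by rw [real_inner_comm, hbc]
  have e1 : ⟪orthComponent b a, orthComponent b c⟫ = d - d ^ 2 := by
    simp only [orthComponent, inner_sub_left, inner_sub_right, real_inner_smul_left,
      real_inner_smul_right, hab, hbc, hac, hba, hb]
    ring
  have e2 : ⟪orthComponent b a, orthComponent b a⟫ = 1 - d ^ 2 := by
    simp only [orthComponent, inner_sub_left, inner_sub_right, real_inner_smul_left,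
      real_inner_smul_right, hab, hba, ha, hb]
    ring
  have e3 : ⟪orthComponent b c, orthComponent b c⟫ = 1 - d ^ 2 := by
    simp only [orthComponent, inner_sub_left, inner_sub_right, real_inner_smul_left,
      real_inner_smul_right, hcb, hbc, hc, hb]
    ring
  rw [sangle, angle, norm_eq_sqrt_real_inner, norm_eq_sqrt_real_inner, e1, e2, e3]

/-- Unit combinations of the vertices have coefficient sums at least 1. As c ≥ 0, bilinearity
carries the bound from vertices to all points. -/
lemma diam_eq_arccos {n : ℕ} {v : Fin n → S2} {V : Set S2} (hv : ∀ i, v i ∈ V)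
    (hcomb : ∀ x ∈ V, ∃ l : Fin n → ℝ, (∀ i, 0 ≤ l i) ∧ (x : E3) = ∑ i, l i • (v i : E3))
    {c : ℝ} (hc : 0 ≤ c) (hle : ∀ i j, c ≤ ⟪(v i : E3), (v j : E3)⟫) {i j : Fin n}
    (hij : ⟪(v i : E3), (v j : E3)⟫ = c) : diam V = Real.arccos c := by
  refine IsGreatest.csSup_eq ⟨⟨v i, hv i, v j, hv j, by rw [sdist_eq_arccos, hij]⟩, ?_⟩
  rintro _ ⟨x, hx, y, hy, rfl⟩
  rw [sdist_eq_arccos]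
  apply Real.arccos_le_arccos
  have hsum : ∀ (x : S2) (l : Fin n → ℝ), (∀ i, 0 ≤ l i) → (x : E3) = ∑ i, l i • (v i : E3) →
      1 ≤ ∑ i, l i := fun x l hl hx => by
    rw [← norm_eq_of_mem_sphere x, hx]
    refine (norm_sum_le _ _).trans (Finset.sum_le_sum fun i _ => ?_)
    rw [norm_smul, norm_eq_of_mem_sphere, mul_one, Real.norm_of_nonneg (hl i)]
  obtain ⟨l, hl, hxl⟩ := hcomb x hx
  obtain ⟨m, hm, hym⟩ := hcomb y hy
  have h1 := one_le_mul_of_one_le_of_one_le (hsum x l hl hxl) (hsum y m hm hym)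
  rw [Finset.sum_mul_sum] at h1
  rw [hxl, hym, sum_inner]
  calc c = c * 1 := (mul_one c).symm
    _ ≤ c * ∑ a, ∑ b, l a * m b := mul_le_mul_of_nonneg_left h1 hc
    _ = ∑ a, ∑ b, l a * m b * c := by
      rw [Finset.mul_sum]
      refine Finset.sum_congr rfl fun a _ => ?_
      rw [Finset.mul_sum]
      exact Finset.sum_congr rfl fun b _ => mul_comm _ _
    _ ≤ _ := by
      refine Finset.sum_le_sum fun a _ => ?_
      rw [inner_sum]
      refine Finset.sum_le_sum fun b _ => ?_
      rw [real_inner_smul_left, real_inner_smul_right, ← mul_assoc]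
      exact mul_le_mul_of_nonneg_left (hle a b) (mul_nonneg (hl a) (hm b))

lemma isRegularTriangle_of_inner {v : Fin 3 → S2} {V : Set S2} (hV : IsConvexGon v V) {d : ℝ}
    (hd : ∀ i j, i ≠ j → ⟪(v i : E3), (v j : E3)⟫ = d) : IsRegularTriangle V := by
  refine ⟨v, hV, ?_, ?_⟩
  · simp only [sdist_eq_arccos]
    rw [hd 0 1 (by decide), hd 1 2 (by decide), hd 2 0 (by decide)]
    exact ⟨rfl, rfl⟩
  · rw [sangle_eq_arccos (hd 2 0 (by decide)) (hd 0 1 (by decide)) (hd 2 1 (by decide)),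
      sangle_eq_arccos (hd 0 1 (by decide)) (hd 1 2 (by decide)) (hd 0 2 (by decide)),
      sangle_eq_arccos (hd 1 2 (by decide)) (hd 2 0 (by decide)) (hd 1 0 (by decide))]
    exact ⟨rfl, rfl⟩

lemma IsConvexGon.injective {n : ℕ} {v : Fin n → S2} {V : Set S2} (hV : IsConvexGon v V) :
    Function.Injective v := fun i j hij => by
  by_contra hne
  exact hV.notMem_hull i (subset_hull _ ⟨j, fun h => hne h.symm, hij.symm⟩)

lemma IsConvexGon.diam_eq_arccos {n : ℕ} {v : Fin n → S2} {V : Set S2} (hV : IsConvexGon v V)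
    (hred : IsReduced V) (hth : thickness V < Real.pi / 2) :
    ∃ η : ℝ, 0 ≤ η ∧ η ≤ 1 ∧ diam V = Real.arccos (Real.cos (thickness V) * η) ∧
      0 ≤ 2 * η ^ 2 - Real.cos (thickness V) * η - 1 ∧
      (n ≠ 3 → 0 < 2 * η ^ 2 - Real.cos (thickness V) * η - 1) ∧
      (n = 3 → 2 * η ^ 2 - Real.cos (thickness V) * η - 1 = 0 ∧ IsRegularTriangle V) := by
  obtain ⟨k, w, g, h, t, rfl, H, hwv, hvw, hcomb⟩ := hV.exists_reducedSystem hred hth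
  obtain ⟨i, hi⟩ := H.exists_min_inner
  refine ⟨⟪t i, w (i + k + 1)⟫, H.foot_cos_nonneg i,
    (abs_le.1 (abs_inner_le_one (H.t_unit i) (H.poly.unit _))).2, ?_, (H.foot_cos_bound i).1,
    fun hn => (H.foot_cos_bound i).2 (by have := H.one_le; omega), fun hn => ?_⟩
  · obtain ⟨a, ha⟩ := hwv i
    obtain ⟨b, hb⟩ := hwv (i + k + 1)
    refine SphericalPolygon.diam_eq_arccos (fun i => ?_) hcomb
      (mul_nonneg H.C_pos.le (H.foot_cos_nonneg i)) (fun a b => ?_) (i := a) (j := b) ?_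
    · rw [hV.eq_hull]; exact subset_hull _ (Set.mem_range_self i)
    · obtain ⟨x, hx⟩ := hvw a
      obtain ⟨y, hy⟩ := hvw b
      rw [← hx, ← hy]
      exact hi x y
    · rw [← ha, ← hb, H.inner_far]
  · obtain rfl : k = 1 := by omega
    refine ⟨H.triangle_foot i, isRegularTriangle_of_inner hV (d := ⟪w 0, w 1⟫) fun a b hab => ?_⟩
    obtain ⟨x, hx⟩ := hvw a
    obtain ⟨y, hy⟩ := hvw b
    rw [← hx, ← hy]
    exact H.triangle_inner_eq fun hxy => hab (hV.injective (Subtype.ext (by rw [← hx, ← hy, hxy])))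

lemma two_mul_arccos {C y : ℝ} (hy : 0 ≤ y) (hy1 : y ≤ 1) (h : 2 * y ^ 2 - C * y - 1 = 0) :
    2 * Real.arccos y = Real.arccos (C * y) := by
  have h1 := Real.arccos_le_pi_div_two.2 hy
  rw [← Real.arccos_cos (x := 2 * Real.arccos y) (by linarith [Real.arccos_nonneg y])
    (by linarith), Real.cos_two_mul, Real.cos_arccos (by linarith) hy1]
  congr 1; linarith

/-- With s = √(C² + 8) one has (s − C)(s + C) = 8, so 1/(2 sin γ) = (C + s)/4, the positive root of
the quadratic. -/
lemma exists_root {C : ℝ} (hC0 : 0 < C) (hC1 : C ≤ 1) :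
    ∃ y, 1 / (2 * Real.sin (Real.arcsin ((-C + √(C ^ 2 + 8)) / 4))) = y ∧ C < 2 * y ∧ y ≤ 1 ∧
      2 * y ^ 2 - C * y - 1 = 0 := by
  have hs := Real.sq_sqrt (by positivity : 0 ≤ C ^ 2 + 8)
  have hs0 := Real.sqrt_nonneg (C ^ 2 + 8)
  set s := √(C ^ 2 + 8)
  have h1 : C < s := by nlinarith
  have h2 : s ≤ 4 - C := by nlinarith
  refine ⟨(C + s) / 4, ?_, by linarith, by linarith, by linear_combination hs / 8⟩
  rw [Real.sin_arcsin (by linarith) (by linarith), div_eq_iff (by linarith)]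
  linear_combination - hs / 8

end SphericalPolygon

end

theorem theorem4p3 (n : ℕ) (v : Fin n → SphericalPolygon.S2) (V : Set SphericalPolygon.S2)
    (hV : SphericalPolygon.IsConvexGon v V) (hred : SphericalPolygon.IsReduced V)
    (hthick : SphericalPolygon.thickness V < Real.pi / 2)
    (γ : ℝ)
    (hγ : γ = Real.arcsin ((-Real.cos (SphericalPolygon.thickness V) +
      √(Real.cos (SphericalPolygon.thickness V) ^ 2 + 8)) / 4)) :
    SphericalPolygon.diam V ≤ 2 * Real.arccos (1 / (2 * Real.sin γ)) ∧
      (SphericalPolygon.diam V = 2 * Real.arccos (1 / (2 * Real.sin γ)) ↔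
        SphericalPolygon.IsRegularTriangle V) := by
  have hC : 0 < Real.cos (SphericalPolygon.thickness V) := Real.cos_pos_of_mem_Ioo
    ⟨by linarith [SphericalPolygon.thickness_nonneg V, Real.pi_pos], hthick⟩
  obtain ⟨y, hy, hCy, hy1, hroot⟩ := SphericalPolygon.exists_root hC (Real.cos_le_one _)
  obtain ⟨η, h0, h1, hdiam, hge, hlt, hreg⟩ := hV.diam_eq_arccos hred hthick
  subst hγ
  set C := Real.cos (SphericalPolygon.thickness V)
  have hfac : ∀ x, 2 * x ^ 2 - C * x - 1 = (x - y) * (2 * (x + y) - C) := fun x => by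
    linear_combination hroot
  have hpos : 0 < 2 * (η + y) - C := by linarith
  have hmul : ∀ x, 0 ≤ x → x ≤ 1 → C * x ∈ Set.Icc (-1 : ℝ) 1 := fun x hx hx1 =>
    ⟨by linarith [mul_nonneg hC.le hx], mul_le_one₀ (Real.cos_le_one _) hx hx1⟩
  have hy0 : 0 ≤ y := by linarith
  rw [hy, SphericalPolygon.two_mul_arccos hy0 hy1 hroot]
  refine ⟨?_, fun heq => ?_, fun ⟨v', hV', _⟩ => ?_⟩
  · rw [hdiam]
    rw [hfac] at hge
    exact Real.arccos_le_arccos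
      (mul_le_mul_of_nonneg_left (by linarith [nonneg_of_mul_nonneg_left hge hpos]) hC.le)
  · rw [hdiam] at heq
    have := mul_left_cancel₀ hC.ne' (Real.arccos_injOn (hmul η h0 h1) (hmul y hy0 hy1) heq)
    by_cases hn : n = 3
    · exact (hreg hn).2
    · have := hlt hn
      rw [hfac, ‹η = y›, sub_self, zero_mul] at this
      exact absurd this (lt_irrefl _)
  -- The description of V by three vertices is used here in place of the given one, so nothing about
  -- `n` is needed.
  · obtain ⟨ξ, hξ0, -, hξ, -, -, hξ'⟩ := hV'.diam_eq_arccos hred hthick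
    have := (hξ' rfl).1
    rw [hfac] at this
    rw [hξ, sub_eq_zero.1 ((mul_eq_zero.1 this).resolve_right (by linarith))]
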